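/- **Setting.** Let $\mathfrak g$ be one of the simply-laced split real Kac–Moody algebras $AE_d$ ($d>3$), $E_{10}$, $DE_{10}$ (put $d=10$ for the last two), given by its Chevalley–Serre presentation with generators $e_i,f_i,h_i$ ($1\le i\le d$). Let $\omega$ be the Cartan–Chevalley involution $e_i\mapsto -f_i$, $f_i\mapsto -e_i$, $h_i\mapsto -h_i$, let $K(\mathfrak g)=\{x:\omega(x)=x\}$ and $x_i=e_i-f_i\in K(\mathfrak g)$. Roots are expanded as $\alpha=\sum_a\alpha_a e^a$ in a basis $e^a$ of $\mathfrak h^*\cong\mathbb R^d$ with $e^a\cdot e^b=G^{ab}$; $G_{ab}$ is the inverse matrix and $\alpha^a=G^{ab}\alpha_b$. Metrics and simple roots are: * $AE_d$ (a line of nodes $1,\dots,d-1$, and node $d$ joined to nodes $2$ and $d-1$): $G^{ab}=\delta^{ab}-\frac1{d-1}$; $\alpha_i=(0,\dots,0,1,-1,0,\dots,0)$ with the $1$ in position $i$, for $i<d$; $\alpha_d=(0,0,1,\dots,1,2)$. * $E_{10}$ (a line of nodes $1,\dots,9$, and node $10$ joined to node $7$): $G^{ab}=\delta^{ab}-\frac19$;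 $\alpha_i$ as above for $i\le 9$; $\alpha_{10}=(0,\dots,0,1,1,1)$. * $DE_{10}$ (a line of nodes $1,\dots,8$, node $9$ joined to node $7$, node $10$ joined to node $3$): $G^{ab}=\delta^{ab}-\frac18$ for $a,b\le 9$, $G^{10,a}=G^{a,10}=0$ for $a\le 9$, $G^{10,10}=2$; $\alpha_i$ as above for $i\le 8$; $\alpha_9=(0,\dots,0,1,1\,|\,\frac12)$; $\alpha_{10}=(0,0,0,1,\dots,1\,|\,-\frac12)$. A real root is an image of a simple root under the Weyl group. For $\alpha$ in the root lattice, with wall components $(p_1,\dots,p_d)$, define $\Gamma(\alpha)$ on $W=\mathbb R^N$ ($N$ arbitrary) as follows. * $AE_d$: $\Gamma(\alpha)=\Gamma_1^{p_1}\cdots\Gamma_d^{p_d}\,\Gamma_*^{\frac1{d-1}\sum_a p_a}$, where $\Gamma_*=\Gamma_0\Gamma_1\cdots\Gamma_d$ and $\Gamma_0,\dots,\Gamma_d$ are any real $N\times N$ matrices with $\{\Gamma_\mu,\Gamma_\nu\}=2\eta_{\mu\nu}$, $\eta=\mathrm{diag}(-1,1,\dots,1)$. * $E_{10}$: $\Gamma(\alpha)=\Gamma_1^{p_1}\cdots\Gamma_{10}^{p_{10}}$,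 and $DE_{10}$: $\Gamma(\alpha)=\Gamma_1^{p_1}\cdots\Gamma_9^{p_9}$, for any real $N\times N$ matrices with $\{\Gamma_a,\Gamma_b\}=2\delta_{ab}$. Round brackets around indices denote symmetrisation of strength one. Consider the polarisation tensors (with a choice of sign $\pm$ in the third, the same throughout) $$X(\alpha)_a{}^b=-\tfrac12\alpha_a\alpha^b+\tfrac14\delta_a{}^b ,$$ $$X(\alpha)_{ab}{}^{cd}=\tfrac12\alpha_a\alpha_b\alpha^c\alpha^d-\alpha_{(a}\delta_{b)}{}^{(c}\alpha^{d)}+\tfrac14\delta_a^{(c}\delta_b^{d)} ,$$ $$\begin{aligned}X(\alpha)_{abc}{}^{def}={}&-\tfrac13\alpha_a\alpha_b\alpha_c\alpha^d\alpha^e\alpha^f+\tfrac32\alpha_{(a}\alpha_b\delta_{c)}^{(d}\alpha^e\alpha^{f)}-\tfrac32\alpha_{(a}\delta_b^{(d}\delta_{c)}^e\alpha^{f)}+\tfrac14\delta_{(a}^{(d}\delta_b^e\delta_{c)}^{f)}\\&+\frac{14+d\pm2\sqrt{6(8+d)}}{(2+d)^2}\,\alpha_{(a}G_{bc)}G^{(de}\alpha^{f)}\\&-\frac{6\pm\sqrt{6(8+d)}}{6(2+d)}\Bigl(\alpha_{(a}\alpha_b\alpha_{c)}G^{(de}\alpha^{f)}+\alpha_{(a}G_{bc)}\alpha^{(d}\alpha^e\alpha^{f)}\Bigr),\end{aligned}$$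 acting on $V=\mathrm{Sym}^s\mathfrak h^*$ for $s=1,2,3$ respectively (products contract upper with lower indices). **Statement.** For each of these algebras: 1. $\alpha_i\cdot\alpha_j$ is the $(i,j)$ entry of the Cartan matrix, and each of the tensors $X$ above satisfies, for all real roots $\alpha,\beta$, $$\{X(\alpha),X(\beta)\}=\tfrac12X(\alpha\pm\beta)\ \text{ if }\alpha\cdot\beta=\mp1,\qquad [X(\alpha),X(\beta)]=0\ \text{ if }\alpha\cdot\beta=0 .$$ 2. For each of these $X$ (spin $\frac32$, $\frac52$, and $\frac72$ with either sign) the operators $J(\alpha)=-2X(\alpha)\otimes\Gamma(\alpha)$ on $V\otimes W$ satisfy, for all real roots $\alpha,\beta$, the Berman relations $[J(\alpha),[J(\alpha),J(\beta)]]+J(\beta)=0$ if $\alpha\cdot\beta=\pm1$ and $[J(\alpha),J(\beta)]=0$ if $\alpha\cdot\beta=0$; and there is a Lie algebra representation $\rho$ of $K(\mathfrak g)$ on $V\otimes W$ with $\rho(x_i)=J(\alpha_i)$ for all $i$. 3. For spin $\frac52$, the space of pure traces $\{G_{ab}\psi:\psi\in W\}$ and the kernel of the $G$-trace $\phi\mapsto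 G^{ab}\phi_{ab}$ are complementary subrepresentations of $V\otimes W$, and the former is isomorphic to the spin-$\frac12$ representation of $K(\mathfrak g)$ on $W$, given by $x_i\mapsto\frac12\Gamma(\alpha_i)$. -/

import Mathlib

attribute [local instance] LieRing.ofAssociativeRing LieAlgebra.ofAssociativeAlgebra

noncomputable section

/-! ### Split real Kac–Moody algebras and their maximal compact subalgebras

Mathlib's `Matrix.ToLieAlgebra ℝ A` is the Lie algebra on generators `h_i, e_i, f_i` subject to the
Chevalley–Serre relations of the generalised Cartan matrix `A`. -/

namespace KacMoody

open CartanMatrix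

variable {I : Type} [DecidableEq I] (A : Matrix I I ℤ)

/-- The quotient map from the free Lie algebra, as a Lie algebra morphism. -/
def proj : FreeLieAlgebra ℝ (Generators I) →ₗ⁅ℝ⁆ Matrix.ToLieAlgebra ℝ A :=
  { (Relations.toIdeal ℝ A).toSubmodule.mkQ with
    map_lie' := fun {_ _} => rfl }

/-- The Chevalley generators. -/
def e (i : I) : Matrix.ToLieAlgebra ℝ A := proj A (FreeLieAlgebra.of ℝ (Generators.E i))
def f (i : I) : Matrix.ToLieAlgebra ℝ A := proj A (FreeLieAlgebra.of ℝ (Generators.F i))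
def h (i : I) : Matrix.ToLieAlgebra ℝ A := proj A (FreeLieAlgebra.of ℝ (Generators.H i))

theorem proj_eq_zero {y : FreeLieAlgebra ℝ (Generators I)} (hy : y ∈ Relations.toSet ℝ A) :
    proj A y = 0 :=
  (Submodule.Quotient.mk_eq_zero (Relations.toIdeal ℝ A).toSubmodule).2
    (LieSubmodule.subset_lieSpan hy)

/-- The Cartan–Chevalley involution on the free Lie algebra, with values in the quotient. -/
def involutionFree : FreeLieAlgebra ℝ (Generators I) →ₗ⁅ℝ⁆ Matrix.ToLieAlgebra ℝ A :=
  FreeLieAlgebra.lift ℝ fun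
    | Generators.H i => - h A i
    | Generators.E i => - f A i
    | Generators.F i => - e A i

@[simp] theorem involutionFree_H (i : I) :
    involutionFree A (FreeLieAlgebra.of ℝ (Generators.H i)) = - h A i := by
  simp [involutionFree]
@[simp] theorem involutionFree_E (i : I) :
    involutionFree A (FreeLieAlgebra.of ℝ (Generators.E i)) = - f A i := by
  simp [involutionFree]
@[simp] theorem involutionFree_F (i : I) :
    involutionFree A (FreeLieAlgebra.of ℝ (Generators.F i)) = - e A i := by
  simp [involutionFree]

theorem map_ad_pow {L L' : Type} [LieRing L] [LieAlgebra ℝ L] [LieRing L'] [LieAlgebra ℝ L']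
    (φ : L →ₗ⁅ℝ⁆ L') (x y : L) (n : ℕ) :
    φ (((LieAlgebra.ad ℝ L x) ^ n) y) = ((LieAlgebra.ad ℝ L' (φ x)) ^ n) (φ y) := by
  induction n with
  | zero => simp
  | succ n ih => rw [pow_succ', pow_succ']; simp [ih]

theorem ad_neg_pow {L : Type} [LieRing L] [LieAlgebra ℝ L] (x y : L) (n : ℕ)
    (hxy : ((LieAlgebra.ad ℝ L x) ^ n) y = 0) : ((LieAlgebra.ad ℝ L (-x)) ^ n) y = 0 := by
  rw [map_neg, neg_pow]
  rcases neg_one_pow_eq_or (Module.End ℝ L) n with hn | hn <;> simp [hn, hxy]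

theorem involutionFree_eq_zero (y : FreeLieAlgebra ℝ (Generators I))
    (hy : y ∈ Relations.toSet ℝ A) : involutionFree A y = 0 := by
  rcases hy with ((((⟨⟨i, j⟩, rfl⟩ | ⟨⟨i, j⟩, rfl⟩) | ⟨⟨i, j⟩, rfl⟩) | ⟨⟨i, j⟩, rfl⟩) |
    ⟨⟨i, j⟩, rfl⟩) | ⟨⟨i, j⟩, rfl⟩
  · have := proj_eq_zero A (y := Relations.HH ℝ (i, j)) (by simp [Relations.toSet])
    simpa [Relations.HH, h] using this
  · have := proj_eq_zero A (y := Relations.EF ℝ (j, i)) (by simp [Relations.toSet])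
    by_cases hij : i = j
    · subst hij
      simp only [Relations.EF, Function.uncurry, if_true, map_sub, LieHom.map_lie,
        Function.comp, involutionFree_E, involutionFree_F, involutionFree_H] at this ⊢
      change ⁅e A i, f A i⁆ - h A i = 0 at this
      rw [sub_eq_zero] at this
      rw [neg_lie, lie_neg, neg_neg, ← lie_skew, this]; simp
    · simp only [Relations.EF, Function.uncurry, if_neg hij, if_neg (Ne.symm hij),
        LieHom.map_lie, Function.comp, involutionFree_E, involutionFree_F] at this ⊢
      change ⁅e A j, f A i⁆ = 0 at this
      rw [neg_lie, lie_neg, neg_neg, ← lie_skew, this]; simp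
  · have := proj_eq_zero A (y := Relations.HF ℝ A (i, j)) (by simp [Relations.toSet])
    simp only [Relations.HF, Relations.HE, Function.uncurry, map_sub, map_add,
      LieHom.map_lie, map_zsmul, Function.comp, involutionFree_E, involutionFree_H] at this ⊢
    change ⁅h A i, f A j⁆ + A i j • f A j = 0 at this
    rw [neg_lie, lie_neg, neg_neg, smul_neg, sub_neg_eq_add, this]
  · have := proj_eq_zero A (y := Relations.HE ℝ A (i, j)) (by simp [Relations.toSet])
    simp only [Relations.HF, Relations.HE, Function.uncurry, map_sub, map_add,
      LieHom.map_lie, map_zsmul, Function.comp, involutionFree_F, involutionFree_H] at this ⊢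
    change ⁅h A i, e A j⁆ - A i j • e A j = 0 at this
    rw [neg_lie, lie_neg, neg_neg, smul_neg, ← sub_eq_add_neg, this]
  · have := proj_eq_zero A (y := Relations.adF ℝ A (i, j)) (by simp [Relations.toSet])
    simp only [Relations.adF, Relations.adE, Function.uncurry, map_ad_pow, LieHom.map_lie,
      Function.comp, involutionFree_E] at this ⊢
    rw [neg_lie, lie_neg, neg_neg]
    exact ad_neg_pow _ _ _ this
  · have := proj_eq_zero A (y := Relations.adE ℝ A (i, j)) (by simp [Relations.toSet])
    simp only [Relations.adF, Relations.adE, Function.uncurry, map_ad_pow, LieHom.map_lie,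
      Function.comp, involutionFree_F] at this ⊢
    rw [neg_lie, lie_neg, neg_neg]
    exact ad_neg_pow _ _ _ this

theorem toIdeal_le_ker : Relations.toIdeal ℝ A ≤ (involutionFree A).ker :=
  LieSubmodule.lieSpan_le.2 fun y hy => by
    simpa using involutionFree_eq_zero A y hy

/-- The Cartan–Chevalley involution `ω` of the Kac–Moody algebra:
`ω e_i = -f_i`, `ω f_i = -e_i`, `ω h_i = -h_i`. -/
def involution : Matrix.ToLieAlgebra ℝ A →ₗ⁅ℝ⁆ Matrix.ToLieAlgebra ℝ A :=
  { (Relations.toIdeal ℝ A).toSubmodule.liftQ (involutionFree A).toLinearMap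
      (fun y hy => by simpa using toIdeal_le_ker A hy) with
    map_lie' := by
      intro x y
      induction x using Submodule.Quotient.induction_on
      induction y using Submodule.Quotient.induction_on
      exact (involutionFree A).map_lie _ _ }

theorem involution_e (i : I) : involution A (e A i) = - f A i := involutionFree_E A i
theorem involution_f (i : I) : involution A (f A i) = - e A i := involutionFree_F A i
theorem involution_h (i : I) : involution A (h A i) = - h A i := involutionFree_H A i

/-- The maximal compact subalgebra `K(𝔤(A))`: the fixed points of `ω`. -/
def maximalCompact : LieSubalgebra ℝ (Matrix.ToLieAlgebra ℝ A) where
  carrier := {x | involution A x = x}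
  add_mem' := by intro a b ha hb; simp_all
  zero_mem' := by simp
  smul_mem' := by intro c a ha; simp_all
  lie_mem' := by intro a b ha hb; simp_all

/-- The Berman generator `x_i = e_i - f_i` of `K(𝔤(A))`. -/
def bermanGenerator (i : I) : maximalCompact A :=
  ⟨e A i - f A i, by
    change involution A _ = _
    rw [map_sub, involution_e, involution_f]; abel⟩

/-- Real roots, i.e. the images of the simple roots under the Weyl group. Elements of the root
lattice `⨁ ℤ α_i` are written as their coefficient families over the simple roots; the `i`-th
fundamental reflection is `α ↦ α - α(h_i) α_i`, where `α_j(h_i) = A i j`. -/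
inductive IsRealRoot [Fintype I] (A : Matrix I I ℤ) : (I → ℤ) → Prop
  | simple (i : I) : IsRealRoot A (Pi.single i 1)
  | reflect (i : I) (m : I → ℤ) :
      IsRealRoot A m → IsRealRoot A (m - (∑ j, A i j * m j) • Pi.single i 1)

end KacMoody

/-! ### Wall bases and polarisation tensors -/

namespace Spin

/-- A simply-laced algebra of rank `d` realised in a wall basis `e^a` of `𝔥*`. -/
structure WallData (d : ℕ) where
  /-- the Cartan matrix -/
  cartan : Matrix (Fin d) (Fin d) ℤ
  /-- the DeWitt metric `G^{ab} = e^a · e^b` -/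
  metric : Matrix (Fin d) (Fin d) ℝ
  metric_symm : metric.IsSymm
  /-- `simpleRoot i a` is the component `(α_i)_a` in `α_i = ∑ a, (α_i)_a e^a` -/
  simpleRoot : Fin d → Fin d → ℝ

namespace WallData

variable {d : ℕ} (D : WallData d)

/-- Wall components `α_a` of the root lattice element `∑ i, m i • α_i`. -/
def wall (m : Fin d → ℤ) (a : Fin d) : ℝ := ∑ i, (m i : ℝ) * D.simpleRoot i a

/-- The raised components `v^a = G^{ab} v_b`. -/
def raise (v : Fin d → ℝ) (a : Fin d) : ℝ := ∑ b, D.metric a b * v b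

/-- The inner product `v · w = G^{ab} v_a w_b` on `𝔥*`. -/
def dot (v w : Fin d → ℝ) : ℝ := ∑ a, v a * D.raise w a

/-- The inverse metric `G_{ab}`. -/
def lowMetric : Matrix (Fin d) (Fin d) ℝ := D.metric⁻¹

theorem lowMetric_symm : D.lowMetric.IsSymm := D.metric_symm.inv

end WallData

/-- Tensors `T_{a₁…a_s}{}^{b₁…b_s}`, as matrices: the lower indices label the rows and the upper
ones the columns, so that matrix multiplication contracts upper with lower indices. -/
abbrev Tensor (s d : ℕ) := Matrix (Fin s → Fin d) (Fin s → Fin d) ℝ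

/-- Strength-one symmetrisation in the lower and in the upper indices. -/
def symmetrise {s d : ℕ} (T : Tensor s d) : Tensor s d := fun A B =>
  (1 / (s.factorial : ℝ) ^ 2) *
    ∑ σ : Equiv.Perm (Fin s), ∑ τ : Equiv.Perm (Fin s), T (A ∘ σ) (B ∘ τ)

/-- The Kronecker delta. -/
def delta {d : ℕ} (a b : Fin d) : ℝ := if a = b then 1 else 0

section Polarisation

variable {d : ℕ} (D : WallData d) (α : Fin d → ℝ)

/-- `-½ α_a α^b + ¼ δ_a^b`. -/
def pol32 : Tensor 1 d := symmetrise fun A B =>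
  -(1 / 2) * α (A 0) * D.raise α (B 0) + 1 / 4 * delta (A 0) (B 0)

/-- `½ α_a α_b α^c α^d - α_(a δ_b)^(c α^d) + ¼ δ_a^(c δ_b^d)`. -/
def pol52 : Tensor 2 d := symmetrise fun A B =>
  1 / 2 * (α (A 0) * α (A 1) * D.raise α (B 0) * D.raise α (B 1))
  - α (A 0) * delta (A 1) (B 0) * D.raise α (B 1)
  + 1 / 4 * (delta (A 0) (B 0) * delta (A 1) (B 1))

/-- The spin-7/2 tensor; `ε = ±1` is the choice of sign in front of the square roots. -/
def pol72 (ε : ℝ) : Tensor 3 d := symmetrise fun A B =>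
  -(1 / 3) * (α (A 0) * α (A 1) * α (A 2) * D.raise α (B 0) * D.raise α (B 1) * D.raise α (B 2))
  + 3 / 2 * (α (A 0) * α (A 1) * delta (A 2) (B 0) * D.raise α (B 1) * D.raise α (B 2))
  - 3 / 2 * (α (A 0) * delta (A 1) (B 0) * delta (A 2) (B 1) * D.raise α (B 2))
  + 1 / 4 * (delta (A 0) (B 0) * delta (A 1) (B 1) * delta (A 2) (B 2))
  + (14 + d + ε * (2 * Real.sqrt (6 * (8 + d)))) / (2 + d) ^ 2 *
      (α (A 0) * D.lowMetric (A 1) (A 2) * D.metric (B 0) (B 1) * D.raise α (B 2))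
  - (6 + ε * Real.sqrt (6 * (8 + d))) / (6 * (2 + d)) *
      (α (A 0) * α (A 1) * α (A 2) * D.metric (B 0) (B 1) * D.raise α (B 2)
        + α (A 0) * D.lowMetric (A 1) (A 2) * D.raise α (B 0) * D.raise α (B 1) * D.raise α (B 2))

end Polarisation

/-- The conditions `{X(α), X(β)} = ½ X(α ± β)` if `α · β = ∓1` and `[X(α), X(β)] = 0` if
`α · β = 0`, for all real roots `α, β`. -/
def SolvesPolarisationEquations {s d : ℕ} (D : WallData d) (X : (Fin d → ℝ) → Tensor s d) : Prop :=
  ∀ m m' : Fin d → ℤ, KacMoody.IsRealRoot D.cartan m → KacMoody.IsRealRoot D.cartan m' →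
    (D.dot (D.wall m) (D.wall m') = -1 →
      X (D.wall m) * X (D.wall m') + X (D.wall m') * X (D.wall m)
        = (1 / 2 : ℝ) • X (D.wall m + D.wall m')) ∧
    (D.dot (D.wall m) (D.wall m') = 1 →
      X (D.wall m) * X (D.wall m') + X (D.wall m') * X (D.wall m)
        = (1 / 2 : ℝ) • X (D.wall m - D.wall m')) ∧
    (D.dot (D.wall m) (D.wall m') = 0 →
      X (D.wall m) * X (D.wall m') - X (D.wall m') * X (D.wall m) = 0)

/-! ### The representation spaces and operators -/

/-- `V = Sym^s 𝔥*`: symmetric tensors `φ_{a₁…a_s}` (components in the wall basis). -/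
def SymTensor (s d : ℕ) : Submodule ℝ ((Fin s → Fin d) → ℝ) where
  carrier := {φ | ∀ (σ : Equiv.Perm (Fin s)) (A : Fin s → Fin d), φ (A ∘ σ) = φ A}
  add_mem' := by intro a b ha hb σ A; simp [ha σ A, hb σ A]
  zero_mem' := by intro σ A; rfl
  smul_mem' := by intro c a ha σ A; simp [ha σ A]

/-- The symmetric part of a tensor acting on symmetric tensors,
`(T φ)_A = ∑ B, T_(A)^(B) φ_B`. -/
def act {s d : ℕ} (T : Tensor s d) : Module.End ℝ (SymTensor s d) :=
  (Matrix.mulVecLin (symmetrise T)).restrict (fun φ _ σ A => by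
    simp only [Matrix.mulVecLin_apply, Matrix.mulVec, dotProduct]
    refine Finset.sum_congr rfl fun B _ => ?_
    congr 1
    simp only [symmetrise]
    congr 1
    exact Fintype.sum_equiv (Equiv.mulLeft σ) _ _ fun _ => rfl)

/-- The representation space `V ⊗ W` with `W = ℝ^N`. -/
abbrev SpinorTensor (s d N : ℕ) := TensorProduct ℝ (SymTensor s d) (Fin N → ℝ)

/-- The operator `J = -2 X ⊗ Γ` on `V ⊗ W`. -/
def spinOperator {s d N : ℕ} (X : Tensor s d) (Γ : Matrix (Fin N) (Fin N) ℝ) :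
    Module.End ℝ (SpinorTensor s d N) :=
  (-2 : ℝ) • TensorProduct.map (act X) (Matrix.toLin' Γ)

/-- The family `J(α) = -2 X(α) ⊗ Γ(α)`, for root lattice elements `α`. -/
def spinFamily {s d N : ℕ} (D : WallData d) (X : (Fin d → ℝ) → Tensor s d)
    (Γ : (Fin d → ℤ) → Matrix (Fin N) (Fin N) ℝ) (m : Fin d → ℤ) :
    Module.End ℝ (SpinorTensor s d N) :=
  spinOperator (X (D.wall m)) (Γ m)

/-- The spin-1/2 family `J(α) = ½ Γ(α)` on `W`. -/
def spinHalfFamily {d N : ℕ} (Γ : (Fin d → ℤ) → Matrix (Fin N) (Fin N) ℝ) (m : Fin d → ℤ) :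
    Module.End ℝ (Fin N → ℝ) :=
  (1 / 2 : ℝ) • Matrix.toLin' (Γ m)

/-- The Berman relations of a simply-laced algebra for a family `J(α)`, over all real roots. -/
def SatisfiesBerman {d : ℕ} (D : WallData d) (M : Type) [AddCommGroup M] [Module ℝ M]
    (J : (Fin d → ℤ) → Module.End ℝ M) : Prop :=
  ∀ m m' : Fin d → ℤ, KacMoody.IsRealRoot D.cartan m → KacMoody.IsRealRoot D.cartan m' →
    ((D.dot (D.wall m) (D.wall m') = -1 ∨ D.dot (D.wall m) (D.wall m') = 1) →
      ⁅J m, ⁅J m, J m'⁆⁆ + J m' = 0) ∧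
    (D.dot (D.wall m) (D.wall m') = 0 → ⁅J m, J m'⁆ = 0)

/-- A representation `ρ` of `K(𝔤)` whose value on each Berman generator `x_i` is `J(α_i)`. -/
def IsRepresentationBy {d : ℕ} (D : WallData d) (M : Type) [AddCommGroup M] [Module ℝ M]
    (J : (Fin d → ℤ) → Module.End ℝ M)
    (ρ : KacMoody.maximalCompact D.cartan →ₗ⁅ℝ⁆ Module.End ℝ M) : Prop :=
  ∀ i, ρ (KacMoody.bermanGenerator D.cartan i) = J (Pi.single i 1)

section Trace

variable {d : ℕ} (D : WallData d) (N : ℕ)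

/-- The contraction `φ ↦ G^{ab} φ_{ab}`. -/
def contract : SymTensor 2 d →ₗ[ℝ] ℝ :=
  (∑ a, ∑ b, D.metric a b • LinearMap.proj (R := ℝ) (φ := fun _ => ℝ) ![a, b]) ∘ₗ
    (SymTensor 2 d).subtype

/-- The metric `G_{ab}` as a symmetric tensor. -/
def metricTensor : SymTensor 2 d :=
  ⟨fun A => D.lowMetric (A 0) (A 1), by
    intro σ A
    have key : ∀ i j : Fin 2, i ≠ j →
        D.lowMetric (A i) (A j) = D.lowMetric (A 0) (A 1) := by
      intro i j hij
      fin_cases i <;> fin_cases j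
      · exact absurd rfl hij
      · rfl
      · exact D.lowMetric_symm.apply (A 0) (A 1)
      · exact absurd rfl hij
    exact key (σ 0) (σ 1) (fun hh => absurd (σ.injective hh) (by decide))⟩

/-- The `G`-trace of a spin-5/2 spinor, `φ ↦ G^{ab} φ_{ab}`, with values in `W`. -/
def gTrace : SpinorTensor 2 d N →ₗ[ℝ] (Fin N → ℝ) :=
  (TensorProduct.lid ℝ (Fin N → ℝ)).toLinearMap ∘ₗ TensorProduct.map (contract D) LinearMap.id

/-- The subspace of pure `G`-trace elements `G_{ab} ψ`, `ψ ∈ W`. -/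
def pureTrace : Submodule ℝ (SpinorTensor 2 d N) :=
  LinearMap.range (TensorProduct.mk ℝ (SymTensor 2 d) (Fin N → ℝ) (metricTensor D))

end Trace

/-! ### The algebras `AE_d`, `E₁₀`, `DE₁₀`

Nodes and wall components are numbered from `0`. -/

/-- The simply-laced Cartan matrix of a Dynkin diagram; `edge i j` lists each edge once. -/
def dynkinCartan (d : ℕ) (edge : ℕ → ℕ → Bool) : Matrix (Fin d) (Fin d) ℤ := fun i j =>
  if i = j then 2 else if edge i j || edge j i then -1 else 0

/-- Components of the root `(0,…,0,1,-1,0,…,0)` with `1` at position `i`. -/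
def chainRoot (i a : ℕ) : ℤ := if a = i then 1 else if a = i + 1 then -1 else 0

/-- Simple roots of `AE_d`: the last one is `(0,0,1,…,1,2)`. -/
def rootAE (d : ℕ) (i a : Fin d) : ℤ :=
  if (i : ℕ) + 1 < d then chainRoot i a
  else if (a : ℕ) < 2 then 0 else if (a : ℕ) + 1 < d then 1 else 2

/-- Simple roots of `E₁₀`: the last one is `(0,…,0,1,1,1)`. -/
def rootE10 (i a : Fin 10) : ℤ :=
  if (i : ℕ) < 9 then chainRoot i a else if 7 ≤ (a : ℕ) then 1 else 0

/-- First nine components of the simple roots of `DE₁₀`. -/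
def rootDE10 (i : Fin 10) (a : Fin 9) : ℤ :=
  if (i : ℕ) < 8 then chainRoot i a
  else if (i : ℕ) = 8 then (if 7 ≤ (a : ℕ) then 1 else 0)
  else if 3 ≤ (a : ℕ) then 1 else 0

/-- Tenth (dilaton) component of the simple roots of `DE₁₀`. -/
def dilatonDE10 (i : Fin 10) : ℝ :=
  if (i : ℕ) = 8 then 1 / 2 else if (i : ℕ) = 9 then -(1 / 2) else 0

/-- `AE_d`: a line of `d - 1` nodes, and a last node joined to the second and to the
`(d-1)`-st; `G^{ab} = δ^{ab} - 1/(d-1)`. -/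
def dataAE (d : ℕ) : WallData d where
  cartan := dynkinCartan d fun i j =>
    (j == i + 1 && decide (j + 1 < d)) || (j + 1 == d && (i == 1 || i + 2 == d))
  metric := fun a b => delta a b - 1 / ((d : ℝ) - 1)
  metric_symm := by
    refine Matrix.IsSymm.ext fun a b => ?_
    simp [delta, eq_comm]
  simpleRoot := fun i a => rootAE d i a

/-- `E₁₀`: a line of nine nodes, and a tenth node joined to the seventh;
`G^{ab} = δ^{ab} - 1/9`. -/
def dataE10 : WallData 10 where
  cartan := dynkinCartan 10 fun i j =>
    (j == i + 1 && decide (j < 9)) || (i == 6 && j == 9)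
  metric := fun a b => delta a b - 1 / 9
  metric_symm := by
    refine Matrix.IsSymm.ext fun a b => ?_
    simp [delta, eq_comm]
  simpleRoot := fun i a => rootE10 i a

/-- `DE₁₀`: a line of eight nodes, a ninth node joined to the seventh and a tenth joined to the
third; `G^{ab} = δ^{ab} - 1/8` on the first nine components, `G^{10,10} = 2`. -/
def dataDE10 : WallData 10 where
  cartan := dynkinCartan 10 fun i j =>
    (j == i + 1 && decide (j < 8)) || (i == 6 && j == 8) || (i == 2 && j == 9)
  metric := fun a b =>
    if (a : ℕ) < 9 ∧ (b : ℕ) < 9 then delta a b - 1 / 8 else 2 * delta a b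
  metric_symm := by
    refine Matrix.IsSymm.ext fun a b => ?_
    simp [delta, eq_comm, and_comm]
  simpleRoot := fun i a => if ha : (a : ℕ) < 9 then rootDE10 i ⟨a, ha⟩ else dilatonDE10 i

/-- The algebras considered: `AE_d` (`d > 3`), `E₁₀`, `DE₁₀`. -/
inductive IsListed : {d : ℕ} → WallData d → Prop
  | ae (d : ℕ) (hd : 3 < d) : IsListed (dataAE d)
  | e10 : IsListed dataE10
  | de10 : IsListed dataDE10

/-! ### Gamma matrices -/

/-- Real gamma matrices `γ_μ γ_ν + γ_ν γ_μ = 2 η_{μν}` for a diagonal `η`. -/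
def IsClifford {n N : ℕ} (η : Fin n → ℝ) (γ : Fin n → Matrix (Fin N) (Fin N) ℝ) : Prop :=
  ∀ μ ν, γ μ * γ ν + γ ν * γ μ = if μ = ν then (2 * η μ) • 1 else 0

/-- The ordered product `(γ₁)^{p₁} ⋯ (γₙ)^{pₙ}`. -/
def gammaMonomial {n N : ℕ} (γ : Fin n → Matrix (Fin N) (Fin N) ℝ) (p : Fin n → ℤ) :
    Matrix (Fin N) (Fin N) ℝ :=
  (List.ofFn fun a => γ a ^ p a).prod

/-- `Γ_* = Γ_0 Γ_1 ⋯ Γ_d`. -/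
def gammaStar {n N : ℕ} (γ : Fin n → Matrix (Fin N) (Fin N) ℝ) : Matrix (Fin N) (Fin N) ℝ :=
  (List.ofFn γ).prod

/-- Integral wall components `p_a` of the root lattice element `∑ i, m i • α_i`. -/
def components {d k : ℕ} (r : Fin d → Fin k → ℤ) (m : Fin d → ℤ) (a : Fin k) : ℤ :=
  ∑ i, m i * r i a

/-- `Γ(α) = (Γ_1)^{p_1} ⋯ (Γ_d)^{p_d} (Γ_*)^{(∑ p_a)/(d-1)}` for `AE_d`, where `γ 0 = Γ_0` is
time-like. On the root lattice `∑ p_a` is a multiple of `d - 1`. -/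
def gammaAE {d N : ℕ} (γ : Fin (d + 1) → Matrix (Fin N) (Fin N) ℝ) (m : Fin d → ℤ) :
    Matrix (Fin N) (Fin N) ℝ :=
  gammaMonomial (fun a : Fin d => γ a.succ) (components (rootAE d) m) *
    gammaStar γ ^ ((∑ a, components (rootAE d) m a) / ((d : ℤ) - 1))

/-- The gamma matrices `Γ(α)` attached to root lattice elements of the algebras considered,
built from an arbitrary real matrix representation of the respective Clifford algebra:
signature `(1,d)` for `AE_d`, ten Euclidean matrices for `E₁₀`, nine for `DE₁₀`. -/
inductive IsGamma : {d : ℕ} → WallData d → {N : ℕ} → ((Fin d → ℤ) → Matrix (Fin N) (Fin N) ℝ) → Prop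
  | ae (d : ℕ) (hd : 3 < d) (N : ℕ) (γ : Fin (d + 1) → Matrix (Fin N) (Fin N) ℝ)
      (hγ : IsClifford (Fin.cons (-1) fun _ => 1) γ) : IsGamma (dataAE d) (gammaAE γ)
  | e10 (N : ℕ) (γ : Fin 10 → Matrix (Fin N) (Fin N) ℝ) (hγ : IsClifford (fun _ => 1) γ) :
      IsGamma dataE10 fun m => gammaMonomial γ (components rootE10 m)
  | de10 (N : ℕ) (γ : Fin 9 → Matrix (Fin N) (Fin N) ℝ) (hγ : IsClifford (fun _ => 1) γ) :
      IsGamma dataDE10 fun m => gammaMonomial γ (components rootDE10 m)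

end Spin

end

noncomputable section

namespace KacMoody

open CartanMatrix

/-! ### Generation of the maximal compact subalgebra by the Berman generators -/

section Generation

variable {I : Type} [DecidableEq I] (A : Matrix I I ℤ)

/-! Polarisation. Let `r_α` be the reflection in `α` and `R_α` its action on `Sym^s`. The tensors
are quantised reflections: `X(α) = ½ R_α - ¼` for `s = 1, 2` (`pol32_eq`, `pol52_eq`), and `X(α) = ½
R_α - ¼ + ⅙ C_α ⊗ C^α` for `s = 3` with `C_α = α³ - k α G` (`pol72_eq`). If `α · β = -1`, the two
reflections generate a copy of `S₃`, and for `½ R - ¼` the anticommutator equation says that `1 +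
R_α R_β + R_β R_α - R_α - R_β - R_{α+β}` vanishes. This alternating sum is six times the projection
to the sign character, which first occurs in `Sym³`, spanned by `α β (α+β)`. So nothing is missing
for `s ≤ 2`, while for `s = 3` the defect has rank one and is a multiple of the square of `C_α + C_β
- C_{α+β} = -3 α β (α+β)`. Reflections permute the `C_α`, and `C^α · C_β = (α·β)³ + 2 α·β` once
`(d+2) k² - 12 k - 6 = 0`; the two roots `k` are the two sign choices, and with this pairing the
correction cancels the defect (`polarises_pol72`).

Berman relations. The matrices `Γ(α)` commute up to the sign `(-1)^{α·β}` and square to `-1` on real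
roots, by counting parities (`SpinHalf.of_signs`). Commutators of the `J(α)` therefore become
anticommutators of the `X(α)` when `α · β = ±1`, and using the polarisation equation twice returns
`-J(β)` (`berman_tensor`).

Extension to the whole algebra. `IsSimplyLaced.exists_representation` lets the Kac–Moody algebra act
on the lowest weight Verma module of weight zero, realised on words modulo Serre relations. The rule
`θ(k_i u) = J_i θ(u)`, `θ(1) = 1`, with `k_i = e_i - f_i`, defines `θ` on words recursively; it
kills the Serre relations because a Serre element in the `e_i` equals the Berman expression in the
`k_i` (`berman_sub`). Then `ρ(x) = θ(x · 1)`. Multiplicativity spreads from the generators because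
the `x_i` generate `K(𝔤)` (`maximalCompact_induction`).

Trace. Reflections fix `G`, so `X(α) G = ¼ G` and `J(α)` acts on pure traces by `-½ Γ(α)`, with the
wrong sign for spin ½. An invertible product of gamma matrices anticommuting with every `Γ(α_i)`
repairs the sign (`spin52_decomposition`). -/

theorem lie_h_e (i j : I) : ⁅h A i, e A j⁆ = (A i j : ℝ) • e A j := by
  have := proj_eq_zero A (y := Relations.HE ℝ A (i, j)) (by simp [Relations.toSet])
  simp only [Relations.HE, Function.uncurry, map_sub, LieHom.map_lie, map_zsmul,
    Function.comp] at this
  rw [Int.cast_smul_eq_zsmul]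
  exact sub_eq_zero.1 this

theorem lie_e_f (i j : I) : ⁅e A i, f A j⁆ = if i = j then h A i else 0 := by
  have := proj_eq_zero A (y := Relations.EF ℝ (i, j)) (by simp [Relations.toSet])
  split_ifs with hij
  · subst hij
    simp only [Relations.EF, Function.uncurry, if_true, map_sub, LieHom.map_lie,
      Function.comp] at this
    exact sub_eq_zero.1 this
  · simp only [Relations.EF, Function.uncurry, if_neg hij, LieHom.map_lie, Function.comp] at this
    exact this

theorem lie_h_f (i j : I) : ⁅h A i, f A j⁆ = -((A i j : ℝ) • f A j) := by
  have := proj_eq_zero A (y := Relations.HF ℝ A (i, j)) (by simp [Relations.toSet])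
  simp only [Relations.HF, Function.uncurry, map_add, LieHom.map_lie, map_zsmul,
    Function.comp] at this
  rw [Int.cast_smul_eq_zsmul]
  exact eq_neg_of_add_eq_zero_left this

theorem lie_h_h (i j : I) : ⁅h A i, h A j⁆ = 0 := by
  have := proj_eq_zero A (y := Relations.HH ℝ (i, j)) (by simp [Relations.toSet])
  simp only [Relations.HH, Function.uncurry, LieHom.map_lie, Function.comp] at this
  exact this

theorem involution_involution (x : Matrix.ToLieAlgebra ℝ A) :
    involution A (involution A x) = x := by
  obtain ⟨y, rfl⟩ : ∃ y, proj A y = x := Submodule.Quotient.mk_surjective _ x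
  have : ((involution A).comp (involution A)).comp (proj A) = proj A := by
    refine FreeLieAlgebra.hom_ext fun g => ?_
    cases g with
    | H i => change involution A (involution A (h A i)) = h A i; simp [involution_h]
    | E i => change involution A (involution A (e A i)) = e A i; simp [involution_e, involution_f]
    | F i => change involution A (involution A (f A i)) = f A i; simp [involution_e, involution_f]
  exact LieHom.congr_fun this y

/-- A Lie subalgebra containing the Chevalley generators is everything. -/
theorem mem_of_generators (S : LieSubalgebra ℝ (Matrix.ToLieAlgebra ℝ A))
    (hh : ∀ i, h A i ∈ S) (he : ∀ i, e A i ∈ S) (hf : ∀ i, f A i ∈ S)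
    (x : Matrix.ToLieAlgebra ℝ A) : x ∈ S := by
  obtain ⟨y, rfl⟩ : ∃ y, proj A y = x := Submodule.Quotient.mk_surjective _ x
  let g : Generators I → S := fun
    | Generators.H i => ⟨h A i, hh i⟩
    | Generators.E i => ⟨e A i, he i⟩
    | Generators.F i => ⟨f A i, hf i⟩
  have : S.incl.comp (FreeLieAlgebra.lift ℝ g) = proj A := by
    refine FreeLieAlgebra.hom_ext fun k => ?_
    rw [LieHom.comp_apply, FreeLieAlgebra.lift_of_apply]
    cases k <;> rfl
  rw [← this]
  exact (FreeLieAlgebra.lift ℝ g y).2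

/-- A subspace containing the Chevalley generators and stable under their adjoint action is
everything. -/
theorem mem_of_stable (W : Submodule ℝ (Matrix.ToLieAlgebra ℝ A))
    (he : ∀ i, e A i ∈ W) (hf : ∀ i, f A i ∈ W)
    (se : ∀ i, ∀ w ∈ W, ⁅e A i, w⁆ ∈ W) (sf : ∀ i, ∀ w ∈ W, ⁅f A i, w⁆ ∈ W)
    (x : Matrix.ToLieAlgebra ℝ A) : x ∈ W := by
  have hh : ∀ i, h A i ∈ W := fun i => by
    have := se i _ (hf i)
    rwa [lie_e_f, if_pos rfl] at this
  let S : LieSubalgebra ℝ (Matrix.ToLieAlgebra ℝ A) :=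
    { carrier := {y | ∀ w ∈ W, ⁅y, w⁆ ∈ W}
      add_mem' := fun {a b} ha hb w hw => by rw [add_lie]; exact W.add_mem (ha w hw) (hb w hw)
      zero_mem' := fun w _ => by rw [zero_lie]; exact W.zero_mem
      smul_mem' := fun c a ha w hw => by rw [smul_lie]; exact W.smul_mem c (ha w hw)
      lie_mem' := fun {a b} ha hb w hw => by
        rw [lie_lie]; exact W.sub_mem (ha _ (hb w hw)) (hb _ (ha w hw)) }
  have hS : ∀ y, y ∈ S := mem_of_generators A S (fun i w hw => by
      have : h A i = ⁅e A i, f A i⁆ := by rw [lie_e_f, if_pos rfl]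
      rw [this, lie_lie]
      exact W.sub_mem (se i _ (sf i w hw)) (sf i _ (se i w hw))) se sf
  let S' : LieSubalgebra ℝ (Matrix.ToLieAlgebra ℝ A) :=
    { W with lie_mem' := fun {a b} _ hb => hS a b hb }
  exact mem_of_generators A S' hh he hf x

/-! ### Symmetrising `y ↦ y + ω y` along a triangular decomposition -/

/-- The filtration of the subspace spanned by the `h_i` and the brackets of the `e_i`. -/
inductive Pos : ℕ → Matrix.ToLieAlgebra ℝ A → Prop
  | zero (n : ℕ) : Pos n 0
  | cartan (n : ℕ) (i : I) : Pos (n + 1) (h A i)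
  | lie (n : ℕ) (i : I) (y : Matrix.ToLieAlgebra ℝ A) : Pos n y → Pos (n + 1) ⁅e A i, y⁆
  | add (n : ℕ) (y z : Matrix.ToLieAlgebra ℝ A) : Pos n y → Pos n z → Pos n (y + z)
  | smul (n : ℕ) (c : ℝ) (y : Matrix.ToLieAlgebra ℝ A) : Pos n y → Pos n (c • y)

variable {A}

theorem Pos.eq_zero {n : ℕ} {y : Matrix.ToLieAlgebra ℝ A} (hy : Pos A n y) (hn : n = 0) :
    y = 0 := by
  induction hy with
  | zero => rfl
  | cartan => omega
  | lie => omega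
  | add n y z _ _ h1 h2 => rw [h1 hn, h2 hn, add_zero]
  | smul n c y _ h1 => rw [h1 hn, smul_zero]

theorem Pos.succ {n : ℕ} {y : Matrix.ToLieAlgebra ℝ A} (hy : Pos A n y) : Pos A (n + 1) y := by
  induction hy with
  | zero => exact .zero _
  | cartan n i => exact .cartan _ i
  | lie n i y _ ih => exact .lie _ i y ih
  | add n y z _ _ h1 h2 => exact .add _ _ _ h1 h2
  | smul n c y _ h1 => exact .smul _ _ _ h1

theorem Pos.mono {n m : ℕ} (hnm : n ≤ m) {y : Matrix.ToLieAlgebra ℝ A} (hy : Pos A n y) :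
    Pos A m y := by
  induction hnm with
  | refl => exact hy
  | step _ ih => exact ih.succ

theorem Pos.lie_h {n : ℕ} {y : Matrix.ToLieAlgebra ℝ A} (hy : Pos A n y) (i : I) :
    Pos A n ⁅h A i, y⁆ := by
  induction hy with
  | zero => rw [lie_zero]; exact .zero _
  | cartan n j => rw [lie_h_h]; exact .zero _
  | lie n k y hy ih =>
    rw [leibniz_lie, lie_h_e, smul_lie]
    exact .add _ _ _ (.smul _ _ _ (.lie _ _ _ hy)) (.lie _ _ _ ih)
  | add n y z _ _ h1 h2 => rw [lie_add]; exact .add _ _ _ h1 h2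
  | smul n c y _ h1 => rw [lie_smul]; exact .smul _ _ _ h1

theorem Pos.lie_e_span {z : Matrix.ToLieAlgebra ℝ A} (hz : z ∈ Submodule.span ℝ (Set.range (f A)))
    (k : I) (n : ℕ) : Pos A (n + 1) ⁅e A k, z⁆ := by
  induction hz using Submodule.span_induction with
  | mem x hx =>
    obtain ⟨j, rfl⟩ := hx
    rw [lie_e_f]
    split_ifs
    · exact .cartan _ _
    · exact .zero _
  | zero => rw [lie_zero]; exact .zero _
  | add x y _ _ hx hy => rw [lie_add]; exact .add _ _ _ hx hy
  | smul c x _ hx => rw [lie_smul]; exact .smul _ _ _ hx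

/-- Bracketing with `f_i` undoes one bracket with some `e_k`, so it lowers the filtration, except
that `[f_i, h_j]` is a multiple of `f_i` and leaves the positive part. The term `z` records this
exception; it is harmless under a further `e_k`, since `[e_k, f_j]` is again in the Cartan part. -/
theorem Pos.lie_f {n : ℕ} {y : Matrix.ToLieAlgebra ℝ A} (hy : Pos A n y) (i : I) :
    ∃ z ∈ Submodule.span ℝ (Set.range (f A)), Pos A (n - 1) (⁅f A i, y⁆ - z) := by
  induction hy with
  | zero => exact ⟨0, Submodule.zero_mem _, by simpa using .zero _⟩
  | cartan n j =>
    refine ⟨(A j i : ℝ) • f A i, Submodule.smul_mem _ _ (Submodule.subset_span ⟨i, rfl⟩), ?_⟩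
    rw [← lie_skew, lie_h_f, neg_neg, sub_self]
    exact .zero _
  | lie n k y hy ih =>
    obtain ⟨z, hz, hp⟩ := ih
    refine ⟨0, Submodule.zero_mem _, ?_⟩
    rcases Nat.eq_zero_or_pos n with hn | hn
    · rw [hy.eq_zero hn]; simpa using .zero _
    have h1 : ⁅e A k, ⁅f A i, y⁆⁆ = ⁅e A k, ⁅f A i, y⁆ - z⁆ + ⁅e A k, z⁆ := by
      rw [← lie_add, sub_add_cancel]
    rw [sub_zero, leibniz_lie, h1, ← lie_skew (f A i), lie_e_f]
    have h2 := Pos.lie _ k _ hp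
    have h3 := Pos.lie_e_span hz k (n - 1)
    rw [Nat.sub_add_cancel hn] at h2 h3
    refine .add _ _ _ ?_ (.add _ _ _ h2 h3)
    split_ifs
    · have := Pos.smul _ (-1) _ (hy.lie_h k)
      simpa using this
    · simpa using Pos.zero _
  | add n y z _ _ h1 h2 =>
    obtain ⟨a, ha, ha'⟩ := h1
    obtain ⟨b, hb, hb'⟩ := h2
    refine ⟨a + b, Submodule.add_mem _ ha hb, ?_⟩
    have := Pos.add _ _ _ ha' hb'
    rwa [sub_add_sub_comm, ← lie_add] at this
  | smul n c y _ h1 =>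
    obtain ⟨a, ha, ha'⟩ := h1
    refine ⟨c • a, Submodule.smul_mem _ _ ha, ?_⟩
    have := Pos.smul _ c _ ha'
    rwa [smul_sub, ← lie_smul] at this

variable (A) in
/-- The Lie subalgebra generated by the `e_i - f_i`. -/
def bermanSpan : LieSubalgebra ℝ (Matrix.ToLieAlgebra ℝ A) :=
  LieSubalgebra.lieSpan ℝ _ (Set.range fun i => e A i - f A i)

variable (A) in
/-- Those `y` for which `y + ω y` lies in the subalgebra generated by the `e_i - f_i`. -/
def symmetrisable : Submodule ℝ (Matrix.ToLieAlgebra ℝ A) :=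
  (bermanSpan A).toSubmodule.comap (LinearMap.id + (involution A).toLinearMap)

theorem mem_symmetrisable {y : Matrix.ToLieAlgebra ℝ A} :
    y ∈ symmetrisable A ↔ y + involution A y ∈ bermanSpan A := Iff.rfl

theorem sub_mem_bermanSpan (i : I) : e A i - f A i ∈ bermanSpan A :=
  LieSubalgebra.subset_lieSpan ⟨i, rfl⟩

theorem span_f_le_symmetrisable : Submodule.span ℝ (Set.range (f A)) ≤ symmetrisable A := by
  rw [Submodule.span_le]
  rintro _ ⟨i, rfl⟩
  rw [SetLike.mem_coe, mem_symmetrisable, involution_f]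
  have := (bermanSpan A).neg_mem (sub_mem_bermanSpan (A := A) i)
  rwa [neg_sub, sub_eq_add_neg] at this

/-- The engine is `[e_k, y] + ω[e_k, y] = [e_k - f_k, y + ω y] + ([f_k, y] + ω[f_k, y])`, in which
`[f_k, y]` is of lower degree modulo the span of the `f_j`. Strong induction on the degree therefore
applies; on the Cartan part `y + ω y` is zero. -/
theorem Pos.mem_symmetrisable (n : ℕ) {y : Matrix.ToLieAlgebra ℝ A} (hy : Pos A n y) :
    y ∈ symmetrisable A := by
  induction n using Nat.strong_induction_on generalizing y with
  | _ n IH =>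
    induction hy with
    | zero => exact Submodule.zero_mem _
    | cartan n i =>
      rw [KacMoody.mem_symmetrisable, involution_h, add_neg_cancel]
      exact LieSubalgebra.zero_mem _
    | lie n k y hy _ =>
      obtain ⟨z, hz, hp⟩ := hy.lie_f k
      have h1 : ⁅f A k, y⁆ ∈ symmetrisable A := by
        have := Submodule.add_mem _ (IH (n - 1) (by omega) hp) (span_f_le_symmetrisable hz)
        rwa [sub_add_cancel] at this
      have h2 : y + involution A y ∈ bermanSpan A := IH n (by omega) hy
      have h3 := (bermanSpan A).lie_mem (sub_mem_bermanSpan (A := A) k) h2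
      rw [KacMoody.mem_symmetrisable] at h1 ⊢
      have h4 := (bermanSpan A).add_mem h3 h1
      rw [LieHom.map_lie, involution_f] at h4
      rw [LieHom.map_lie, involution_e]
      convert h4 using 1
      simp only [sub_lie, lie_add, neg_lie]
      abel
    | add n y z _ _ h1 h2 => exact Submodule.add_mem _ (h1 IH) (h2 IH)
    | smul n c y _ h1 => exact Submodule.smul_mem _ _ (h1 IH)

/-- The filtration starts from the `h_i` alone; `[e_i, h_i] = -2 e_i` recovers `e_i` in degree two.
-/
theorem Pos.e (hA : ∀ i, A i i = 2) (i : I) : Pos A 2 (e A i) := by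
  have := Pos.smul _ (-1 / 2) _ (Pos.lie _ i _ (Pos.cartan (A := A) 0 i))
  rw [← lie_skew, lie_h_e, hA i, smul_neg, smul_smul] at this
  norm_num at this
  exact this

variable (A) in
/-- The sum of the span of the positive part and of its image under the involution. -/
def posNeg : Submodule ℝ (Matrix.ToLieAlgebra ℝ A) where
  carrier := {y | ∃ n a b, Pos A n a ∧ Pos A n b ∧ y = a + involution A b}
  add_mem' := by
    rintro _ _ ⟨n, a, b, ha, hb, rfl⟩ ⟨m, c, d, hc, hd, rfl⟩
    refine ⟨max n m, a + c, b + d, .add _ _ _ (ha.mono (le_max_left _ _))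
      (hc.mono (le_max_right _ _)), .add _ _ _ (hb.mono (le_max_left _ _))
      (hd.mono (le_max_right _ _)), ?_⟩
    rw [map_add]; abel
  zero_mem' := ⟨0, 0, 0, .zero _, .zero _, by simp⟩
  smul_mem' := by
    rintro c _ ⟨n, a, b, ha, hb, rfl⟩
    exact ⟨n, c • a, c • b, .smul _ _ _ ha, .smul _ _ _ hb, by simp⟩

theorem involution_mem_posNeg {y : Matrix.ToLieAlgebra ℝ A} (hy : y ∈ posNeg A) :
    involution A y ∈ posNeg A := by
  obtain ⟨n, a, b, ha, hb, rfl⟩ := hy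
  exact ⟨n, b, a, hb, ha, by rw [map_add, involution_involution, add_comm]⟩

theorem Pos.mem_posNeg {n : ℕ} {y : Matrix.ToLieAlgebra ℝ A} (hy : Pos A n y) : y ∈ posNeg A :=
  ⟨n, y, 0, hy, .zero _, by simp⟩

theorem f_mem_posNeg (hA : ∀ i, A i i = 2) (i : I) : f A i ∈ posNeg A := by
  have := Submodule.neg_mem _ (involution_mem_posNeg (Pos.e hA i).mem_posNeg)
  rwa [involution_e, neg_neg] at this

/-- On the positive half this is built into the filtration. On the negative half `[e_i, ω b] =
-ω[f_i, b]` reduces it to `Pos.lie_f`. -/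
theorem lie_e_mem_posNeg (hA : ∀ i, A i i = 2) (i : I) {y : Matrix.ToLieAlgebra ℝ A}
    (hy : y ∈ posNeg A) : ⁅e A i, y⁆ ∈ posNeg A := by
  obtain ⟨n, a, b, ha, hb, rfl⟩ := hy
  rw [lie_add]
  refine Submodule.add_mem _ (Pos.lie _ i _ ha).mem_posNeg ?_
  have h1 : ⁅e A i, involution A b⁆ = - involution A ⁅f A i, b⁆ := by
    rw [LieHom.map_lie, involution_f, neg_lie, neg_neg]
  rw [h1]
  refine Submodule.neg_mem _ (involution_mem_posNeg ?_)
  obtain ⟨z, hz, hp⟩ := hb.lie_f i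
  have : z ∈ posNeg A := by
    refine (Submodule.span_le.2 ?_) hz
    rintro _ ⟨j, rfl⟩
    exact f_mem_posNeg hA j
  simpa using Submodule.add_mem _ hp.mem_posNeg this

theorem lie_f_mem_posNeg (hA : ∀ i, A i i = 2) (i : I) {y : Matrix.ToLieAlgebra ℝ A}
    (hy : y ∈ posNeg A) : ⁅f A i, y⁆ ∈ posNeg A := by
  have h1 := involution_mem_posNeg (lie_e_mem_posNeg hA i (involution_mem_posNeg hy))
  rw [LieHom.map_lie, involution_involution, involution_e, neg_lie] at h1
  simpa using Submodule.neg_mem _ h1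

theorem mem_symmetrisable_of_diag (hA : ∀ i, A i i = 2) (y : Matrix.ToLieAlgebra ℝ A) :
    y ∈ symmetrisable A := by
  obtain ⟨n, a, b, ha, hb, rfl⟩ := mem_of_stable A (posNeg A) (fun i => (Pos.e hA i).mem_posNeg)
    (f_mem_posNeg hA) (fun i w => lie_e_mem_posNeg hA i) (fun i w => lie_f_mem_posNeg hA i) y
  refine Submodule.add_mem _ ha.mem_symmetrisable ?_
  have := hb.mem_symmetrisable
  rw [mem_symmetrisable] at this ⊢
  rwa [involution_involution, add_comm]

/-- The maximal compact subalgebra is generated by the Berman generators. -/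
theorem maximalCompact_induction (hA : ∀ i, A i i = 2) {p : maximalCompact A → Prop}
    (mem : ∀ i, p (bermanGenerator A i)) (zero : p 0)
    (add : ∀ x y, p x → p y → p (x + y)) (smul : ∀ (c : ℝ) x, p x → p (c • x))
    (lie : ∀ x y, p x → p y → p ⁅x, y⁆) (x : maximalCompact A) : p x := by
  have key : ∀ y ∈ bermanSpan A, ∃ hy : y ∈ maximalCompact A, p ⟨y, hy⟩ := by
    intro y hy
    induction hy using LieSubalgebra.lieSpan_induction with
    | mem y hy =>
      obtain ⟨i, rfl⟩ := hy
      exact ⟨(bermanGenerator A i).2, mem i⟩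
    | zero => exact ⟨LieSubalgebra.zero_mem _, zero⟩
    | add y z _ _ h1 h2 => exact ⟨_, add _ _ h1.2 h2.2⟩
    | smul c y _ h1 => exact ⟨_, smul c _ h1.2⟩
    | lie y z _ _ h1 h2 => exact ⟨_, lie _ _ h1.2 h2.2⟩
  -- A fixed point is `x = ½ (x + ω x)`, and every `x + ω x` lies in the subalgebra generated by the
  -- `e_i - f_i`.
  have h1 := mem_symmetrisable.1 (mem_symmetrisable_of_diag hA (x : Matrix.ToLieAlgebra ℝ A))
  have h2 : involution A (x : Matrix.ToLieAlgebra ℝ A) = x := x.2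
  rw [h2] at h1
  obtain ⟨hy, hp⟩ := key _ h1
  have := smul (1 / 2) _ hp
  convert this using 1
  ext
  change (x : Matrix.ToLieAlgebra ℝ A) = (1 / 2 : ℝ) • ((x : Matrix.ToLieAlgebra ℝ A) + x)
  rw [← two_smul ℝ, smul_smul]
  norm_num

end Generation

end KacMoody

end

noncomputable section

namespace KacMoody

open CartanMatrix Finsupp

section Berman

set_option linter.unusedSectionVars false

/-! ### The lowest weight Verma module on words -/

/-- In a Lie algebra with elements `x_i`, `y_i` obeying the Chevalley relations of a simply-laced
Cartan matrix, the Serre elements of the `x_i` commute with the `y_k`. -/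
theorem lie_serre_eq_zero {I L : Type} [DecidableEq I] [LieRing L] [LieAlgebra ℝ L]
    {A : Matrix I I ℤ} {x y t : I → L} (hdiag : ∀ i, A i i = 2)
    (hyx : ∀ k i, ⁅y k, x i⁆ = if k = i then t i else 0)
    (htx : ∀ i j, ⁅t i, x j⁆ = -((A i j : ℝ) • x j)) {i j : I} (hij : A i j = -1)
    (hji : A j i = -1) (k : I) : ⁅y k, ⁅x i, ⁅x i, x j⁆⁆⁆ = 0 := by
  have hne : i ≠ j := fun hh => by subst hh; rw [hdiag] at hij; omega
  have h1 : ⁅y k, ⁅x i, x j⁆⁆ = ⁅⁅y k, x i⁆, x j⁆ + ⁅x i, ⁅y k, x j⁆⁆ := leibniz_lie _ _ _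
  rw [leibniz_lie, h1, hyx, hyx]
  by_cases hki : k = i
  · subst hki
    rw [if_pos rfl, if_neg hne, lie_zero, add_zero, leibniz_lie (t k), htx, htx, hdiag, hij]
    simp only [Int.cast_ofNat, Int.cast_neg, Int.cast_one, neg_smul, one_smul, neg_neg, neg_lie,
      two_smul, add_lie]
    abel
  · by_cases hkj : k = j
    · subst hkj
      rw [if_neg hki, if_pos rfl, zero_lie, zero_lie, zero_add, zero_add, ← lie_skew (x i) (t k),
        htx, hji]
      simp
    · rw [if_neg hki, if_neg hkj]; simp

theorem lie_serre_eq_zero' {I L : Type} [DecidableEq I] [LieRing L] [LieAlgebra ℝ L]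
    {A : Matrix I I ℤ} {x y t : I → L}
    (hyx : ∀ k i, ⁅y k, x i⁆ = if k = i then t i else 0)
    (htx : ∀ i j, ⁅t i, x j⁆ = -((A i j : ℝ) • x j)) {i j : I} (hij : A i j = 0)
    (hji : A j i = 0) (k : I) : ⁅y k, ⁅x i, x j⁆⁆ = 0 := by
  rw [leibniz_lie, hyx, hyx]
  split_ifs with h1 h2 h2
  · subst h1 h2; rw [htx, ← lie_skew, htx, hij]; simp
  · rw [htx, hij]; simp
  · rw [← lie_skew (x i) (t j), htx, hji]; simp
  · simp

/-- The Serre elements of a family in a Lie algebra. -/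
def serre {I L : Type} (A : Matrix I I ℤ) [LieRing L] [LieAlgebra ℝ L] (x : I → L) (i j : I) : L :=
  ((LieAlgebra.ad ℝ L (x i)) ^ (-A i j).toNat) ⁅x i, x j⁆

theorem map_serre {I L L' : Type} (A : Matrix I I ℤ) [LieRing L] [LieAlgebra ℝ L] [LieRing L']
    [LieAlgebra ℝ L'] (φ : L →ₗ⁅ℝ⁆ L') (x : I → L) (i j : I) :
    φ (serre A x i j) = serre A (φ ∘ x) i j := by
  rw [serre, map_ad_pow, LieHom.map_lie]; rfl

/-- Simply-laced generalised Cartan matrices. -/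
structure IsSimplyLaced {I : Type} (A : Matrix I I ℤ) : Prop where
  diag : ∀ i, A i i = 2
  symm : ∀ i j, A i j = A j i
  off_diag : ∀ i j, i ≠ j → A i j = 0 ∨ A i j = -1

/-- A property of the Serre elements of a simply-laced algebra, checked case by case. -/
theorem IsSimplyLaced.serre_cases {I L : Type} {A : Matrix I I ℤ} (hA : IsSimplyLaced A)
    [LieRing L] [LieAlgebra ℝ L] {x : I → L} {p : L → Prop} (i j : I) (hz : p 0)
    (h0 : A i j = 0 → p ⁅x i, x j⁆) (h1 : A i j = -1 → p ⁅x i, ⁅x i, x j⁆⁆) :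
    p (serre A x i j) := by
  rw [serre]
  by_cases hij : i = j
  · subst hij; simpa using hz
  rcases hA.off_diag i j hij with h | h
  · simpa [h] using h0 h
  · simpa [h] using h1 h

/-! ### Serre and Berman relations from the Verma axioms -/

section Algebra

variable {I R : Type} [DecidableEq I] [Ring R] [Algebra ℝ R]

/-- Elements of an associative algebra which act like the Chevalley generators on a Verma module
generated from a vacuum by the `E_i`; the left ideal `N` is the annihilator of the vacuum. -/
structure IsVerma (A : Matrix I I ℤ) (E F H : I → R) (N : Ideal R) : Prop where
  lie_H_E : ∀ i j, ⁅H i, E j⁆ = (A i j : ℝ) • E j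
  lie_H_H : ∀ i j, ⁅H i, H j⁆ = 0
  lie_E_F : ∀ i j, ⁅E i, F j⁆ = if i = j then H i else 0
  H_mem : ∀ i, H i ∈ N
  F_mem : ∀ i, F i ∈ N
  eq_zero : ∀ X ∈ N, (∀ k, ⁅E k, X⁆ = 0) → X = 0

variable {A : Matrix I I ℤ} {E F H : I → R} {N : Ideal R}

theorem lie_mem_of_mem {X Y : R} (hX : X ∈ N) (hY : Y ∈ N) : ⁅X, Y⁆ ∈ N := by
  rw [LieRing.of_associative_ring_bracket]
  exact N.sub_mem (N.mul_mem_left _ hY) (N.mul_mem_left _ hX)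

namespace IsVerma


theorem lie_F_E (hV : IsVerma A E F H N) (i j : I) : ⁅F i, E j⁆ = if i = j then -H j else 0 := by
  rw [← lie_skew, hV.lie_E_F]
  by_cases hij : i = j
  · subst hij; simp
  · simp [hij, Ne.symm hij]

/-- The difference of the two sides kills the vacuum and commutes with every `E_k`, so `eq_zero`
removes it. This avoids any computation with the explicit operator `F_j`. -/
theorem lie_H_F (hV : IsVerma A E F H N) (i j : I) : ⁅H i, F j⁆ = -((A i j : ℝ) • F j) := by
  rw [← add_eq_zero_iff_eq_neg]
  refine hV.eq_zero _ (N.add_mem (lie_mem_of_mem (hV.H_mem i) (hV.F_mem j)) ?_) fun k => ?_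
  · rw [Algebra.smul_def]; exact N.mul_mem_left _ (hV.F_mem j)
  · rw [lie_add, leibniz_lie, ← lie_skew (E k) (H i), hV.lie_H_E, lie_smul, neg_lie,
      smul_lie, hV.lie_E_F]
    by_cases hkj : k = j
    · subst hkj; simp [hV.lie_H_H]
    · simp [hkj]

/-- A Serre element of the `F_i` kills the vacuum and commutes with the `E_k`, hence is zero already
on the free module. The corresponding elements of the `E_i` do not kill the vacuum, and this
asymmetry is what makes `berman_sub` useful. -/
theorem serre_F (hV : IsVerma A E F H N) (hA : IsSimplyLaced A) (i j : I) : serre A F i j = 0 := by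
  refine hA.serre_cases (p := fun X => X = 0) i j rfl (fun h => ?_) (fun h => ?_)
  · refine hV.eq_zero _ (lie_mem_of_mem (hV.F_mem i) (hV.F_mem j)) fun k => ?_
    exact lie_serre_eq_zero' (A := A) (y := E) (t := H)
      (fun k i => by rw [hV.lie_E_F]; split_ifs with h <;> simp [h]) hV.lie_H_F h
      (by rw [hA.symm, h]) k
  · refine hV.eq_zero _ (lie_mem_of_mem (hV.F_mem i)
      (lie_mem_of_mem (hV.F_mem i) (hV.F_mem j))) fun k => ?_
    exact lie_serre_eq_zero (A := A) (y := E) (t := H) hA.diag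
      (fun k i => by rw [hV.lie_E_F]; split_ifs with h <;> simp [h]) hV.lie_H_F h
      (by rw [hA.symm, h]) k

/-- The same Chevalley computation with the roles of `E` and `F` exchanged; the sign in `[F_i, E_i]
= -H_i` is absorbed by taking `t = -H`. It makes the span of the Serre elements stable under the
`F_k`. -/
theorem lie_F_serre (hV : IsVerma A E F H N) (hA : IsSimplyLaced A) (i j k : I) :
    ⁅F k, serre A E i j⁆ = 0 := by
  have ht : ∀ i j, ⁅-H i, E j⁆ = -((A i j : ℝ) • E j) := fun i j => by
    rw [neg_lie, hV.lie_H_E]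
  have hF : ∀ k i, ⁅F k, E i⁆ = if k = i then (fun i => -H i) i else 0 := hV.lie_F_E
  refine hA.serre_cases (p := fun X => ⁅F k, X⁆ = 0) i j (lie_zero _) (fun h => ?_)
    (fun h => ?_)
  · exact lie_serre_eq_zero' (A := A) hF ht h (by rw [hA.symm, h]) k
  · exact lie_serre_eq_zero (A := A) hA.diag hF ht h (by rw [hA.symm, h]) k

theorem lie_H_serre (hV : IsVerma A E F H N) (hA : IsSimplyLaced A) (i j k : I) :
    ∃ c : ℝ, ⁅H k, serre A E i j⁆ = c • serre A E i j := by
  refine hA.serre_cases (p := fun X => ∃ c : ℝ, ⁅H k, X⁆ = c • X) i j ⟨0, by simp⟩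
    (fun _ => ⟨A k i + A k j, ?_⟩) (fun _ => ⟨A k i + (A k i + A k j), ?_⟩)
  · rw [leibniz_lie, hV.lie_H_E, hV.lie_H_E, smul_lie, lie_smul, add_smul]
  · rw [leibniz_lie, leibniz_lie (H k) (E i) (E j), hV.lie_H_E, hV.lie_H_E, smul_lie,
      smul_lie, lie_add, lie_smul, lie_smul, lie_smul, add_smul, add_smul]

/-- The Berman relations of the elements `E_i - F_i` are the Serre relations of the `E_i`. -/
theorem berman_sub (hV : IsVerma A E F H N) (hA : IsSimplyLaced A) {i j : I} (hij : A i j = -1) :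
    ⁅E i - F i, ⁅E i - F i, E j - F j⁆⁆ + (E j - F j) = ⁅E i, ⁅E i, E j⁆⁆ := by
  have hne : i ≠ j := fun hh => by subst hh; rw [hA.diag] at hij; omega
  have hF : ⁅F i, ⁅F i, F j⁆⁆ = 0 := by
    have := hV.serre_F hA i j
    simpa [serre, hij] using this
  have e1 : ⁅E i, ⁅F i, F j⁆⁆ = F j := by
    rw [leibniz_lie, hV.lie_E_F, hV.lie_E_F, if_pos rfl, if_neg hne, hV.lie_H_F, hij]
    simp
  have e2 : ⁅F i, ⁅E i, E j⁆⁆ = E j := by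
    rw [leibniz_lie, hV.lie_F_E, hV.lie_F_E, if_pos rfl, if_neg hne, neg_lie, hV.lie_H_E, hij]
    simp
  have e3 : ⁅E i, F j⁆ = 0 := by rw [hV.lie_E_F, if_neg hne]
  have e4 : ⁅F i, E j⁆ = 0 := by rw [hV.lie_F_E, if_neg hne]
  simp only [sub_lie, lie_sub, hF, e1, e2, e3, e4, lie_zero]
  abel

theorem berman_sub' (hV : IsVerma A E F H N) (hA : IsSimplyLaced A) {i j : I} (hij : A i j = 0) :
    ⁅E i - F i, E j - F j⁆ = ⁅E i, E j⁆ := by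
  have hne : i ≠ j := fun hh => by subst hh; rw [hA.diag] at hij; omega
  have hF : ⁅F i, F j⁆ = 0 := by
    have := hV.serre_F hA i j
    simpa [serre, hij] using this
  have e3 : ⁅E i, F j⁆ = 0 := by rw [hV.lie_E_F, if_neg hne]
  have e4 : ⁅F i, E j⁆ = 0 := by rw [hV.lie_F_E, if_neg hne]
  simp only [sub_lie, lie_sub, hF, e3, e4]
  abel

end IsVerma

end Algebra

section Verma

attribute [local instance 2000] Ring.instBracket lieRingSelfModule

variable {I : Type} [DecidableEq I] (A : Matrix I I ℤ)

/-- The pairing of `h_i` with the weight of a word. -/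
def weight (i : I) (w : List I) : ℤ := (w.map (A i)).sum

/-- The action of `e_i`: prepend a letter. -/
def opE (i : I) : Module.End ℝ (List I →₀ ℝ) :=
  linearCombination ℝ fun w => single (i :: w) (1 : ℝ)

/-- The action of `h_i`: multiply by the weight. -/
def opH (i : I) : Module.End ℝ (List I →₀ ℝ) :=
  linearCombination ℝ fun w => (weight A i w : ℝ) • single w (1 : ℝ)

/-- The action of `f_i` on a word: remove a letter `i`, weighted by what follows it. -/
def removal (i : I) (w : List I) : List I →₀ ℝ :=
  -∑ k : Fin w.length,
    if w.get k = i then (weight A i (w.drop (k + 1)) : ℝ) • single (w.eraseIdx k) (1 : ℝ) else 0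

/-- The action of `f_i`. -/
def opF (i : I) : Module.End ℝ (List I →₀ ℝ) := linearCombination ℝ (removal A i)

@[simp] theorem opE_single (i : I) (w : List I) :
    opE i (single w 1) = single (i :: w) 1 := by
  simp [opE]

@[simp] theorem opH_single (i : I) (w : List I) :
    opH A i (single w 1) = (weight A i w : ℝ) • single w 1 := by
  simp [opH]

@[simp] theorem opF_single (i : I) (w : List I) : opF A i (single w 1) = removal A i w := by
  simp [opF]

theorem removal_nil (i : I) : removal A i [] = 0 := by simp [removal]

/-- This is `F_i E_j = E_j F_i - δ_{ij} H_i` evaluated on a word: position `0` gives the `H_i` term,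
the remaining positions give `E_j F_i`. -/
theorem removal_cons (i j : I) (w : List I) :
    removal A i (j :: w) = opE j (removal A i w)
      - if i = j then (weight A i w : ℝ) • single w (1 : ℝ) else 0 := by
  simp only [removal, map_neg, map_sum]
  rw [← neg_add', neg_inj, add_comm]
  refine (Fin.sum_univ_succ (n := w.length) _).trans ?_
  rw [add_comm, add_comm (ite _ _ _)]
  refine congrArg₂ (fun a b : List I →₀ ℝ => a + b) ?_ ?_
  · refine Finset.sum_congr rfl fun k _ => ?_
    rw [apply_ite (opE j), map_zero, map_smul, opE_single]
    rfl
  · simp [eq_comm]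

theorem end_ext {M : Type} [AddCommGroup M] [Module ℝ M] {X Y : (List I →₀ ℝ) →ₗ[ℝ] M}
    (hXY : ∀ w, X (single w 1) = Y (single w 1)) : X = Y :=
  Finsupp.lhom_ext' fun w => LinearMap.ext_ring (hXY w)

theorem lie_opH_opE (i j : I) : ⁅opH A i, opE j⁆ = (A i j : ℝ) • opE j := by
  refine end_ext fun w => ?_
  simp only [LieRing.of_associative_ring_bracket, LinearMap.sub_apply, Module.End.mul_apply,
    LinearMap.smul_apply, opE_single, opH_single, map_smul, weight, List.map_cons, List.sum_cons,
    Int.cast_add, add_smul, add_sub_cancel_right]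

theorem lie_opH_opH (i j : I) : ⁅opH A i, opH A j⁆ = 0 := by
  refine end_ext fun w => ?_
  simp only [LieRing.of_associative_ring_bracket, LinearMap.sub_apply, Module.End.mul_apply,
    opH_single, map_smul, smul_comm (weight A i w : ℝ), sub_self, LinearMap.zero_apply]

theorem lie_opE_opF (i j : I) : ⁅opE i, opF A j⁆ = if i = j then opH A i else 0 := by
  refine end_ext fun w => ?_
  simp only [LieRing.of_associative_ring_bracket, LinearMap.sub_apply, Module.End.mul_apply,
    opF_single, opE_single, removal_cons, sub_sub_cancel]
  by_cases hij : i = j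
  · subst hij; simp
  · simp [hij, Ne.symm hij]

/-- The operators on words form a Verma module; the vacuum is the empty word. -/
theorem isVerma_op : IsVerma A opE (opF A) (opH A)
    (LinearMap.ker (LinearMap.toSpanSingleton (Module.End ℝ (List I →₀ ℝ)) (List I →₀ ℝ)
      (single [] 1))) where
  lie_H_E := lie_opH_opE A
  lie_H_H := lie_opH_opH A
  lie_E_F := lie_opE_opF A
  H_mem i := by simp [weight]
  F_mem i := by simp [removal_nil]
  eq_zero X h0 hX := by
    replace h0 : X (single [] 1) = 0 := h0
    -- Every word is obtained from the vacuum by prepending letters, and `X` commutes with this.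
    refine end_ext fun w => ?_
    induction w with
    | nil => simpa using h0
    | cons k w ih =>
      have : (opE k * X - X * opE k) (single w 1) = 0 := LinearMap.congr_fun (hX k) (single w 1)
      simp only [LinearMap.sub_apply, Module.End.mul_apply, opE_single, ih] at this
      simpa using this

variable {A}

/-! ### The universal intertwiner -/

section Theta

variable {R : Type} [Ring R] [Algebra ℝ R] (J : I → R)

variable (A) in
/-- The images of words under the intertwiner determined by `θ(k_i u) = J_i θ(u)`, `θ(1) = 1`,
where `k_i = e_i - f_i`. -/
def thetaWord : List I → R
  | [] => 1
  | i :: w => J i * thetaWord w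
      - ∑ k : Fin w.length,
          if w.get k = i then (weight A i (w.drop (k + 1)) : ℝ) • thetaWord (w.eraseIdx k) else 0
  termination_by w => w.length
  decreasing_by
  · simp
  · have := k.2
    simp only [List.length_cons, List.length_eraseIdx]
    split_ifs <;> omega

variable (A) in
/-- The intertwiner `θ`. -/
def theta : (List I →₀ ℝ) →ₗ[ℝ] R := linearCombination ℝ (thetaWord A J)

theorem theta_nil : theta A J (single [] 1) = 1 := by simp [theta, thetaWord]

/-- The recursion of `thetaWord` is `E_i = (E_i - F_i) + F_i` with the first summand replaced by
multiplication by `J_i`; no relation among the `J_i` is needed on the free module. -/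
theorem theta_opE (i : I) (u : List I →₀ ℝ) :
    theta A J (opE i u) = J i * theta A J u + theta A J (opF A i u) := by
  have : theta A J ∘ₗ opE i
      = LinearMap.mulLeft ℝ (J i) ∘ₗ theta A J + theta A J ∘ₗ opF A i := by
    refine end_ext fun w => ?_
    simp only [LinearMap.comp_apply, LinearMap.add_apply, LinearMap.mulLeft_apply, opE_single,
      opF_single, removal, map_neg, map_sum]
    simp only [theta, linearCombination_single, one_smul]
    rw [thetaWord, sub_eq_add_neg]
    congr 2
    refine Finset.sum_congr rfl fun k _ => ?_
    split_ifs <;> simp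
  exact LinearMap.congr_fun this u

theorem theta_sub (i : I) (u : List I →₀ ℝ) :
    theta A J ((opE i - opF A i) u) = J i * theta A J u := by
  rw [LinearMap.sub_apply, map_sub, theta_opE, add_sub_cancel_right]

theorem theta_lie {X Y : Module.End ℝ (List I →₀ ℝ)} {a b : R}
    (hX : ∀ u, theta A J (X u) = a * theta A J u) (hY : ∀ u, theta A J (Y u) = b * theta A J u)
    (u : List I →₀ ℝ) : theta A J (⁅X, Y⁆ u) = ⁅a, b⁆ * theta A J u := by
  simp only [LieRing.of_associative_ring_bracket, LinearMap.sub_apply, Module.End.mul_apply,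
    map_sub, hX, hY, sub_mul, mul_assoc]

variable {J}

/-- By `berman_sub` the Serre operator is the Berman expression in the operators `E_i - F_i`. The
map `theta` turns that into the same expression in the `J_i`, which is zero by hypothesis. -/
theorem IsSimplyLaced.theta_serre (hA : IsSimplyLaced A)
    (hJ1 : ∀ i j, A i j = -1 → ⁅J i, ⁅J i, J j⁆⁆ + J j = 0)
    (hJ0 : ∀ i j, A i j = 0 → ⁅J i, J j⁆ = 0) (i j : I) (u : List I →₀ ℝ) :
    theta A J (serre A opE i j u) = 0 := by
  refine hA.serre_cases (p := fun X : Module.End ℝ (List I →₀ ℝ) => theta A J (X u) = 0) i j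
    (by simp) (fun h => ?_)
    (fun h => ?_)
  · rw [← (isVerma_op A).berman_sub' hA h, theta_lie J (theta_sub J i) (theta_sub J j), hJ0 i j h,
      zero_mul]
  · rw [← (isVerma_op A).berman_sub hA h, LinearMap.add_apply, map_add,
      theta_lie J (theta_sub J i) (theta_lie J (theta_sub J i) (theta_sub J j)), theta_sub,
      ← add_mul, hJ1 i j h, zero_mul]

end Theta

/-! ### The quotient by the Serre relations -/

variable (A) in
/-- The left ideal span of the Serre elements, filtered by the length of the left factor. -/
inductive SerreSpan : ℕ → (List I →₀ ℝ) → Prop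
  | serre (n : ℕ) (i j : I) (u : List I →₀ ℝ) : SerreSpan n (serre A opE i j u)
  | zero (n : ℕ) : SerreSpan n 0
  | opE (n : ℕ) (i : I) (u : List I →₀ ℝ) : SerreSpan n u → SerreSpan (n + 1) (opE i u)
  | add (n : ℕ) (u v : List I →₀ ℝ) : SerreSpan n u → SerreSpan n v → SerreSpan n (u + v)
  | smul (n : ℕ) (c : ℝ) (u : List I →₀ ℝ) : SerreSpan n u → SerreSpan n (c • u)

theorem SerreSpan.succ {n : ℕ} {u : List I →₀ ℝ} (hu : SerreSpan A n u) :
    SerreSpan A (n + 1) u := by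
  induction hu with
  | serre n i j u => exact .serre _ i j u
  | zero => exact .zero _
  | opE n i u _ ih => exact .opE _ _ _ ih
  | add n u v _ _ h1 h2 => exact .add _ _ _ h1 h2
  | smul n c u _ h1 => exact .smul _ _ _ h1

theorem SerreSpan.mono {n m : ℕ} (hnm : n ≤ m) {u : List I →₀ ℝ} (hu : SerreSpan A n u) :
    SerreSpan A m u := by
  induction hnm with
  | refl => exact hu
  | step _ ih => exact ih.succ

theorem SerreSpan.opH (hA : IsSimplyLaced A) {n : ℕ} {u : List I →₀ ℝ} (hu : SerreSpan A n u)
    (k : I) : SerreSpan A n (opH A k u) := by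
  have comm : ∀ (X Y : Module.End ℝ (List I →₀ ℝ)) u, X (Y u) = ⁅X, Y⁆ u + Y (X u) := by
    intro X Y u
    simp [LieRing.of_associative_ring_bracket]
  induction hu with
  | serre n i j u =>
    obtain ⟨c, hc⟩ := (isVerma_op A).lie_H_serre hA i j k
    rw [comm, hc]
    exact .add _ _ _ (.smul _ _ _ (.serre _ _ _ _)) (.serre _ _ _ _)
  | zero => rw [map_zero]; exact .zero _
  | opE n i u hu ih =>
    rw [comm, lie_opH_opE]
    exact .add _ _ _ (.smul _ _ _ (.opE _ _ _ hu)) (.opE _ _ _ ih)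
  | add n u v _ _ h1 h2 => rw [map_add]; exact .add _ _ _ h1 h2
  | smul n c u _ h1 => rw [map_smul]; exact .smul _ _ _ h1

/-- It matters that the level `n` is not raised: the induction in `SerreSpan.theta_eq_zero` applies
`F_i` to an element of level `n` while treating level `n + 1`. The operator `F_k` commutes with
Serre elements, and passing it across `E_i` costs only an `H_i`. -/
theorem SerreSpan.opF (hA : IsSimplyLaced A) {n : ℕ} {u : List I →₀ ℝ} (hu : SerreSpan A n u)
    (k : I) : SerreSpan A n (opF A k u) := by
  have comm : ∀ (X Y : Module.End ℝ (List I →₀ ℝ)) u, X (Y u) = ⁅X, Y⁆ u + Y (X u) := by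
    intro X Y u
    simp [LieRing.of_associative_ring_bracket]
  induction hu with
  | serre n i j u =>
    rw [comm, (isVerma_op A).lie_F_serre hA, LinearMap.zero_apply, zero_add]
    exact .serre _ _ _ _
  | zero => rw [map_zero]; exact .zero _
  | opE n i u hu ih =>
    rw [comm, (isVerma_op A).lie_F_E]
    refine .add _ _ _ ?_ (.opE _ _ _ ih)
    split_ifs
    · have := SerreSpan.smul _ (-1) _ (hu.opH hA i).succ
      simpa using this
    · exact .zero _
  | add n u v _ _ h1 h2 => rw [map_add]; exact .add _ _ _ h1 h2
  | smul n c u _ h1 => rw [map_smul]; exact .smul _ _ _ h1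

theorem SerreSpan.theta_eq_zero (hA : IsSimplyLaced A) {R : Type} [Ring R] [Algebra ℝ R]
    {J : I → R} (hJ1 : ∀ i j, A i j = -1 → ⁅J i, ⁅J i, J j⁆⁆ + J j = 0)
    (hJ0 : ∀ i j, A i j = 0 → ⁅J i, J j⁆ = 0) (n : ℕ) {u : List I →₀ ℝ}
    (hu : SerreSpan A n u) : theta A J u = 0 := by
  induction n using Nat.strong_induction_on generalizing u with
  | _ n IH =>
    induction hu with
    | serre n i j u => exact hA.theta_serre hJ1 hJ0 i j u
    | zero => exact map_zero _
    | opE n i u hu ih =>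
      rw [theta_opE, IH n (by omega) hu, IH n (by omega) (hu.opF hA i), mul_zero, add_zero]
    | add n u v _ _ h1 h2 => rw [map_add, h1 IH, h2 IH, add_zero]
    | smul n c u _ h1 => rw [map_smul, h1 IH, smul_zero]

variable (A) in
/-- The submodule generated by the Serre relations. -/
def serreSubmodule : Submodule ℝ (List I →₀ ℝ) where
  carrier := {u | ∃ n, SerreSpan A n u}
  add_mem' := by
    rintro u v ⟨n, hu⟩ ⟨m, hv⟩
    exact ⟨max n m, .add _ _ _ (hu.mono (le_max_left _ _)) (hv.mono (le_max_right _ _))⟩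
  zero_mem' := ⟨0, .zero _⟩
  smul_mem' := by
    rintro c u ⟨n, hu⟩
    exact ⟨n, .smul _ _ _ hu⟩

/-! ### The Kac–Moody action on the Serre quotient, and Berman's theorem -/

/-- The endomorphisms preserving a submodule. -/
def stabiliser {M : Type} [AddCommGroup M] [Module ℝ M] (N : Submodule ℝ M) :
    LieSubalgebra ℝ (Module.End ℝ M) where
  carrier := {X | ∀ u ∈ N, X u ∈ N}
  add_mem' := fun ha hb u hu => N.add_mem (ha u hu) (hb u hu)
  zero_mem' := fun _ _ => N.zero_mem
  smul_mem' := fun c _ ha u hu => N.smul_mem c (ha u hu)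
  lie_mem' := fun ha hb u hu => N.sub_mem (ha _ (hb u hu)) (hb _ (ha u hu))

/-- The induced action on the quotient. -/
def quotientHom {M : Type} [AddCommGroup M] [Module ℝ M] (N : Submodule ℝ M) :
    stabiliser N →ₗ⁅ℝ⁆ Module.End ℝ (M ⧸ N) where
  toFun X := N.mapQ N (X : Module.End ℝ M) X.2
  map_add' _ _ := Submodule.linearMap_qext _ rfl
  map_smul' _ _ := Submodule.linearMap_qext _ rfl
  map_lie' := Submodule.linearMap_qext _ rfl

theorem quotientHom_eq_zero {M : Type} [AddCommGroup M] [Module ℝ M] (N : Submodule ℝ M)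
    (X : stabiliser N) (hX : ∀ u, (X : Module.End ℝ M) u ∈ N) : quotientHom N X = 0 :=
  Submodule.linearMap_qext _ (LinearMap.ext fun u => (Submodule.Quotient.mk_eq_zero N).2 (hX u))

/-- The action of the Chevalley generators on the free Verma module. -/
def freeAction (hA : IsSimplyLaced A) :
    FreeLieAlgebra ℝ (Generators I) →ₗ⁅ℝ⁆ stabiliser (serreSubmodule A) :=
  FreeLieAlgebra.lift ℝ fun
    | Generators.H i => ⟨opH A i, fun _ ⟨n, hu⟩ => ⟨n, hu.opH hA i⟩⟩
    | Generators.E i => ⟨opE i, fun _ ⟨n, hu⟩ => ⟨n + 1, .opE _ i _ hu⟩⟩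
    | Generators.F i => ⟨opF A i, fun _ ⟨n, hu⟩ => ⟨n, hu.opF hA i⟩⟩

theorem freeAction_H (hA : IsSimplyLaced A) (i : I) :
    (stabiliser (serreSubmodule A)).incl (freeAction hA (FreeLieAlgebra.of ℝ (Generators.H i)))
      = opH A i := by
  rw [freeAction, FreeLieAlgebra.lift_of_apply]; rfl

theorem freeAction_E (hA : IsSimplyLaced A) (i : I) :
    (stabiliser (serreSubmodule A)).incl (freeAction hA (FreeLieAlgebra.of ℝ (Generators.E i)))
      = opE i := by
  rw [freeAction, FreeLieAlgebra.lift_of_apply]; rfl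

theorem freeAction_F (hA : IsSimplyLaced A) (i : I) :
    (stabiliser (serreSubmodule A)).incl (freeAction hA (FreeLieAlgebra.of ℝ (Generators.F i)))
      = opF A i := by
  rw [freeAction, FreeLieAlgebra.lift_of_apply]; rfl

/-- All relations except the Serre relations of the `e_i` hold as identities of operators on words;
only those need the passage to the quotient. -/
theorem freeAction_relation (hA : IsSimplyLaced A) {y : FreeLieAlgebra ℝ (Generators I)}
    (hy : y ∈ Relations.toSet ℝ A) (u : List I →₀ ℝ) :
    (stabiliser (serreSubmodule A)).incl (freeAction hA y) u ∈ serreSubmodule A := by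
  have key : ∀ X : Module.End ℝ (List I →₀ ℝ), X = 0 → X u ∈ serreSubmodule A := by
    rintro _ rfl; exact Submodule.zero_mem _
  rcases hy with ((((⟨⟨i, j⟩, rfl⟩ | ⟨⟨i, j⟩, rfl⟩) | ⟨⟨i, j⟩, rfl⟩) | ⟨⟨i, j⟩, rfl⟩) |
    ⟨⟨i, j⟩, rfl⟩) | ⟨⟨i, j⟩, rfl⟩
  · apply key
    simp only [Relations.HH, Function.uncurry, Function.comp, LieHom.map_lie, freeAction_H,
      lie_opH_opH]
  · apply key
    by_cases hij : i = j
    · subst hij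
      simp only [Relations.EF, Function.uncurry, Function.comp, LieHom.map_lie, freeAction_H,
        map_sub, freeAction_E, freeAction_F, if_true, lie_opE_opF, sub_self]
    · simp only [Relations.EF, Function.uncurry, Function.comp, LieHom.map_lie, if_neg hij,
        freeAction_E, freeAction_F, lie_opE_opF]
  · apply key
    simp only [Relations.HE, Function.uncurry, Function.comp, LieHom.map_lie, freeAction_H,
      map_sub, map_zsmul, freeAction_E, lie_opH_opE]
    have := Int.cast_smul_eq_zsmul ℝ (A i j) (opE j)
    exact sub_eq_zero.2 this
  · apply key
    simp only [Relations.HF, Function.uncurry, Function.comp, LieHom.map_lie, freeAction_H,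
      map_add, map_zsmul, freeAction_F, (isVerma_op A).lie_H_F]
    have := Int.cast_smul_eq_zsmul ℝ (A i j) (opF A j)
    exact neg_add_eq_zero.2 this
  · have : (stabiliser (serreSubmodule A)).incl (freeAction hA (Relations.adE ℝ A (i, j)))
        = serre A opE i j := by
      rw [show Relations.adE ℝ A (i, j)
        = serre A (fun i => FreeLieAlgebra.of ℝ (Generators.E i)) i j from rfl, map_serre,
        map_serre]
      congr 1
      funext i
      exact freeAction_E hA i
    rw [this]
    exact ⟨0, .serre _ _ _ _⟩
  · apply key
    rw [← (isVerma_op A).serre_F hA i j, show Relations.adF ℝ A (i, j)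
        = serre A (fun i => FreeLieAlgebra.of ℝ (Generators.F i)) i j from rfl, map_serre,
        map_serre]
    congr 1
    funext i
    exact freeAction_F hA i

/-- The action of the Kac–Moody algebra on its Verma module. -/
def vermaAction (hA : IsSimplyLaced A) :
    Matrix.ToLieAlgebra ℝ A →ₗ⁅ℝ⁆ Module.End ℝ ((List I →₀ ℝ) ⧸ serreSubmodule A) :=
  { (Relations.toIdeal ℝ A).toSubmodule.liftQ
      ((quotientHom (serreSubmodule A)).comp (freeAction hA)).toLinearMap (fun y hy => by
        have : Relations.toIdeal ℝ A ≤
            ((quotientHom (serreSubmodule A)).comp (freeAction hA)).ker :=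
          LieSubmodule.lieSpan_le.2 fun y hy => by
            rw [SetLike.mem_coe, LieHom.mem_ker]
            exact quotientHom_eq_zero _ _ (freeAction_relation hA hy)
        simpa using this hy) with
    map_lie' := by
      intro x y
      induction x using Submodule.Quotient.induction_on
      induction y using Submodule.Quotient.induction_on
      exact ((quotientHom (serreSubmodule A)).comp (freeAction hA)).map_lie _ _ }

theorem vermaAction_sub_mk (hA : IsSimplyLaced A) (i : I) (u : List I →₀ ℝ) :
    vermaAction hA (e A i - f A i) (Submodule.Quotient.mk u)
      = Submodule.Quotient.mk ((opE i - opF A i) u) := by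
  have h1 : vermaAction hA (e A i) (Submodule.Quotient.mk u)
      = Submodule.Quotient.mk (opE i u) := by
    rw [← freeAction_E hA i]; rfl
  have h2 : vermaAction hA (f A i) (Submodule.Quotient.mk u)
      = Submodule.Quotient.mk (opF A i u) := by
    rw [← freeAction_F hA i]; rfl
  rw [map_sub, LinearMap.sub_apply, h1, h2]; rfl

/-- Berman's theorem for simply-laced algebras: operators which satisfy the Berman relations
define a representation of the maximal compact subalgebra. -/
theorem IsSimplyLaced.exists_representation (hA : IsSimplyLaced A) {M : Type} [AddCommGroup M]
    [Module ℝ M] (J : I → Module.End ℝ M)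
    (hJ1 : ∀ i j, A i j = -1 → ⁅J i, ⁅J i, J j⁆⁆ + J j = 0)
    (hJ0 : ∀ i j, A i j = 0 → ⁅J i, J j⁆ = 0) :
    ∃ ρ : maximalCompact A →ₗ⁅ℝ⁆ Module.End ℝ M, ∀ i, ρ (bermanGenerator A i) = J i := by
  let Θ : ((List I →₀ ℝ) ⧸ serreSubmodule A) →ₗ[ℝ] Module.End ℝ M :=
    (serreSubmodule A).liftQ (theta A J) fun u ⟨n, hu⟩ => hu.theta_eq_zero hA hJ1 hJ0
  let vac : (List I →₀ ℝ) ⧸ serreSubmodule A := Submodule.Quotient.mk (single [] 1)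
  have hvac : Θ vac = 1 := theta_nil J
  -- Since `Θ` maps the vacuum to `1`, the desired `Θ(x q) = ρ(x) Θ(q)` leaves no choice but `ρ(x) =
  -- Θ(x · vac)`. This is well defined and linear from the outset, so only the intertwining property
  -- is left.
  let r : maximalCompact A →ₗ[ℝ] Module.End ℝ M :=
    { toFun := fun x => Θ (vermaAction hA x vac)
      map_add' := fun x y => by simp
      map_smul' := fun c x => by simp }
  have hgen : ∀ i q, Θ (vermaAction hA (bermanGenerator A i) q) = J i * Θ q := by
    intro i q
    induction q using Submodule.Quotient.induction_on with
    | H u =>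
      rw [show ((bermanGenerator A i : maximalCompact A) : Matrix.ToLieAlgebra ℝ A)
        = e A i - f A i from rfl, vermaAction_sub_mk]
      exact theta_sub J i u
  have hr : ∀ i, r (bermanGenerator A i) = J i := fun i => by
    change Θ (vermaAction hA (bermanGenerator A i) vac) = J i
    rw [hgen, hvac, mul_one]
  have hlie : ∀ x y : maximalCompact A, (∀ q, Θ (vermaAction hA x q) = r x * Θ q) →
      (∀ q, Θ (vermaAction hA y q) = r y * Θ q) → ∀ q,
      Θ (vermaAction hA ((⁅x, y⁆ : maximalCompact A) : Matrix.ToLieAlgebra ℝ A) q)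
        = ⁅r x, r y⁆ * Θ q := by
    intro x y hx hy q
    rw [LieSubalgebra.coe_bracket, LieHom.map_lie, LieRing.of_associative_ring_bracket,
      LinearMap.sub_apply, map_sub, Module.End.mul_apply, Module.End.mul_apply, hx, hy, hy, hx,
      LieRing.of_associative_ring_bracket, sub_mul, mul_assoc, mul_assoc]
  -- Evaluating the intertwining rule for `[x, y]` at the vacuum identifies the value of `r` on the
  -- bracket.
  have hlie' : ∀ x y : maximalCompact A, (∀ q, Θ (vermaAction hA x q) = r x * Θ q) →
      (∀ q, Θ (vermaAction hA y q) = r y * Θ q) → r ⁅x, y⁆ = ⁅r x, r y⁆ := by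
    intro x y hx hy
    have := hlie x y hx hy vac
    rwa [hvac, mul_one] at this
  have key : ∀ x : maximalCompact A, ∀ q, Θ (vermaAction hA x q) = r x * Θ q := by
    refine maximalCompact_induction hA.diag (fun i q => ?_) (fun q => ?_) (fun x y hx hy q => ?_)
      (fun c x hx q => ?_) (fun x y hx hy q => ?_)
    · rw [hgen, hr]
    · simp
    · rw [map_add, add_mul, ← hx, ← hy, ← map_add, ← LinearMap.add_apply, ← map_add]; rfl
    · rw [map_smul, smul_mul_assoc, ← hx, ← map_smul, ← LinearMap.smul_apply, ← map_smul]; rfl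
    · rw [hlie x y hx hy, hlie' x y hx hy]
  exact ⟨{ r with map_lie' := fun {x y} => hlie' x y (key x) (key y) }, hr⟩

end Verma

end Berman

end KacMoody

end

noncomputable section

namespace Spin

open Matrix

/-! ### Symmetric tensors and their pairing with powers of vectors -/

section SymmetricTensors

variable {s d : ℕ}

/-- The tensor power `u_{a₁} ⋯ u_{a_s}` of a vector. -/
def power (s : ℕ) (u : Fin d → ℝ) : (Fin s → Fin d) → ℝ := fun A => ∏ k, u (A k)

theorem power_dot_power (u v : Fin d → ℝ) : power s u ⬝ᵥ power s v = (u ⬝ᵥ v) ^ s := by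
  simp only [dotProduct, power, ← Finset.prod_mul_distrib]
  exact (Fintype.sum_pow (fun a => u a * v a) s).symm

theorem power_mem (u : Fin d → ℝ) : power s u ∈ SymTensor s d := fun σ A =>
  Equiv.prod_comp σ fun k => u (A k)

/-- Symmetric tensors which agree as homogeneous polynomials are equal. -/
theorem eq_of_power_dot {φ ψ : (Fin s → Fin d) → ℝ} (hφ : φ ∈ SymTensor s d)
    (hψ : ψ ∈ SymTensor s d) (h : ∀ u, power s u ⬝ᵥ φ = power s u ⬝ᵥ ψ) : φ = ψ := by
  have key : ∀ χ ∈ SymTensor s d, (∀ u, power s u ⬝ᵥ χ = 0) → χ = 0 := by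
    intro χ hχ h0
    -- The pairing of `χ` with powers is the polynomial function with a term `χ A` on the monomial
    -- of each index word `A`. It vanishes on all of `ℝ^d`, so the polynomial is zero.
    let m : (Fin s → Fin d) → (Fin d →₀ ℕ) := fun A => ∑ k, Finsupp.single (A k) 1
    let p : MvPolynomial (Fin d) ℝ := ∑ A, MvPolynomial.monomial (m A) (χ A)
    have hp : p = 0 := by
      refine MvPolynomial.funext fun u => ?_
      rw [map_zero, ← h0 u, map_sum]
      refine Finset.sum_congr rfl fun A _ => ?_
      rw [MvPolynomial.eval_monomial, mul_comm]
      congr 1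
      rw [← Finsupp.prod_finsetSum_index (fun _ => pow_zero _) (fun _ _ _ => pow_add _ _ _)]
      exact Finset.prod_congr rfl fun k _ => by simp
    have hm : ∀ A B, m A = m B → χ A = χ B := by
      intro A B hAB
      have hcard : ∀ c, Fintype.card {k // A k = c} = Fintype.card {k // B k = c} := by
        intro c
        have h1 := DFunLike.congr_fun hAB c
        simpa [m, Finsupp.finsetSum_apply, Finsupp.single_apply, Fintype.card_subtype] using h1
      -- Two index words with the same monomial use each value equally often, so matching fibres
      -- gives a permutation between them.
      let σ : Equiv.Perm (Fin s) := Equiv.ofFiberEquiv fun c => Fintype.equivOfCardEq (hcard c)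
      have hσ : A = B ∘ σ := funext fun k => (Equiv.ofFiberEquiv_map _ k).symm
      rw [hσ, hχ]
    funext A
    have hc := congrArg (MvPolynomial.coeff (m A)) hp
    simp only [p, MvPolynomial.coeff_sum, MvPolynomial.coeff_monomial, MvPolynomial.coeff_zero]
      at hc
    -- The coefficient at the monomial of `A` is `χ A` times the nonzero number of rearrangements of
    -- `A`.
    rw [← Finset.sum_filter, Finset.sum_congr rfl (g := fun _ => χ A) (fun B hB =>
      hm B A (Finset.mem_filter.1 hB).2), Finset.sum_const, nsmul_eq_mul] at hc
    refine (mul_eq_zero.1 hc).resolve_left ?_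
    exact Nat.cast_ne_zero.2 (Finset.card_pos.2 ⟨A, by simp⟩).ne'
  rw [← sub_eq_zero]
  exact key _ ((SymTensor s d).sub_mem hφ hψ) fun u => by rw [dotProduct_sub, h u, sub_self]

/-- Tensors which are symmetric in the lower and in the upper indices. -/
def symTensors (s d : ℕ) : Submodule ℝ (Tensor s d) where
  carrier := {X | ∀ (σ τ : Equiv.Perm (Fin s)) (A B : Fin s → Fin d), X (A ∘ σ) (B ∘ τ) = X A B}
  add_mem' := by intro X Y hX hY σ τ A B; simp [hX σ τ, hY σ τ]
  zero_mem' := by intro σ τ A B; rfl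
  smul_mem' := by intro c X hX σ τ A B; simp [hX σ τ]

theorem mulVec_mem {X : Tensor s d} (hX : X ∈ symTensors s d) (φ : (Fin s → Fin d) → ℝ) :
    X *ᵥ φ ∈ SymTensor s d := fun σ A =>
  Finset.sum_congr rfl fun B _ => congrArg (· * φ B) (hX σ 1 A B)

theorem vecMul_mem {X : Tensor s d} (hX : X ∈ symTensors s d) (φ : (Fin s → Fin d) → ℝ) :
    φ ᵥ* X ∈ SymTensor s d := fun τ B =>
  Finset.sum_congr rfl fun A _ => congrArg (φ A * ·) (hX 1 τ A B)

theorem mul_mem {X Y : Tensor s d} (hX : X ∈ symTensors s d) (hY : Y ∈ symTensors s d) :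
    X * Y ∈ symTensors s d := fun σ τ A B =>
  Finset.sum_congr rfl fun C _ =>
    congrArg₂ (· * ·) (hX σ 1 A C) (hY 1 τ C B)

theorem vecMulVec_mem {φ ψ : (Fin s → Fin d) → ℝ} (hφ : φ ∈ SymTensor s d)
    (hψ : ψ ∈ SymTensor s d) : vecMulVec φ ψ ∈ symTensors s d := fun σ τ A B => by
  rw [vecMulVec_apply, vecMulVec_apply, hφ, hψ]

theorem eq_of_mulVec_power {X Y : Tensor s d} (hX : X ∈ symTensors s d)
    (hY : Y ∈ symTensors s d) (h : ∀ v, X *ᵥ power s v = Y *ᵥ power s v) : X = Y := by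
  funext A
  refine eq_of_power_dot (φ := X A) (ψ := Y A) (fun τ B => ?_) (fun τ B => ?_) fun v => ?_
  · rw [← hX 1 τ A B]; rfl
  · rw [← hY 1 τ A B]; rfl
  · rw [dotProduct_comm, dotProduct_comm _ (Y A)]
    exact congrFun (h v) A

/-- Polarisation in both groups of indices: it turns each tensor identity below into a polynomial
identity in the vectors `u` and `v`. -/
theorem eq_of_pairing {X Y : Tensor s d} (hX : X ∈ symTensors s d) (hY : Y ∈ symTensors s d)
    (h : ∀ u v, power s u ⬝ᵥ (X *ᵥ power s v) = power s u ⬝ᵥ (Y *ᵥ power s v)) : X = Y :=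
  eq_of_mulVec_power hX hY fun v =>
    eq_of_power_dot (mulVec_mem hX _) (mulVec_mem hY _) fun u => h u v

theorem symmetrise_mem (T : Tensor s d) : symmetrise T ∈ symTensors s d := by
  intro σ τ A B
  simp only [symmetrise]
  congr 1
  refine Fintype.sum_equiv (Equiv.mulLeft σ) _ _ fun σ' => ?_
  exact Fintype.sum_equiv (Equiv.mulLeft τ) _ _ fun τ' => rfl

theorem symmetrise_eq_self {T : Tensor s d} (hT : T ∈ symTensors s d) : symmetrise T = T := by
  funext A B
  have : (s.factorial : ℝ) ≠ 0 := by positivity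
  simp only [symmetrise, hT _ _ A B, Finset.sum_const, Finset.card_univ, Fintype.card_perm,
    Fintype.card_fin, nsmul_eq_mul]
  field_simp

/-- Permutations of the indices of `T` can be moved onto `φ` and `ψ`, which absorb them; each of the
`(s!)²` terms contributes equally. -/
theorem pairing_symmetrise {φ ψ : (Fin s → Fin d) → ℝ} (hφ : φ ∈ SymTensor s d)
    (hψ : ψ ∈ SymTensor s d) (T : Tensor s d) :
    φ ⬝ᵥ (symmetrise T *ᵥ ψ) = φ ⬝ᵥ (T *ᵥ ψ) := by
  have hs : (s.factorial : ℝ) ≠ 0 := by positivity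
  have key : ∀ σ τ : Equiv.Perm (Fin s),
      ∑ A, ∑ B, φ A * (T (A ∘ σ) (B ∘ τ) * ψ B) = ∑ A, ∑ B, φ A * (T A B * ψ B) := by
    intro σ τ
    refine Fintype.sum_equiv (Equiv.arrowCongr σ.symm (Equiv.refl _)) _ _ fun A => ?_
    refine Fintype.sum_equiv (Equiv.arrowCongr τ.symm (Equiv.refl _)) _ _ fun B => ?_
    have h1 : (Equiv.arrowCongr σ.symm (Equiv.refl (Fin d))) A = A ∘ σ := rfl
    have h2 : (Equiv.arrowCongr τ.symm (Equiv.refl (Fin d))) B = B ∘ τ := rfl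
    rw [h1, h2, hφ, hψ]
  calc φ ⬝ᵥ (symmetrise T *ᵥ ψ)
      = ∑ σ : Equiv.Perm (Fin s), ∑ τ : Equiv.Perm (Fin s), (1 / (s.factorial : ℝ) ^ 2) *
          ∑ A, ∑ B, φ A * (T (A ∘ σ) (B ∘ τ) * ψ B) := by
        simp only [dotProduct, mulVec, symmetrise, Finset.mul_sum, Finset.sum_mul]
        rw [Finset.sum_congr rfl fun A _ => Finset.sum_comm, Finset.sum_comm]
        refine Finset.sum_congr rfl fun σ _ => ?_
        rw [Finset.sum_congr rfl fun A _ => Finset.sum_comm, Finset.sum_comm]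
        refine Finset.sum_congr rfl fun τ _ => Finset.sum_congr rfl fun A _ =>
          Finset.sum_congr rfl fun B _ => ?_
        ring
    _ = φ ⬝ᵥ (T *ᵥ ψ) := by
        simp only [key, Finset.sum_const, Finset.card_univ, Fintype.card_perm, Fintype.card_fin,
          nsmul_eq_mul, dotProduct, mulVec, Finset.mul_sum]
        refine Finset.sum_congr rfl fun A _ => Finset.sum_congr rfl fun B _ => ?_
        field_simp

/-- A product of matrices whose upper indices are permuted. -/
def permProd (M : Fin s → Matrix (Fin d) (Fin d) ℝ) (π : Equiv.Perm (Fin s)) : Tensor s d :=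
  fun A B => ∏ k, M k (A k) (B (π k))

/-- A power of `v` does not see the permutation `π`, so the sum factorises over the slots. Crossed
index patterns thus pair like straight ones. -/
theorem pairing_permProd (M : Fin s → Matrix (Fin d) (Fin d) ℝ) (π : Equiv.Perm (Fin s))
    (u v : Fin d → ℝ) :
    power s u ⬝ᵥ (permProd M π *ᵥ power s v) = ∏ k, u ⬝ᵥ (M k *ᵥ v) := by
  have h1 : ∀ A : Fin s → Fin d,
      (permProd M π *ᵥ power s v) A
        = ∏ k, (M k *ᵥ v) (A k) := by
    intro A
    simp only [mulVec, dotProduct, permProd]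
    rw [Finset.prod_univ_sum, Fintype.piFinset_univ]
    refine Fintype.sum_equiv (Equiv.arrowCongr π.symm (Equiv.refl _)) _ _ fun B => ?_
    rw [Finset.prod_mul_distrib]
    congr 1
    exact (Equiv.prod_comp π fun k => v (B k)).symm
  simp only [dotProduct, h1]
  rw [Finset.prod_univ_sum, Fintype.piFinset_univ]
  exact Finset.sum_congr rfl fun A _ => by rw [power, Finset.prod_mul_distrib]

/-- The action of a matrix on symmetric tensors. -/
def tpow (s : ℕ) (M : Matrix (Fin d) (Fin d) ℝ) : Tensor s d :=
  symmetrise fun A B => ∏ k, M (A k) (B k)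

theorem tpow_mem (M : Matrix (Fin d) (Fin d) ℝ) : tpow s M ∈ symTensors s d := symmetrise_mem _

theorem pairing_tpow (M : Matrix (Fin d) (Fin d) ℝ) (u v : Fin d → ℝ) :
    power s u ⬝ᵥ (tpow s M *ᵥ power s v) = (u ⬝ᵥ (M *ᵥ v)) ^ s := by
  refine (pairing_symmetrise (power_mem u) (power_mem v) _).trans ?_
  refine (pairing_permProd (fun _ => M) 1 u v).trans ?_
  simp

theorem tpow_mulVec_power (M : Matrix (Fin d) (Fin d) ℝ) (v : Fin d → ℝ) :
    tpow s M *ᵥ power s v = power s (M *ᵥ v) :=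
  eq_of_power_dot (mulVec_mem (tpow_mem M) _) (power_mem _) fun u => by
    rw [pairing_tpow, power_dot_power]

theorem power_vecMul_tpow (M : Matrix (Fin d) (Fin d) ℝ) (u : Fin d → ℝ) :
    power s u ᵥ* tpow s M = power s (u ᵥ* M) :=
  eq_of_power_dot (vecMul_mem (tpow_mem M) _) (power_mem _) fun v => by
    rw [dotProduct_comm, ← dotProduct_mulVec, pairing_tpow, power_dot_power, dotProduct_mulVec,
      dotProduct_comm]

theorem tpow_mul (M N : Matrix (Fin d) (Fin d) ℝ) : tpow s M * tpow s N = tpow s (M * N) :=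
  eq_of_mulVec_power (mul_mem (tpow_mem M) (tpow_mem N)) (tpow_mem _) fun v => by
    rw [← mulVec_mulVec, tpow_mulVec_power, tpow_mulVec_power, tpow_mulVec_power, mulVec_mulVec]

theorem power_dot_tpow_mulVec (M : Matrix (Fin d) (Fin d) ℝ) (u : Fin d → ℝ)
    (φ : (Fin s → Fin d) → ℝ) :
    power s u ⬝ᵥ (tpow s M *ᵥ φ) = power s (u ᵥ* M) ⬝ᵥ φ := by
  rw [dotProduct_mulVec, power_vecMul_tpow]

theorem vecMul_tpow_dot_power (M : Matrix (Fin d) (Fin d) ℝ) (v : Fin d → ℝ)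
    (φ : (Fin s → Fin d) → ℝ) :
    power s v ⬝ᵥ (φ ᵥ* tpow s M) = power s (M *ᵥ v) ⬝ᵥ φ := by
  rw [dotProduct_comm, ← dotProduct_mulVec, tpow_mulVec_power, dotProduct_comm]

/-- Symmetry of `φ` is essential: `tpow s 1` is the symmetriser, which in general is not the
identity matrix. -/
theorem tpow_one_mulVec {φ : (Fin s → Fin d) → ℝ} (hφ : φ ∈ SymTensor s d) :
    tpow s (1 : Matrix (Fin d) (Fin d) ℝ) *ᵥ φ = φ :=
  eq_of_power_dot (mulVec_mem (tpow_mem _) _) hφ fun u => by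
    rw [power_dot_tpow_mulVec, vecMul_one]

theorem vecMul_tpow_one {φ : (Fin s → Fin d) → ℝ} (hφ : φ ∈ SymTensor s d) :
    φ ᵥ* tpow s (1 : Matrix (Fin d) (Fin d) ℝ) = φ :=
  eq_of_power_dot (vecMul_mem (tpow_mem _) _) hφ fun u => by
    rw [vecMul_tpow_dot_power, one_mulVec]

/-! Sums over two and three indices. -/

theorem sum_fin_two (F : Fin d → Fin d → ℝ) :
    ∑ A : Fin 2 → Fin d, F (A 0) (A 1) = ∑ a, ∑ b, F a b := by
  rw [← Fintype.sum_prod_type']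
  exact Fintype.sum_equiv (finTwoArrowEquiv (Fin d)) _ _ fun A => rfl

theorem sum_fin_three (F : Fin d → Fin d → Fin d → ℝ) :
    ∑ A : Fin 3 → Fin d, F (A 0) (A 1) (A 2) = ∑ a, ∑ b, ∑ c, F a b c := by
  have h := Fintype.sum_equiv (Fin.consEquiv fun _ : Fin 3 => Fin d).symm
    (fun A : Fin 3 → Fin d => F (A 0) (A 1) (A 2))
    (fun p : Fin d × (Fin 2 → Fin d) => F p.1 (p.2 0) (p.2 1)) (fun A => rfl)
  rw [h, Fintype.sum_prod_type]
  exact Finset.sum_congr rfl fun a _ => sum_fin_two (F a)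

end SymmetricTensors

end Spin

end

noncomputable section

namespace Spin

open Matrix

/-! ### The polarisation tensors as quantised reflections -/

namespace WallData

variable {d : ℕ} (D : WallData d)

theorem raise_eq (v : Fin d → ℝ) : D.raise v = D.metric *ᵥ v := rfl

theorem dot_eq (v w : Fin d → ℝ) : D.dot v w = v ⬝ᵥ (D.metric *ᵥ w) := rfl

theorem raise_add (v w : Fin d → ℝ) : D.raise (v + w) = D.raise v + D.raise w := mulVec_add _ _ _

theorem raise_neg (v : Fin d → ℝ) : D.raise (-v) = -D.raise v := mulVec_neg _ _

theorem dot_raise (v w : Fin d → ℝ) : D.dot v w = D.raise w ⬝ᵥ v := dotProduct_comm _ _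

theorem dot_comm (v w : Fin d → ℝ) : D.dot v w = D.dot w v := by
  rw [dot_eq, dot_eq, dotProduct_mulVec, ← mulVec_transpose, D.metric_symm.eq, dotProduct_comm]

theorem dot_add_left (v v' w : Fin d → ℝ) : D.dot (v + v') w = D.dot v w + D.dot v' w :=
  add_dotProduct _ _ _

theorem dot_add_right (v w w' : Fin d → ℝ) : D.dot v (w + w') = D.dot v w + D.dot v w' := by
  rw [dot_comm, dot_add_left, D.dot_comm w, D.dot_comm w']

theorem dot_neg_right (v w : Fin d → ℝ) : D.dot v (-w) = -D.dot v w := by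
  rw [dot_eq, mulVec_neg, dotProduct_neg]; rfl

theorem dot_smul_left (c : ℝ) (v w : Fin d → ℝ) : D.dot (c • v) w = c * D.dot v w :=
  smul_dotProduct _ _ _

theorem dot_smul_right (c : ℝ) (v w : Fin d → ℝ) : D.dot v (c • w) = c * D.dot v w := by
  rw [dot_comm, dot_smul_left, dot_comm]

/-- The reflection `v_a ↦ v_a - α_a α^b v_b`. -/
def reflection (α : Fin d → ℝ) : Matrix (Fin d) (Fin d) ℝ := 1 - vecMulVec α (D.raise α)

theorem reflection_mulVec (α v : Fin d → ℝ) :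
    D.reflection α *ᵥ v = v - (D.raise α ⬝ᵥ v) • α := by
  rw [reflection, sub_mulVec, one_mulVec, vecMulVec_mulVec]
  ext a; simp

theorem vecMul_reflection (α u : Fin d → ℝ) :
    u ᵥ* D.reflection α = u - (u ⬝ᵥ α) • D.raise α := by
  rw [reflection, vecMul_sub, vecMul_one, vecMul_vecMulVec]

theorem reflection_neg (α : Fin d → ℝ) : D.reflection (-α) = D.reflection α := by
  rw [reflection, raise_neg, neg_vecMulVec, vecMulVec_neg, neg_neg, reflection]

theorem dot_reflection (α v w : Fin d → ℝ) :
    v ⬝ᵥ (D.reflection α *ᵥ w) = v ⬝ᵥ w - (v ⬝ᵥ α) * (D.raise α ⬝ᵥ w) := by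
  rw [reflection_mulVec, dotProduct_sub, dotProduct_smul, smul_eq_mul, mul_comm]

theorem dot_reflection_mul (α β v w : Fin d → ℝ) :
    v ⬝ᵥ ((D.reflection α * D.reflection β) *ᵥ w)
      = v ⬝ᵥ w - (v ⬝ᵥ α) * (D.raise α ⬝ᵥ w) - (v ⬝ᵥ β) * (D.raise β ⬝ᵥ w)
        + (v ⬝ᵥ α) * D.dot α β * (D.raise β ⬝ᵥ w) := by
  rw [← mulVec_mulVec, dot_reflection, dot_reflection, reflection_mulVec, dotProduct_sub,
    dotProduct_smul, smul_eq_mul, ← D.dot_raise β α, D.dot_comm β]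
  ring

theorem reflection_mul_comm {α β : Fin d → ℝ} (h : D.dot α β = 0) :
    D.reflection α * D.reflection β = D.reflection β * D.reflection α := by
  have h1 : D.raise α ⬝ᵥ β = 0 := by rw [← D.dot_raise, D.dot_comm, h]
  have h2 : D.raise β ⬝ᵥ α = 0 := by rw [← D.dot_raise, h]
  simp only [reflection, sub_mul, mul_sub, one_mul, mul_one, vecMulVec_mul_vecMulVec, h1, h2,
    zero_smul, vecMulVec_zero]
  abel

end WallData

theorem delta_eq {d : ℕ} (a b : Fin d) : delta a b = (1 : Matrix (Fin d) (Fin d) ℝ) a b := by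
  rw [delta, Matrix.one_apply]

section Polarisation

variable {d : ℕ} (D : WallData d)

theorem pol32_eq (α : Fin d → ℝ) :
    pol32 D α = (1 / 2 : ℝ) • tpow 1 (D.reflection α) - (1 / 4 : ℝ) • tpow 1 1 := by
  refine eq_of_pairing (symmetrise_mem _) (Submodule.sub_mem _ (Submodule.smul_mem _ _
    (tpow_mem _)) (Submodule.smul_mem _ _ (tpow_mem _))) fun u v => ?_
  have hT : @Eq (Tensor 1 d)
      (fun A B => -(1 / 2) * α (A 0) * D.raise α (B 0) + 1 / 4 * delta (A 0) (B 0))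
      ((-(1 / 2) : ℝ) • permProd (fun _ => vecMulVec α (D.raise α)) (Equiv.refl _)
        + (1 / 4 : ℝ) • permProd (fun _ => 1) (Equiv.refl _)) := by
    refine Matrix.ext fun A B => ?_
    simp only [Matrix.add_apply, Matrix.smul_apply, permProd, ← delta_eq,
      vecMulVec_apply, Equiv.refl_apply, smul_eq_mul, Fin.prod_univ_one]
    ring
  refine (pairing_symmetrise (power_mem u) (power_mem v) _).trans ?_
  rw [hT, add_mulVec, sub_mulVec]
  simp only [smul_mulVec, dotProduct_add, dotProduct_sub, dotProduct_smul, pairing_tpow,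
    pairing_permProd, D.dot_reflection, vecMulVec_mulVec, one_mulVec, smul_eq_mul,
    Finset.prod_const, Finset.card_univ, Fintype.card_fin, op_smul_eq_smul]
  ring

/-- Paired with powers, the right side is `½ (u·v - (u·α)(α·v))² - ¼ (u·v)²`; expanding the square
gives the three terms of the tensor. -/
theorem pol52_eq (α : Fin d → ℝ) :
    pol52 D α = (1 / 2 : ℝ) • tpow 2 (D.reflection α) - (1 / 4 : ℝ) • tpow 2 1 := by
  refine eq_of_pairing (symmetrise_mem _) (Submodule.sub_mem _ (Submodule.smul_mem _ _
    (tpow_mem _)) (Submodule.smul_mem _ _ (tpow_mem _))) fun u v => ?_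
  have hT : @Eq (Tensor 2 d)
      (fun A B => 1 / 2 * (α (A 0) * α (A 1) * D.raise α (B 0) * D.raise α (B 1))
        - α (A 0) * delta (A 1) (B 0) * D.raise α (B 1)
        + 1 / 4 * (delta (A 0) (B 0) * delta (A 1) (B 1)))
      ((1 / 2 : ℝ) • permProd (fun _ => vecMulVec α (D.raise α)) (Equiv.refl _)
        - permProd ![vecMulVec α (D.raise α), 1] (Equiv.swap 0 1)
        + (1 / 4 : ℝ) • permProd (fun _ => 1) (Equiv.refl _)) := by
    refine Matrix.ext fun A B => ?_
    simp only [Matrix.add_apply, Matrix.sub_apply, Matrix.smul_apply, permProd, ← delta_eq,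
      vecMulVec_apply, Equiv.refl_apply, smul_eq_mul, Fin.prod_univ_two,
      Matrix.cons_val_zero, Matrix.cons_val_one, Equiv.swap_apply_left, Equiv.swap_apply_right]
    ring
  refine (pairing_symmetrise (power_mem u) (power_mem v) _).trans ?_
  rw [hT, add_mulVec, sub_mulVec, sub_mulVec]
  simp only [smul_mulVec, dotProduct_add, dotProduct_sub, dotProduct_smul, pairing_tpow,
    pairing_permProd, D.dot_reflection, vecMulVec_mulVec, one_mulVec, smul_eq_mul,
    Finset.prod_const, Finset.card_univ, Fintype.card_fin, op_smul_eq_smul, Fin.prod_univ_two,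
    Matrix.cons_val_zero, Matrix.cons_val_one]
  ring

/-! ### The cubic tensors -/

/-- The components of `β_a β_b β_c - k β_(a G_{bc)}`. -/
def cubic (k : ℝ) (β : Fin d → ℝ) (G : Matrix (Fin d) (Fin d) ℝ) : (Fin 3 → Fin d) → ℝ :=
  fun A => β (A 0) * β (A 1) * β (A 2) - k / 3 * (β (A 0) * G (A 1) (A 2)
    + β (A 1) * G (A 0) (A 2) + β (A 2) * G (A 0) (A 1))

theorem cubic_mem (k : ℝ) (β : Fin d → ℝ) {G : Matrix (Fin d) (Fin d) ℝ} (hG : G.IsSymm) :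
    cubic k β G ∈ SymTensor 3 d := by
  intro σ A
  have key : ∀ i j l : Fin 3, i ≠ j → i ≠ l → j ≠ l →
      β (A i) * β (A j) * β (A l) - k / 3 * (β (A i) * G (A j) (A l)
        + β (A j) * G (A i) (A l) + β (A l) * G (A i) (A j)) = cubic k β G A := by
    intro i j l hij hil hjl
    have h1 := hG.apply (A 0) (A 1)
    have h2 := hG.apply (A 0) (A 2)
    have h3 := hG.apply (A 1) (A 2)
    fin_cases i <;> fin_cases j <;> fin_cases l <;>
      first
        | exact absurd rfl hij
        | exact absurd rfl hil
        | exact absurd rfl hjl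
        | (simp only [cubic, Fin.zero_eta, Fin.mk_one, Fin.reduceFinMk, h1, h2, h3] <;> ring)
  exact key (σ 0) (σ 1) (σ 2) (fun h => absurd (σ.injective h) (by decide))
    (fun h => absurd (σ.injective h) (by decide)) (fun h => absurd (σ.injective h) (by decide))

/-- The tensor `x_a H_{bc}`. -/
def vecTensor (x : Fin d → ℝ) (H : Matrix (Fin d) (Fin d) ℝ) : (Fin 3 → Fin d) → ℝ :=
  fun A => x (A 0) * H (A 1) (A 2)

theorem cubic_dot_sym (k : ℝ) (x : Fin d → ℝ) (H : Matrix (Fin d) (Fin d) ℝ)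
    {φ : (Fin 3 → Fin d) → ℝ} (hφ : φ ∈ SymTensor 3 d) :
    cubic k x H ⬝ᵥ φ = power 3 x ⬝ᵥ φ - k * (vecTensor x H ⬝ᵥ φ) := by
  have perm : ∀ σ : Equiv.Perm (Fin 3), ∑ A, vecTensor x H (A ∘ σ) * φ A
      = vecTensor x H ⬝ᵥ φ := by
    intro σ
    refine Fintype.sum_equiv (Equiv.arrowCongr σ.symm (Equiv.refl _)) _ _ fun A => ?_
    rw [show (Equiv.arrowCongr σ.symm (Equiv.refl (Fin d))) A = A ∘ σ from rfl, hφ]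
  -- One permutation for each choice of the slot that carries the vector; a symmetric `φ` gives all
  -- three terms the same pairing.
  have h1 := perm 1
  have h2 := perm (Equiv.swap 0 1)
  have h3 := perm (finRotate 3)⁻¹
  have e : cubic k x H ⬝ᵥ φ = power 3 x ⬝ᵥ φ - k / 3 *
      (∑ A, vecTensor x H (A ∘ (1 : Equiv.Perm (Fin 3))) * φ A
        + ∑ A, vecTensor x H (A ∘ (Equiv.swap 0 1 : Equiv.Perm (Fin 3))) * φ A
        + ∑ A, vecTensor x H (A ∘ ((finRotate 3)⁻¹ : Equiv.Perm (Fin 3))) * φ A) := by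
    rw [← Finset.sum_add_distrib, ← Finset.sum_add_distrib, Finset.mul_sum, dotProduct,
      dotProduct, ← Finset.sum_sub_distrib]
    refine Finset.sum_congr rfl fun A _ => ?_
    have e0 : (finRotate 3)⁻¹ (0 : Fin 3) = 2 := by decide
    have e1 : (finRotate 3)⁻¹ (1 : Fin 3) = 0 := by decide
    have e2 : (finRotate 3)⁻¹ (2 : Fin 3) = 1 := by decide
    have e3 : (Equiv.swap 0 1 : Equiv.Perm (Fin 3)) 2 = 2 := by decide
    simp only [cubic, power, vecTensor, Fin.prod_univ_three, Function.comp, e0, e1, e2, e3,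
      Equiv.swap_apply_left, Equiv.swap_apply_right, Equiv.Perm.one_apply]
    ring
  rw [e, h1, h2, h3]
  ring

theorem vecTensor_dot_power (x u : Fin d → ℝ) (H : Matrix (Fin d) (Fin d) ℝ) :
    vecTensor x H ⬝ᵥ power 3 u = (x ⬝ᵥ u) * (u ⬝ᵥ (H *ᵥ u)) := by
  have h := sum_fin_three fun a b c => x a * H b c * (u a * u b * u c)
  simp only [dotProduct, vecTensor, power, Fin.prod_univ_three, mulVec] at h ⊢
  rw [h, Finset.sum_mul]
  refine Finset.sum_congr rfl fun a _ => ?_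
  rw [Finset.mul_sum]
  refine Finset.sum_congr rfl fun b _ => ?_
  rw [Finset.mul_sum, Finset.mul_sum]
  refine Finset.sum_congr rfl fun c _ => ?_
  ring

theorem power_dot_cubic (k : ℝ) (β u : Fin d → ℝ) (G : Matrix (Fin d) (Fin d) ℝ) :
    power 3 u ⬝ᵥ cubic k β G = (u ⬝ᵥ β) ^ 3 - k * ((u ⬝ᵥ β) * (u ⬝ᵥ (G *ᵥ u))) := by
  rw [dotProduct_comm, cubic_dot_sym _ _ _ (power_mem u), power_dot_power, vecTensor_dot_power,
    dotProduct_comm β]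

/-- Of the three terms of the symmetrised `β G`, the one contracting `H` with `G` completely gives
the dimension `d`, and the other two give `1` each. This is the origin of the factor `d + 2`. -/
theorem vecTensor_dot_cubic (k : ℝ) (x β : Fin d → ℝ) {H G : Matrix (Fin d) (Fin d) ℝ}
    (hG : G.IsSymm) (hHG : H * G = 1) :
    vecTensor x H ⬝ᵥ cubic k β G
      = (x ⬝ᵥ β) * (β ⬝ᵥ (H *ᵥ β)) - k / 3 * ((d + 2) * (x ⬝ᵥ β)) := by
  have hone : ∀ a b, ∑ c, H b c * G a c = (1 : Matrix (Fin d) (Fin d) ℝ) b a := by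
    intro a b
    rw [← hHG, mul_apply]
    exact Finset.sum_congr rfl fun c _ => by rw [hG.apply]
  have hGH : G * H = 1 := mul_eq_one_comm.1 hHG
  have hone' : ∀ a c, ∑ b, H b c * G a b = (1 : Matrix (Fin d) (Fin d) ℝ) a c := by
    intro a c
    rw [← hGH, mul_apply]
    exact Finset.sum_congr rfl fun c _ => mul_comm _ _
  have h := sum_fin_three fun a b c => x a * H b c * (β a * β b * β c - k / 3 *
    (β a * G b c + β b * G a c + β c * G a b))
  have t0 : ∑ a, ∑ b, ∑ c, x a * H b c * (β a * β b * β c)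
      = (x ⬝ᵥ β) * (β ⬝ᵥ (H *ᵥ β)) := by
    simp only [dotProduct, mulVec]
    rw [Finset.sum_mul]
    refine Finset.sum_congr rfl fun a _ => ?_
    rw [Finset.mul_sum]
    refine Finset.sum_congr rfl fun b _ => ?_
    rw [Finset.mul_sum, Finset.mul_sum]
    refine Finset.sum_congr rfl fun c _ => ?_
    ring
  have t1 : ∑ a, ∑ b, ∑ c, x a * H b c * (β a * G b c) = d * (x ⬝ᵥ β) := by
    have : ∀ a b, ∑ c, x a * H b c * (β a * G b c) = x a * β a := by
      intro a b
      have h1 := hone b b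
      rw [one_apply_eq] at h1
      calc ∑ c, x a * H b c * (β a * G b c) = x a * β a * ∑ c, H b c * G b c := by
            rw [Finset.mul_sum]; exact Finset.sum_congr rfl fun c _ => by ring
        _ = x a * β a := by rw [h1, mul_one]
    simp only [this, Finset.sum_const, Finset.card_univ, Fintype.card_fin, nsmul_eq_mul,
      dotProduct, Finset.mul_sum]
  have t2 : ∑ a, ∑ b, ∑ c, x a * H b c * (β b * G a c) = x ⬝ᵥ β := by
    have : ∀ a b, ∑ c, x a * H b c * (β b * G a c)
        = x a * β b * (1 : Matrix (Fin d) (Fin d) ℝ) b a := by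
      intro a b
      rw [← hone a b, Finset.mul_sum]; exact Finset.sum_congr rfl fun c _ => by ring
    simp [this, one_apply, dotProduct]
  have t3 : ∑ a, ∑ b, ∑ c, x a * H b c * (β c * G a b) = x ⬝ᵥ β := by
    have : ∀ a c, ∑ b, x a * H b c * (β c * G a b)
        = x a * β c * (1 : Matrix (Fin d) (Fin d) ℝ) a c := by
      intro a c
      rw [← hone' a c, Finset.mul_sum]; exact Finset.sum_congr rfl fun b _ => by ring
    rw [Finset.sum_congr rfl fun a _ => Finset.sum_comm]
    simp [this, one_apply, dotProduct]
  have e : vecTensor x H ⬝ᵥ cubic k β G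
      = ∑ a, ∑ b, ∑ c, x a * H b c * (β a * β b * β c)
        - k / 3 * (∑ a, ∑ b, ∑ c, x a * H b c * (β a * G b c)
          + ∑ a, ∑ b, ∑ c, x a * H b c * (β b * G a c)
          + ∑ a, ∑ b, ∑ c, x a * H b c * (β c * G a b)) := by
    refine h.trans ?_
    simp only [← Finset.sum_add_distrib, Finset.mul_sum, ← Finset.sum_sub_distrib]
    refine Finset.sum_congr rfl fun a _ => Finset.sum_congr rfl fun b _ =>
      Finset.sum_congr rfl fun c _ => ?_
    ring
  rw [e, t0, t1, t2, t3]
  ring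

end Polarisation

end Spin

end

noncomputable section

namespace Spin

open Matrix

/-! ### The spin-7/2 tensor as a quantised reflection with a rank-one correction -/

section Polarisation

variable {d : ℕ} (D : WallData d)

/-- The coefficient `k` for which `β_a β_b β_c - k β_(a G_{bc)}` occurs in the spin-7/2 tensor. -/
def cubicCoeff (d : ℕ) (ε : ℝ) : ℝ := (6 + ε * Real.sqrt (6 * (8 + d))) / (2 + d)

theorem cubicCoeff_eq {ε : ℝ} (hε : ε = 1 ∨ ε = -1) :
    (2 + d) * cubicCoeff d ε ^ 2 - 12 * cubicCoeff d ε - 6 = 0 := by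
  have hS : Real.sqrt (6 * (8 + d)) ^ 2 = 6 * (8 + d) := Real.sq_sqrt (by positivity)
  have h2 : (2 + d : ℝ) ≠ 0 := by positivity
  have he : ε ^ 2 = 1 := by rcases hε with rfl | rfl <;> norm_num
  rw [cubicCoeff]
  set S := Real.sqrt (6 * (8 + d))
  field_simp
  have : (ε * S) ^ 2 = 6 * (8 + d) := by rw [mul_pow, he, hS, one_mul]
  linear_combination this

/-- The tensor `β_a β_b β_c - k β_(a G_{bc)}`. -/
def cubicLow (k : ℝ) (β : Fin d → ℝ) : (Fin 3 → Fin d) → ℝ := cubic k β D.lowMetric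

/-- The tensor `β^a β^b β^c - k β^(a G^{bc)}`. -/
def cubicUp (k : ℝ) (β : Fin d → ℝ) : (Fin 3 → Fin d) → ℝ := cubic k (D.raise β) D.metric

theorem cubicLow_mem (k : ℝ) (β : Fin d → ℝ) : cubicLow D k β ∈ SymTensor 3 d :=
  cubic_mem _ _ D.lowMetric_symm

theorem cubicUp_mem (k : ℝ) (β : Fin d → ℝ) : cubicUp D k β ∈ SymTensor 3 d :=
  cubic_mem _ _ D.metric_symm

theorem dot_vecMulVec_mulVec {n : Type} [Fintype n] (u φ ψ v : n → ℝ) :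
    u ⬝ᵥ (vecMulVec φ ψ *ᵥ v) = (u ⬝ᵥ φ) * (ψ ⬝ᵥ v) := by
  rw [vecMulVec_mulVec, op_smul_eq_smul, dotProduct_smul, smul_eq_mul, mul_comm]

/-- The correction `⅙ C_α ⊗ C^α` changes the sextic coefficient `-½` of the reflection part to `-⅓`
and produces trace terms with coefficients `k²/6` and `-k/6`, which are the two square-root
expressions (`c1`, `c2`). -/
theorem pol72_eq (α : Fin d → ℝ) {ε : ℝ} (hε : ε = 1 ∨ ε = -1) :
    pol72 D α ε = (1 / 2 : ℝ) • tpow 3 (D.reflection α) - (1 / 4 : ℝ) • tpow 3 1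
      + (1 / 6 : ℝ) • vecMulVec (cubicLow D (cubicCoeff d ε) α) (cubicUp D (cubicCoeff d ε) α) := by
  refine eq_of_pairing (symmetrise_mem _) (Submodule.add_mem _ (Submodule.sub_mem _
    (Submodule.smul_mem _ _ (tpow_mem _)) (Submodule.smul_mem _ _ (tpow_mem _)))
    (Submodule.smul_mem _ _ (vecMulVec_mem (cubicLow_mem D _ _) (cubicUp_mem D _ _))))
    fun u v => ?_
  let τ : (Fin 3 → Fin d) → ℝ := fun B => D.metric (B 0) (B 1) * D.raise α (B 2)
  have hτ : τ ⬝ᵥ power 3 v = (D.raise α ⬝ᵥ v) * (v ⬝ᵥ (D.metric *ᵥ v)) := by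
    have h := sum_fin_three fun a b c => D.metric a b * D.raise α c * (v a * v b * v c)
    simp only [dotProduct, τ, power, Fin.prod_univ_three, mulVec] at h ⊢
    rw [h, mul_comm (∑ i, D.raise α i * v i) _, Finset.sum_mul]
    refine Finset.sum_congr rfl fun a _ => ?_
    rw [mul_assoc, Finset.sum_mul, Finset.mul_sum]
    refine Finset.sum_congr rfl fun b _ => ?_
    rw [Finset.mul_sum, Finset.mul_sum]
    refine Finset.sum_congr rfl fun c _ => ?_
    ring
  have e0 : (finRotate 3)⁻¹ (0 : Fin 3) = 2 := by decide
  have e1 : (finRotate 3)⁻¹ (1 : Fin 3) = 0 := by decide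
  have e2 : (finRotate 3)⁻¹ (2 : Fin 3) = 1 := by decide
  have f0 : finRotate 3 (0 : Fin 3) = 1 := by decide
  have f1 : finRotate 3 (1 : Fin 3) = 2 := by decide
  have f2 : finRotate 3 (2 : Fin 3) = 0 := by decide
  have c1 : (14 + d + ε * (2 * Real.sqrt (6 * (8 + d)))) / (2 + d) ^ 2
      = cubicCoeff d ε ^ 2 / 6 := by
    have hS : Real.sqrt (6 * (8 + d)) ^ 2 = 6 * (8 + d) := Real.sq_sqrt (by positivity)
    have h2 : (2 + d : ℝ) ≠ 0 := by positivity
    have he : ε ^ 2 = 1 := by rcases hε with rfl | rfl <;> norm_num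
    rw [cubicCoeff]
    set S := Real.sqrt (6 * (8 + d))
    have : (ε * S) ^ 2 = 6 * (8 + d) := by rw [mul_pow, he, hS, one_mul]
    field_simp
    linear_combination -this
  have c2 : (6 + ε * Real.sqrt (6 * (8 + d))) / (6 * (2 + d)) = cubicCoeff d ε / 6 := by
    rw [cubicCoeff, div_div, mul_comm (2 + (d : ℝ)) 6]
  -- The rotations encode which upper index each delta is attached to; they disappear after pairing
  -- with powers.
  have hT : @Eq (Tensor 3 d)
      (fun A B =>
        -(1 / 3) * (α (A 0) * α (A 1) * α (A 2)
          * D.raise α (B 0) * D.raise α (B 1) * D.raise α (B 2))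
        + 3 / 2 * (α (A 0) * α (A 1) * delta (A 2) (B 0) * D.raise α (B 1) * D.raise α (B 2))
        - 3 / 2 * (α (A 0) * delta (A 1) (B 0) * delta (A 2) (B 1) * D.raise α (B 2))
        + 1 / 4 * (delta (A 0) (B 0) * delta (A 1) (B 1) * delta (A 2) (B 2))
        + (14 + d + ε * (2 * Real.sqrt (6 * (8 + d)))) / (2 + d) ^ 2 *
            (α (A 0) * D.lowMetric (A 1) (A 2) * D.metric (B 0) (B 1) * D.raise α (B 2))
        - (6 + ε * Real.sqrt (6 * (8 + d))) / (6 * (2 + d)) *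
            (α (A 0) * α (A 1) * α (A 2) * D.metric (B 0) (B 1) * D.raise α (B 2)
              + α (A 0) * D.lowMetric (A 1) (A 2)
                * D.raise α (B 0) * D.raise α (B 1) * D.raise α (B 2)))
      ((-(1 / 3) : ℝ) • permProd (fun _ => vecMulVec α (D.raise α)) (Equiv.refl _)
        + (3 / 2 : ℝ) • permProd ![vecMulVec α (D.raise α), vecMulVec α (D.raise α), 1]
            (finRotate 3)
        - (3 / 2 : ℝ) • permProd ![vecMulVec α (D.raise α), 1, 1] (finRotate 3)⁻¹
        + (1 / 4 : ℝ) • permProd (fun _ => 1) (Equiv.refl _)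
        + (cubicCoeff d ε ^ 2 / 6) • vecMulVec (vecTensor α D.lowMetric) τ
        - (cubicCoeff d ε / 6) • (vecMulVec (power 3 α) τ
            + vecMulVec (vecTensor α D.lowMetric) (power 3 (D.raise α)))) := by
    refine Matrix.ext fun A B => ?_
    simp only [Matrix.add_apply, Matrix.sub_apply, Matrix.smul_apply, permProd, c1, c2, ← delta_eq,
      Fin.prod_univ_three, e0, e1, e2, f0, f1, f2, vecMulVec_apply, vecTensor, power, τ,
      Matrix.cons_val_zero, Matrix.cons_val_one, Matrix.cons_val, Equiv.refl_apply, smul_eq_mul]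
    ring
  refine (pairing_symmetrise (power_mem u) (power_mem v) _).trans ?_
  rw [hT, add_mulVec, sub_mulVec, sub_mulVec, add_mulVec, add_mulVec, sub_mulVec, add_mulVec]
  simp only [smul_mulVec, dotProduct_add, dotProduct_sub, dotProduct_smul, pairing_tpow,
    pairing_permProd, D.dot_reflection, dot_vecMulVec_mulVec, one_mulVec, smul_eq_mul,
    Finset.prod_const, Finset.card_univ, Fintype.card_fin, Fin.prod_univ_three, add_mulVec,
    Matrix.cons_val_zero, Matrix.cons_val_one, Matrix.cons_val, hτ, vecTensor_dot_power,
    cubicLow, cubicUp, power_dot_cubic, dotProduct_comm (power 3 u) (vecTensor _ _),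
    dotProduct_comm (cubic _ _ _) (power 3 v), power_dot_power]
  rw [dotProduct_comm v (D.raise α), dotProduct_comm α u]
  ring

/-! ### Reflections of the cubic tensors -/

variable {D}

theorem reflection_mulVec_eq {α β : Fin d → ℝ} :
    D.reflection α *ᵥ β = β - D.dot α β • α := by
  rw [D.reflection_mulVec, ← D.dot_raise, D.dot_comm]

theorem dot_reflection_right {α v w : Fin d → ℝ} :
    D.dot v (D.reflection α *ᵥ w) = D.dot v w - D.dot α v * D.dot α w := by
  rw [reflection_mulVec_eq, sub_eq_add_neg, D.dot_add_right, ← neg_smul, D.dot_smul_right,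
    D.dot_comm v α]
  ring

theorem dot_reflection_left {α v w : Fin d → ℝ} :
    D.dot (D.reflection α *ᵥ v) w = D.dot v (D.reflection α *ᵥ w) := by
  rw [D.dot_comm, dot_reflection_right, dot_reflection_right, D.dot_comm w v]; ring

theorem dot_reflection_reflection {α v w : Fin d → ℝ} (h : D.dot α α = 2) :
    D.dot (D.reflection α *ᵥ v) (D.reflection α *ᵥ w) = D.dot v w := by
  rw [dot_reflection_left, dot_reflection_right, dot_reflection_right, dot_reflection_right, h]
  ring

theorem lowMetric_mulVec_raise (hG : D.metric * D.lowMetric = 1) (v : Fin d → ℝ) :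
    D.lowMetric *ᵥ D.raise v = v := by
  rw [D.raise_eq, mulVec_mulVec, mul_eq_one_comm.1 hG, one_mulVec]

/-- For `α · α = 2` the transposed reflection is an isometry of the inverse metric: the two linear
contributions `-(u·α)²` cancel `(u·α)² (α·α)`. -/
theorem lowMetric_vecMul_reflection (hG : D.metric * D.lowMetric = 1) {α : Fin d → ℝ}
    (hα : D.dot α α = 2) (u : Fin d → ℝ) :
    (u ᵥ* D.reflection α) ⬝ᵥ (D.lowMetric *ᵥ (u ᵥ* D.reflection α))
      = u ⬝ᵥ (D.lowMetric *ᵥ u) := by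
  have h1 : D.raise α ⬝ᵥ (D.lowMetric *ᵥ u) = u ⬝ᵥ α := by
    rw [dotProduct_mulVec, ← mulVec_transpose, D.lowMetric_symm.eq, lowMetric_mulVec_raise hG,
      dotProduct_comm]
  rw [D.vecMul_reflection, mulVec_sub, mulVec_smul, lowMetric_mulVec_raise hG, sub_dotProduct,
    dotProduct_sub, dotProduct_sub, smul_dotProduct, smul_dotProduct, dotProduct_smul,
    dotProduct_smul, h1, ← D.dot_raise, hα]
  simp only [smul_eq_mul]
  ring

/-- An isometry fixes `G`, so it acts on `β³ - k β G` only through `β`. -/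
theorem tpow_reflection_mulVec_cubicLow (hG : D.metric * D.lowMetric = 1) (k : ℝ)
    {α : Fin d → ℝ} (hα : D.dot α α = 2) (β : Fin d → ℝ) :
    tpow 3 (D.reflection α) *ᵥ cubicLow D k β = cubicLow D k (D.reflection α *ᵥ β) := by
  refine eq_of_power_dot (mulVec_mem (tpow_mem _) _) (cubicLow_mem D _ _) fun u => ?_
  rw [power_dot_tpow_mulVec, cubicLow, cubicLow, power_dot_cubic, power_dot_cubic,
    lowMetric_vecMul_reflection hG hα, ← dotProduct_mulVec]

theorem cubicUp_vecMul_tpow_reflection (k : ℝ)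
    {α : Fin d → ℝ} (hα : D.dot α α = 2) (β : Fin d → ℝ) :
    cubicUp D k β ᵥ* tpow 3 (D.reflection α) = cubicUp D k (D.reflection α *ᵥ β) := by
  refine eq_of_power_dot (vecMul_mem (tpow_mem _) _) (cubicUp_mem D _ _) fun v => ?_
  rw [vecMul_tpow_dot_power, cubicUp, cubicUp, power_dot_cubic, power_dot_cubic,
    D.raise_eq, D.raise_eq, ← D.dot_eq, ← D.dot_eq, ← D.dot_eq, ← D.dot_eq,
    dot_reflection_reflection hα, dot_reflection_left]

/-- For general `k` the pairing is `x³ + (-4k + (d+2) k²/3) x` with `x = α · β`. The quadratic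
equation makes the coefficient of `x` equal to `2`, hence the pairing is `0` and `-3` at `x = 0` and
`x = -1`, as required below. -/
theorem cubicUp_dot_cubicLow (hG : D.metric * D.lowMetric = 1) {k : ℝ}
    (hk : (2 + d) * k ^ 2 - 12 * k - 6 = 0) {α β : Fin d → ℝ} (hα : D.dot α α = 2)
    (hβ : D.dot β β = 2) :
    cubicUp D k α ⬝ᵥ cubicLow D k β = D.dot α β ^ 3 + 2 * D.dot α β := by
  have h1 : D.raise α ⬝ᵥ (D.lowMetric *ᵥ D.raise α) = 2 := by
    rw [lowMetric_mulVec_raise hG, ← D.dot_raise, hα]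
  rw [cubicUp, cubic_dot_sym _ _ _ (cubicLow_mem D k β), cubicLow, power_dot_cubic,
    vecTensor_dot_cubic _ _ _ D.lowMetric_symm hG, h1, ← D.dot_eq, hβ, ← D.dot_raise,
    D.dot_comm β α]
  linear_combination (D.dot α β / 3) * hk

theorem cubicLow_neg (k : ℝ) (α : Fin d → ℝ) : cubicLow D k (-α) = -cubicLow D k α := by
  funext A; simp only [cubicLow, cubic, Pi.neg_apply]; ring

theorem cubicUp_neg (k : ℝ) (α : Fin d → ℝ) : cubicUp D k (-α) = -cubicUp D k α := by
  funext A; simp only [cubicUp, cubic, D.raise_neg, Pi.neg_apply]; ring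

/-! ### The polarisation equations at the level of vectors -/

variable (D) in
/-- The polarisation equations for vectors of length two. -/
structure Polarises {s : ℕ} (X : (Fin d → ℝ) → Tensor s d) : Prop where
  mem : ∀ α, X α ∈ symTensors s d
  neg : ∀ α, X (-α) = X α
  anticomm : ∀ {α β}, D.dot α α = 2 → D.dot β β = 2 → D.dot α β = -1 →
    X α * X β + X β * X α = (1 / 2 : ℝ) • X (α + β)
  comm : ∀ {α β}, D.dot α α = 2 → D.dot β β = 2 → D.dot α β = 0 → X α * X β - X β * X α = 0

/-- Products of tensors of the form `½ R - ¼`. -/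
theorem mul_quantised {s : ℕ} (M N : Matrix (Fin d) (Fin d) ℝ) :
    ((1 / 2 : ℝ) • tpow s M - (1 / 4 : ℝ) • tpow s 1)
      * ((1 / 2 : ℝ) • tpow s N - (1 / 4 : ℝ) • tpow s 1)
    = (1 / 4 : ℝ) • tpow s (M * N) - (1 / 8 : ℝ) • (tpow s M + tpow s N)
      + (1 / 16 : ℝ) • tpow s 1 := by
  simp only [sub_mul, mul_sub, smul_mul_smul_comm, tpow_mul, one_mul, mul_one]
  module

/-- After expansion the equation is the vanishing of the `S₃` alternating sum on `Sym^s`. For `s ≤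
2` there is no alternating vector, which appears here as a polynomial identity in the pairings of
`u` and `v` with `α` and `β`. -/
theorem polarises_of_eq {s : ℕ} {X : (Fin d → ℝ) → Tensor s d}
    (hX : ∀ α, X α = (1 / 2 : ℝ) • tpow s (D.reflection α) - (1 / 4 : ℝ) • tpow s 1)
    (hs : s = 1 ∨ s = 2) : Polarises D X where
  mem α := by
    rw [hX]
    exact Submodule.sub_mem _ (Submodule.smul_mem _ _ (tpow_mem _))
      (Submodule.smul_mem _ _ (tpow_mem _))
  neg α := by rw [hX, hX, D.reflection_neg]
  anticomm {α β} _ _ h := by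
    have key : tpow s (D.reflection α * D.reflection β) + tpow s (D.reflection β * D.reflection α)
        + tpow s 1
        = tpow s (D.reflection α) + tpow s (D.reflection β) + tpow s (D.reflection (α + β)) := by
      refine eq_of_pairing ?_ ?_ fun u v => ?_
      · exact Submodule.add_mem _ (Submodule.add_mem _ (tpow_mem _) (tpow_mem _)) (tpow_mem _)
      · exact Submodule.add_mem _ (Submodule.add_mem _ (tpow_mem _) (tpow_mem _)) (tpow_mem _)
      · simp only [add_mulVec, dotProduct_add, pairing_tpow, D.dot_reflection_mul,
          D.dot_reflection, D.raise_add, add_dotProduct, h, D.dot_comm β α, one_mulVec]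
        rcases hs with rfl | rfl <;> ring
    rw [hX, hX, hX, mul_quantised, mul_quantised]
    linear_combination (norm := module) (1 / 4 : ℝ) • key
  comm {α β} _ _ h := by
    rw [hX, hX, mul_quantised, mul_quantised, D.reflection_mul_comm h]
    module

theorem polarises_pol32 : Polarises D (pol32 D) := polarises_of_eq (pol32_eq D) (Or.inl rfl)

theorem polarises_pol52 : Polarises D (pol52 D) := polarises_of_eq (pol52_eq D) (Or.inr rfl)

/-- Reflections move the cubic tensors of the cross terms to reflected vectors, and a product of two
rank-one terms is again rank one with the scalar `C^α · C_β`. -/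
theorem mul_pol72 (hG : D.metric * D.lowMetric = 1) {α β : Fin d → ℝ} (hα : D.dot α α = 2)
    (hβ : D.dot β β = 2) {ε : ℝ} (hε : ε = 1 ∨ ε = -1) :
    pol72 D α ε * pol72 D β ε
      = (1 / 4 : ℝ) • tpow 3 (D.reflection α * D.reflection β)
        - (1 / 8 : ℝ) • (tpow 3 (D.reflection α) + tpow 3 (D.reflection β))
        + (1 / 16 : ℝ) • tpow 3 1
        + (1 / 12 : ℝ) •
          (vecMulVec (cubicLow D (cubicCoeff d ε) (D.reflection α *ᵥ β))
              (cubicUp D (cubicCoeff d ε) β)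
            + vecMulVec (cubicLow D (cubicCoeff d ε) α)
              (cubicUp D (cubicCoeff d ε) (D.reflection β *ᵥ α)))
        - (1 / 24 : ℝ) •
          (vecMulVec (cubicLow D (cubicCoeff d ε) α) (cubicUp D (cubicCoeff d ε) α)
            + vecMulVec (cubicLow D (cubicCoeff d ε) β) (cubicUp D (cubicCoeff d ε) β))
        + ((D.dot α β ^ 3 + 2 * D.dot α β) / 36) •
          vecMulVec (cubicLow D (cubicCoeff d ε) α) (cubicUp D (cubicCoeff d ε) β) := by
  rw [pol72_eq D α hε, pol72_eq D β hε, add_mul, mul_add, mul_add, mul_quantised,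
    ← cubicUp_dot_cubicLow hG (cubicCoeff_eq hε) hα hβ,
    ← tpow_reflection_mulVec_cubicLow hG _ hα, ← cubicUp_vecMul_tpow_reflection _ hβ]
  simp only [sub_mul, mul_sub, smul_mul_smul_comm, mul_vecMulVec, vecMulVec_mul,
    vecMulVec_mulVec, op_smul_eq_smul, tpow_one_mulVec (cubicLow_mem D _ _),
    vecMul_tpow_one (cubicUp_mem D _ _), smul_vecMulVec]
  module

theorem polarises_pol72 (hG : D.metric * D.lowMetric = 1) {ε : ℝ} (hε : ε = 1 ∨ ε = -1) :
    Polarises D fun α => pol72 D α ε where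
  mem α := symmetrise_mem _
  neg α := by
    simp only [pol72_eq D _ hε, D.reflection_neg, cubicLow_neg, cubicUp_neg, neg_vecMulVec,
      vecMulVec_neg, neg_neg]
  anticomm {α β} hα hβ h := by
    have hγ : D.reflection α *ᵥ β = α + β := by rw [reflection_mulVec_eq, h]; module
    have hγ' : D.reflection β *ᵥ α = α + β := by
      rw [reflection_mulVec_eq, D.dot_comm, h]; module
    -- The defect of the reflection part: the `k` terms cancel on the right by linearity, leaving
    -- three times the square of the cubic `α β (α+β)`.
    have key : tpow 3 (D.reflection α * D.reflection β) + tpow 3 (D.reflection β * D.reflection α)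
        + tpow 3 1 - tpow 3 (D.reflection α) - tpow 3 (D.reflection β)
        - tpow 3 (D.reflection (α + β))
        = (1 / 3 : ℝ) • vecMulVec
          (cubicLow D (cubicCoeff d ε) α + cubicLow D (cubicCoeff d ε) β
            - cubicLow D (cubicCoeff d ε) (α + β))
          (cubicUp D (cubicCoeff d ε) α + cubicUp D (cubicCoeff d ε) β
            - cubicUp D (cubicCoeff d ε) (α + β)) := by
      refine eq_of_pairing ?_ ?_ fun u v => ?_
      · exact Submodule.sub_mem _ (Submodule.sub_mem _ (Submodule.sub_mem _ (Submodule.add_mem _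
          (Submodule.add_mem _ (tpow_mem _) (tpow_mem _)) (tpow_mem _)) (tpow_mem _))
          (tpow_mem _)) (tpow_mem _)
      · exact Submodule.smul_mem _ _ (vecMulVec_mem
          (Submodule.sub_mem _ (Submodule.add_mem _ (cubicLow_mem D _ _) (cubicLow_mem D _ _))
            (cubicLow_mem D _ _))
          (Submodule.sub_mem _ (Submodule.add_mem _ (cubicUp_mem D _ _) (cubicUp_mem D _ _))
            (cubicUp_mem D _ _)))
      · simp only [add_mulVec, sub_mulVec, smul_mulVec, dotProduct_smul, dotProduct_sub,
          dotProduct_add, pairing_tpow, D.dot_reflection_mul, D.dot_reflection, D.raise_add,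
          add_dotProduct, h, D.dot_comm β α, one_mulVec, dot_vecMulVec_mulVec,
          dotProduct_comm _ (power 3 v), cubicLow, cubicUp, power_dot_cubic, smul_eq_mul,
          dotProduct_comm v (D.raise _)]
        ring
    rw [mul_pol72 hG hα hβ hε, mul_pol72 hG hβ hα hε, hγ, hγ', D.dot_comm β α, h,
      pol72_eq D _ hε]
    simp only [add_vecMulVec, sub_vecMulVec, vecMulVec_add, vecMulVec_sub] at key
    linear_combination (norm := module) (1 / 4 : ℝ) • key
  comm {α β} hα hβ h := by
    -- For orthogonal roots the cross terms are `C_α ⊗ C^α` and `C_β ⊗ C^β` in either order, and the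
    -- scalar `C^α · C_β` is zero.
    have hγ : D.reflection α *ᵥ β = β := by rw [reflection_mulVec_eq, h]; module
    have hγ' : D.reflection β *ᵥ α = α := by rw [reflection_mulVec_eq, D.dot_comm, h]; module
    rw [mul_pol72 hG hα hβ hε, mul_pol72 hG hβ hα hε, hγ, hγ', D.dot_comm β α, h,
      D.reflection_mul_comm h]
    module

end Polarisation

end Spin

end

noncomputable section

namespace Spin

open Matrix

/-! ### Operators on spinor tensors -/

theorem End_lie_eq {M : Type} [AddCommGroup M] [Module ℝ M] (a b : Module.End ℝ M) :
    ⁅a, b⁆ = a * b - b * a := rfl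

theorem toLin'_mul_eq {N : ℕ} (a b : Matrix (Fin N) (Fin N) ℝ) :
    toLin' (a * b) = toLin' a * toLin' b := toLin'_mul a b

section Operators

variable {s d N : ℕ}

theorem coe_act {X : Tensor s d} (hX : X ∈ symTensors s d) (φ : SymTensor s d) :
    (act X φ : (Fin s → Fin d) → ℝ) = X *ᵥ (φ : (Fin s → Fin d) → ℝ) := by
  change symmetrise X *ᵥ (φ : (Fin s → Fin d) → ℝ) = _
  rw [symmetrise_eq_self hX]

theorem act_anticomm {X Y Z : Tensor s d} (hX : X ∈ symTensors s d) (hY : Y ∈ symTensors s d)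
    (hZ : Z ∈ symTensors s d) (h : X * Y + Y * X = (1 / 2 : ℝ) • Z) :
    act X * act Y + act Y * act X = (1 / 2 : ℝ) • act Z := by
  refine LinearMap.ext fun φ => Subtype.ext ?_
  change ((act X (act Y φ) : (Fin s → Fin d) → ℝ)) + (act Y (act X φ) : (Fin s → Fin d) → ℝ)
    = (1 / 2 : ℝ) • (act Z φ : (Fin s → Fin d) → ℝ)
  rw [coe_act hX, coe_act hY, coe_act hY, coe_act hX, coe_act hZ, mulVec_mulVec, mulVec_mulVec,
    ← add_mulVec, h, smul_mulVec]

theorem act_comm {X Y : Tensor s d} (hX : X ∈ symTensors s d) (hY : Y ∈ symTensors s d)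
    (h : X * Y - Y * X = 0) : act X * act Y = act Y * act X := by
  refine LinearMap.ext fun φ => Subtype.ext ?_
  change (act X (act Y φ) : (Fin s → Fin d) → ℝ) = (act Y (act X φ) : (Fin s → Fin d) → ℝ)
  rw [coe_act hX, coe_act hY, coe_act hY, coe_act hX, mulVec_mulVec, mulVec_mulVec,
    sub_eq_zero.1 h]

end Operators

section TensorOperators

variable {V W : Type} [AddCommGroup V] [Module ℝ V] [AddCommGroup W] [Module ℝ W]

/-- The Berman relation for `-2 x ⊗ a` and `-2 y ⊗ b`. -/
theorem berman_tensor {x y z : Module.End ℝ V} {a b : Module.End ℝ W}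
    (hxy : x * y + y * x = (1 / 2 : ℝ) • z) (hxz : x * z + z * x = (1 / 2 : ℝ) • y)
    (haa : a * a = -1) (hab : a * b = -(b * a)) :
    ⁅(-2 : ℝ) • TensorProduct.map x a,
      ⁅(-2 : ℝ) • TensorProduct.map x a, (-2 : ℝ) • TensorProduct.map y b⁆⁆
      + (-2 : ℝ) • TensorProduct.map y b = 0 := by
  have h1 : ⁅(-2 : ℝ) • TensorProduct.map x a, (-2 : ℝ) • TensorProduct.map y b⁆
      = (2 : ℝ) • TensorProduct.map z (a * b) := by
    rw [End_lie_eq, smul_mul_smul_comm, smul_mul_smul_comm, ← TensorProduct.map_mul,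
      ← TensorProduct.map_mul, show b * a = -(a * b) by rw [hab, neg_neg],
      ← neg_one_smul ℝ (a * b), TensorProduct.map_smul_right]
    have h2 : TensorProduct.map z (a * b) = (2 : ℝ) •
        (TensorProduct.map (x * y) (a * b) + TensorProduct.map (y * x) (a * b)) := by
      rw [← TensorProduct.map_add_left, hxy, TensorProduct.map_smul_left, smul_smul]
      norm_num
    rw [h2]
    module
  have h3 : a * (a * b) = -b := by rw [← mul_assoc, haa, neg_one_mul]
  have h4 : a * b * a = b := by
    rw [hab, neg_mul, mul_assoc, haa, mul_neg, mul_one, neg_neg]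
  rw [h1, End_lie_eq, smul_mul_smul_comm, smul_mul_smul_comm, ← TensorProduct.map_mul,
    ← TensorProduct.map_mul, h3, h4, ← neg_one_smul ℝ b, TensorProduct.map_smul_right]
  have h5 : TensorProduct.map y b = (2 : ℝ) •
      (TensorProduct.map (x * z) b + TensorProduct.map (z * x) b) := by
    rw [← TensorProduct.map_add_left, hxz, TensorProduct.map_smul_left, smul_smul]
    norm_num
  rw [h5]
  module

theorem lie_tensor_eq_zero {x y : Module.End ℝ V} {a b : Module.End ℝ W}
    (hxy : x * y = y * x) (hab : a * b = b * a) :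
    ⁅(-2 : ℝ) • TensorProduct.map x a, (-2 : ℝ) • TensorProduct.map y b⁆ = 0 := by
  rw [End_lie_eq, smul_mul_smul_comm, smul_mul_smul_comm, ← TensorProduct.map_mul,
    ← TensorProduct.map_mul, hxy, hab, sub_self]

theorem berman_half {a b : Module.End ℝ W} (haa : a * a = -1) (hab : a * b = -(b * a)) :
    ⁅(1 / 2 : ℝ) • a, ⁅(1 / 2 : ℝ) • a, (1 / 2 : ℝ) • b⁆⁆ + (1 / 2 : ℝ) • b = 0 := by
  have h3 : a * (a * b) = -b := by rw [← mul_assoc, haa, neg_one_mul]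
  have h4 : a * b * a = b := by
    rw [hab, neg_mul, mul_assoc, haa, mul_neg, mul_one, neg_neg]
  have h5 : b * a = -(a * b) := by rw [hab, neg_neg]
  rw [End_lie_eq, End_lie_eq, smul_mul_smul_comm, smul_mul_smul_comm, h5]
  simp only [mul_sub, sub_mul, smul_mul_smul_comm, mul_neg, neg_mul, h3, h4, smul_neg]
  module

end TensorOperators

/-! ### Berman relations from the polarisation equations -/

section Berman

variable {s d N : ℕ} {D : WallData d}

/-- The properties of the matrices `Γ(α)` which make `½ Γ` a representation of `K(𝔤)`. -/
structure SpinHalf (D : WallData d) (Γ : (Fin d → ℤ) → Matrix (Fin N) (Fin N) ℝ) : Prop where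
  sq : ∀ m, KacMoody.IsRealRoot D.cartan m → Γ m * Γ m = -1
  anticomm : ∀ m m', KacMoody.IsRealRoot D.cartan m → KacMoody.IsRealRoot D.cartan m' →
    (D.dot (D.wall m) (D.wall m') = -1 ∨ D.dot (D.wall m) (D.wall m') = 1) →
    Γ m * Γ m' = -(Γ m' * Γ m)
  comm : ∀ m m', KacMoody.IsRealRoot D.cartan m → KacMoody.IsRealRoot D.cartan m' →
    D.dot (D.wall m) (D.wall m') = 0 → Γ m * Γ m' = Γ m' * Γ m

variable (D) in
/-- Realisation of the Cartan matrix by the simple roots. -/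
def RealisesCartan : Prop :=
  ∀ i j, D.dot (D.simpleRoot i) (D.simpleRoot j) = D.cartan i j

theorem wall_single (i : Fin d) : D.wall (Pi.single i 1) = D.simpleRoot i := by
  funext a
  simp [WallData.wall, Pi.single_apply]

theorem wall_eq (m : Fin d → ℤ) : D.wall m = ∑ i, (m i : ℝ) • D.simpleRoot i := by
  funext a
  simp [WallData.wall]

theorem dot_wall (hD : RealisesCartan D) (m m' : Fin d → ℤ) :
    D.dot (D.wall m) (D.wall m') = ((∑ i, ∑ j, m i * m' j * D.cartan i j : ℤ) : ℝ) := by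
  rw [wall_eq, wall_eq, D.dot_eq, mulVec_sum, sum_dotProduct, Int.cast_sum]
  refine Finset.sum_congr rfl fun i _ => ?_
  rw [dotProduct_sum, Int.cast_sum]
  refine Finset.sum_congr rfl fun j _ => ?_
  rw [mulVec_smul, dotProduct_smul, smul_dotProduct, ← D.dot_eq, hD]
  push_cast [smul_eq_mul]
  ring

/-- Simple roots have length two by the diagonal of the Cartan matrix, and in wall components each
Weyl reflection is an isometry. -/
theorem dot_wall_self (hD : RealisesCartan D) (hA : KacMoody.IsSimplyLaced D.cartan)
    {m : Fin d → ℤ} (hm : KacMoody.IsRealRoot D.cartan m) :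
    D.dot (D.wall m) (D.wall m) = 2 := by
  induction hm with
  | simple i => rw [wall_single, hD, hA.diag]; norm_num
  | reflect i m _ ih =>
    have h1 : D.dot (D.simpleRoot i) (D.wall m) = ((∑ j, D.cartan i j * m j : ℤ) : ℝ) := by
      rw [← wall_single, dot_wall hD]
      congr 1
      simp [Pi.single_apply, mul_comm]
    have h2 : D.wall (m - (∑ j, D.cartan i j * m j) • Pi.single i 1)
        = D.reflection (D.simpleRoot i) *ᵥ D.wall m := by
      rw [reflection_mulVec_eq, h1, ← wall_single, wall_eq, wall_eq, wall_eq, Finset.smul_sum,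
        ← Finset.sum_sub_distrib]
      refine Finset.sum_congr rfl fun j _ => ?_
      rw [smul_smul, ← sub_smul]
      congr 1
      push_cast [Pi.sub_apply, Pi.smul_apply, smul_eq_mul]
      rfl
    rw [h2, dot_reflection_reflection (by rw [hD, hA.diag]; norm_num), ih]

namespace Polarises

variable {X : (Fin d → ℝ) → Tensor s d}

theorem anticomm_sub (hX : Polarises D X) {α β : Fin d → ℝ} (hα : D.dot α α = 2)
    (hβ : D.dot β β = 2) (h : D.dot α β = 1) :
    X α * X β + X β * X α = (1 / 2 : ℝ) • X (α - β) := by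
  have hβ' : D.dot (-β) (-β) = 2 := by
    rw [D.dot_neg_right, D.dot_comm, D.dot_neg_right, neg_neg, hβ]
  have := hX.anticomm hα hβ' (by rw [D.dot_neg_right, h])
  rwa [hX.neg, ← sub_eq_add_neg] at this

theorem solves (hX : Polarises D X) (hD : RealisesCartan D)
    (hA : KacMoody.IsSimplyLaced D.cartan) : SolvesPolarisationEquations D X :=
  fun _ _ hm hm' => ⟨hX.anticomm (dot_wall_self hD hA hm) (dot_wall_self hD hA hm'),
    hX.anticomm_sub (dot_wall_self hD hA hm) (dot_wall_self hD hA hm'),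
    hX.comm (dot_wall_self hD hA hm) (dot_wall_self hD hA hm')⟩

theorem satisfiesBerman (hX : Polarises D X) (hD : RealisesCartan D)
    (hA : KacMoody.IsSimplyLaced D.cartan) {Γ : (Fin d → ℤ) → Matrix (Fin N) (Fin N) ℝ}
    (hΓ : SpinHalf D Γ) :
    SatisfiesBerman D (SpinorTensor s d N) (spinFamily D X Γ) := by
  intro m m' hm hm'
  have hα := dot_wall_self hD hA hm
  have hβ := dot_wall_self hD hA hm'
  constructor
  · intro h
    have haa : toLin' (Γ m) * toLin' (Γ m) = -1 := by
      rw [← toLin'_mul_eq, hΓ.sq m hm, map_neg, toLin'_one]; rfl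
    have hab : toLin' (Γ m) * toLin' (Γ m') = -(toLin' (Γ m') * toLin' (Γ m)) := by
      rw [← toLin'_mul_eq, hΓ.anticomm m m' hm hm' h, map_neg, toLin'_mul_eq]
    rcases h with h | h
    · have hγ : D.dot (D.wall m + D.wall m') (D.wall m + D.wall m') = 2 := by
        rw [D.dot_add_left, D.dot_add_right, D.dot_add_right, D.dot_comm (D.wall m'), hα, hβ, h]
        norm_num
      have hαγ : D.dot (D.wall m) (D.wall m + D.wall m') = 1 := by
        rw [D.dot_add_right, hα, h]; norm_num
      -- With `γ = α + β` one has `α · γ = 1` and `α - γ = -β`; evenness of `X` turns the second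
      -- anticommutator back into `½ X(β)`.
      have h2 := hX.anticomm_sub hα hγ hαγ
      rw [sub_add_cancel_left, hX.neg] at h2
      exact berman_tensor (act_anticomm (hX.mem _) (hX.mem _) (hX.mem _) (hX.anticomm hα hβ h))
        (act_anticomm (hX.mem _) (hX.mem _) (hX.mem _) h2) haa hab
    · have hγ : D.dot (D.wall m - D.wall m') (D.wall m - D.wall m') = 2 := by
        rw [sub_eq_add_neg, D.dot_add_left, D.dot_add_right, D.dot_add_right, D.dot_neg_right,
          D.dot_neg_right, D.dot_comm (-D.wall m'), D.dot_comm (-D.wall m'), D.dot_neg_right,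
          D.dot_neg_right, D.dot_comm (D.wall m'), hα, hβ, h]
        norm_num
      have hαγ : D.dot (D.wall m) (D.wall m - D.wall m') = 1 := by
        rw [sub_eq_add_neg, D.dot_add_right, D.dot_neg_right, hα, h]; norm_num
      have h2 := hX.anticomm_sub hα hγ hαγ
      rw [sub_sub_cancel] at h2
      exact berman_tensor
        (act_anticomm (hX.mem _) (hX.mem _) (hX.mem _) (hX.anticomm_sub hα hβ h))
        (act_anticomm (hX.mem _) (hX.mem _) (hX.mem _) h2) haa hab
  · intro h
    refine lie_tensor_eq_zero (act_comm (hX.mem _) (hX.mem _) (hX.comm hα hβ h)) ?_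
    rw [← toLin'_mul_eq, hΓ.comm m m' hm hm' h, toLin'_mul_eq]

end Polarises

theorem SpinHalf.satisfiesBerman {Γ : (Fin d → ℤ) → Matrix (Fin N) (Fin N) ℝ}
    (hΓ : SpinHalf D Γ) : SatisfiesBerman D (Fin N → ℝ) (spinHalfFamily Γ) := by
  intro m m' hm hm'
  constructor
  · intro h
    refine berman_half ?_ ?_
    · rw [← toLin'_mul_eq, hΓ.sq m hm, map_neg, toLin'_one]; rfl
    · rw [← toLin'_mul_eq, hΓ.anticomm m m' hm hm' h, map_neg, toLin'_mul_eq]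
  · intro h
    rw [End_lie_eq, spinHalfFamily, spinHalfFamily, smul_mul_smul_comm, smul_mul_smul_comm,
      ← toLin'_mul_eq, hΓ.comm m m' hm hm' h, toLin'_mul_eq, sub_self]

theorem SatisfiesBerman.exists_representation {M : Type} [AddCommGroup M] [Module ℝ M]
    {J : (Fin d → ℤ) → Module.End ℝ M} (hJ : SatisfiesBerman D M J) (hD : RealisesCartan D)
    (hA : KacMoody.IsSimplyLaced D.cartan) : ∃ ρ, IsRepresentationBy D M J ρ := by
  refine hA.exists_representation (fun i => J (Pi.single i 1)) (fun i j hij => ?_)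
    fun i j hij => ?_
  · refine (hJ _ _ (.simple i) (.simple j)).1 (Or.inl ?_)
    rw [wall_single, wall_single, hD, hij]; norm_num
  · refine (hJ _ _ (.simple i) (.simple j)).2 ?_
    rw [wall_single, wall_single, hD, hij]; norm_num

end Berman

/-! ### The trace of the spin-5/2 representation -/

section Trace

variable {d N : ℕ} {D : WallData d}

theorem invariant_of_generators (hA : KacMoody.IsSimplyLaced D.cartan) {M : Type}
    [AddCommGroup M] [Module ℝ M] {J : (Fin d → ℤ) → Module.End ℝ M}
    {ρ : KacMoody.maximalCompact D.cartan →ₗ⁅ℝ⁆ Module.End ℝ M}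
    (hρ : IsRepresentationBy D M J ρ) (S : Submodule ℝ M)
    (hS : ∀ i, ∀ φ ∈ S, J (Pi.single i 1) φ ∈ S) : ∀ x, ∀ φ ∈ S, ρ x φ ∈ S := by
  intro x
  induction x using KacMoody.maximalCompact_induction hA.diag with
  | mem i => rw [hρ i]; exact hS i
  | zero => intro φ _; rw [map_zero]; exact S.zero_mem
  | add x y hx hy => intro φ hφ; rw [map_add]; exact S.add_mem (hx φ hφ) (hy φ hφ)
  | smul c x hx => intro φ hφ; rw [map_smul]; exact S.smul_mem c (hx φ hφ)
  | lie x y hx hy =>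
    intro φ hφ
    rw [LieHom.map_lie]
    exact S.sub_mem (hx _ (hy φ hφ)) (hy _ (hx φ hφ))

theorem intertwines_of_generators (hA : KacMoody.IsSimplyLaced D.cartan) {M M' : Type}
    [AddCommGroup M] [Module ℝ M] [AddCommGroup M'] [Module ℝ M']
    {J : (Fin d → ℤ) → Module.End ℝ M} {J' : (Fin d → ℤ) → Module.End ℝ M'}
    {ρ : KacMoody.maximalCompact D.cartan →ₗ⁅ℝ⁆ Module.End ℝ M}
    {ρ' : KacMoody.maximalCompact D.cartan →ₗ⁅ℝ⁆ Module.End ℝ M'}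
    (hρ : IsRepresentationBy D M J ρ) (hρ' : IsRepresentationBy D M' J' ρ') (e : M' →ₗ[ℝ] M)
    (he : ∀ i w, e (J' (Pi.single i 1) w) = J (Pi.single i 1) (e w)) :
    ∀ x w, e (ρ' x w) = ρ x (e w) := by
  intro x
  induction x using KacMoody.maximalCompact_induction hA.diag with
  | mem i => rw [hρ i, hρ' i]; exact he i
  | zero => intro w; rw [map_zero, map_zero]; exact map_zero e
  | add x y hx hy =>
    intro w
    rw [map_add, map_add, LinearMap.add_apply, LinearMap.add_apply, map_add, hx, hy]
  | smul c x hx =>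
    intro w
    rw [map_smul, map_smul, LinearMap.smul_apply, LinearMap.smul_apply, map_smul, hx]
  | lie x y hx hy =>
    intro w
    rw [LieHom.map_lie, LieHom.map_lie]
    change e (ρ' x (ρ' y w) - ρ' y (ρ' x w)) = ρ x (ρ y (e w)) - ρ y (ρ x (e w))
    rw [map_sub, hx, hy, hy, hx]

theorem contract_eq (φ : SymTensor 2 d) :
    contract D φ
      = (fun A : Fin 2 → Fin d => D.metric (A 0) (A 1)) ⬝ᵥ (φ : (Fin 2 → Fin d) → ℝ) := by
  have h := sum_fin_two fun a b => D.metric a b * (φ : (Fin 2 → Fin d) → ℝ) ![a, b]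
  have e : ∀ A : Fin 2 → Fin d, ![A 0, A 1] = A := fun A => by
    ext k; fin_cases k <;> rfl
  simp only [e] at h
  rw [dotProduct, h]
  simp [contract]

theorem matrix_dot_power (G : Matrix (Fin d) (Fin d) ℝ) (u : Fin d → ℝ) :
    (fun A : Fin 2 → Fin d => G (A 0) (A 1)) ⬝ᵥ power 2 u = u ⬝ᵥ (G *ᵥ u) := by
  have h := sum_fin_two fun a b => G a b * (u a * u b)
  simp only [dotProduct, power, Fin.prod_univ_two, mulVec] at h ⊢
  rw [h]
  refine Finset.sum_congr rfl fun a _ => ?_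
  rw [Finset.mul_sum]
  exact Finset.sum_congr rfl fun b _ => by ring

theorem matrix_mem {G : Matrix (Fin d) (Fin d) ℝ} (hG : G.IsSymm) :
    (fun A : Fin 2 → Fin d => G (A 0) (A 1)) ∈ SymTensor 2 d := by
  intro σ A
  have key : ∀ i j : Fin 2, i ≠ j → G (A i) (A j) = G (A 0) (A 1) := by
    intro i j hij
    fin_cases i <;> fin_cases j
    · exact absurd rfl hij
    · rfl
    · exact hG.apply (A 0) (A 1)
    · exact absurd rfl hij
  exact key (σ 0) (σ 1) fun h => absurd (σ.injective h) (by decide)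

/-- The reflection fixes the metric, so `½ R - ¼` takes the value `½ - ¼` on it. With the factor
`-2` this produces `-½ Γ` on pure traces. -/
theorem act_pol52_metricTensor (hG : D.metric * D.lowMetric = 1) {α : Fin d → ℝ}
    (hα : D.dot α α = 2) :
    act (pol52 D α) (metricTensor D) = (1 / 4 : ℝ) • metricTensor D := by
  refine Subtype.ext ?_
  have h : tpow 2 (D.reflection α) *ᵥ (metricTensor D : (Fin 2 → Fin d) → ℝ)
      = (metricTensor D : (Fin 2 → Fin d) → ℝ) := by
    refine eq_of_power_dot (mulVec_mem (tpow_mem _) _) (metricTensor D).2 fun u => ?_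
    rw [power_dot_tpow_mulVec, dotProduct_comm, dotProduct_comm (power 2 u)]
    change (fun A : Fin 2 → Fin d => D.lowMetric (A 0) (A 1)) ⬝ᵥ _
      = (fun A : Fin 2 → Fin d => D.lowMetric (A 0) (A 1)) ⬝ᵥ _
    rw [matrix_dot_power, matrix_dot_power, lowMetric_vecMul_reflection hG hα]
  rw [coe_act (polarises_pol52.mem α), pol52_eq, sub_mulVec, smul_mulVec, smul_mulVec, h,
    tpow_one_mulVec (metricTensor D).2, Submodule.coe_smul]
  module

theorem contract_act_pol52 {α : Fin d → ℝ} (hα : D.dot α α = 2) (φ : SymTensor 2 d) :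
    contract D (act (pol52 D α) φ) = (1 / 4 : ℝ) * contract D φ := by
  have h : (fun A : Fin 2 → Fin d => D.metric (A 0) (A 1)) ᵥ* tpow 2 (D.reflection α)
      = fun A : Fin 2 → Fin d => D.metric (A 0) (A 1) := by
    refine eq_of_power_dot (vecMul_mem (tpow_mem _) _) (matrix_mem D.metric_symm) fun v => ?_
    rw [vecMul_tpow_dot_power, dotProduct_comm, dotProduct_comm (power 2 v), matrix_dot_power,
      matrix_dot_power, ← D.dot_eq, ← D.dot_eq, dot_reflection_reflection hα]
  rw [contract_eq, contract_eq, coe_act (polarises_pol52.mem α), dotProduct_mulVec, pol52_eq,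
    vecMul_sub, vecMul_smul, vecMul_smul, h, vecMul_tpow_one (matrix_mem D.metric_symm),
    sub_dotProduct, smul_dotProduct, smul_dotProduct, smul_eq_mul, smul_eq_mul]
  ring

theorem contract_metricTensor (hG : D.metric * D.lowMetric = 1) :
    contract D (metricTensor D) = d := by
  rw [contract_eq]
  have h := sum_fin_two fun a b => D.metric a b * D.lowMetric a b
  refine h.trans ?_
  have : ∀ a, ∑ b, D.metric a b * D.lowMetric a b = 1 := fun a => by
    rw [← one_apply_eq a, ← hG, mul_apply]
    exact Finset.sum_congr rfl fun b _ => by rw [D.lowMetric_symm.apply]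
  simp [this]

theorem gTrace_tmul (φ : SymTensor 2 d) (ψ : Fin N → ℝ) :
    gTrace D N (φ ⊗ₜ ψ) = contract D φ • ψ := by
  simp [gTrace]

theorem isCompl_pureTrace (hG : D.metric * D.lowMetric = 1) (hd : d ≠ 0) :
    IsCompl (pureTrace D N) (LinearMap.ker (gTrace D N)) := by
  have hd' : (d : ℝ) ≠ 0 := Nat.cast_ne_zero.2 hd
  constructor
  · rw [Submodule.disjoint_def]
    rintro _ ⟨ψ, rfl⟩ h
    rw [LinearMap.mem_ker, TensorProduct.mk_apply, gTrace_tmul, contract_metricTensor hG] at h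
    rw [(smul_eq_zero.1 h).resolve_left hd', map_zero]
  · rw [codisjoint_iff, eq_top_iff]
    intro φ _
    -- The projection to pure traces is `φ ↦ G ⊗ tr φ / d`, normalised by `G^{ab} G_{ab} = d`.
    refine Submodule.mem_sup.2 ⟨metricTensor D ⊗ₜ ((d : ℝ)⁻¹ • gTrace D N φ), ⟨_, rfl⟩,
      φ - metricTensor D ⊗ₜ ((d : ℝ)⁻¹ • gTrace D N φ), ?_, add_sub_cancel _ _⟩
    rw [LinearMap.mem_ker, map_sub, gTrace_tmul, contract_metricTensor hG, smul_smul,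
      mul_inv_cancel₀ hd', one_smul, sub_self]

theorem spinFamily_pol52_metricTensor (hG : D.metric * D.lowMetric = 1)
    (Γ : (Fin d → ℤ) → Matrix (Fin N) (Fin N) ℝ) {m : Fin d → ℤ}
    (hm : D.dot (D.wall m) (D.wall m) = 2) (ψ : Fin N → ℝ) :
    spinFamily D (pol52 D) Γ m (metricTensor D ⊗ₜ ψ)
      = metricTensor D ⊗ₜ (-(1 / 2 : ℝ) • (Γ m *ᵥ ψ)) := by
  rw [spinFamily, spinOperator, LinearMap.smul_apply, TensorProduct.map_tmul,
    act_pol52_metricTensor hG hm, TensorProduct.smul_tmul, toLin'_apply, ← TensorProduct.tmul_smul,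
    smul_smul]
  norm_num

theorem gTrace_spinFamily (Γ : (Fin d → ℤ) → Matrix (Fin N) (Fin N) ℝ) {m : Fin d → ℤ}
    (hm : D.dot (D.wall m) (D.wall m) = 2) (φ : SpinorTensor 2 d N) :
    gTrace D N (spinFamily D (pol52 D) Γ m φ) = -(1 / 2 : ℝ) • (Γ m *ᵥ gTrace D N φ) := by
  induction φ using TensorProduct.induction_on with
  | zero => simp
  | tmul φ ψ =>
    rw [spinFamily, spinOperator, LinearMap.smul_apply, TensorProduct.map_tmul, map_smul,
      gTrace_tmul, gTrace_tmul, contract_act_pol52 hm, toLin'_apply, mulVec_smul, smul_smul,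
      smul_smul]
    congr 1
    ring
  | add x y hx hy => rw [map_add, map_add, hx, hy, map_add, mulVec_add, smul_add]

/-- The decomposition of the spin-5/2 representation. -/
theorem spin52_decomposition (hD : RealisesCartan D) (hA : KacMoody.IsSimplyLaced D.cartan)
    (hG : D.metric * D.lowMetric = 1) (hd : d ≠ 0)
    {Γ : (Fin d → ℤ) → Matrix (Fin N) (Fin N) ℝ} (hΓ : SpinHalf D Γ)
    {T T' : Matrix (Fin N) (Fin N) ℝ} (hT : T' * T = 1)
    (hTΓ : ∀ i, T * Γ (Pi.single i 1) = -(Γ (Pi.single i 1) * T))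
    {ρ : _} (hρ : IsRepresentationBy D (SpinorTensor 2 d N) (spinFamily D (pol52 D) Γ) ρ) :
    ∃ ρ₁, IsRepresentationBy D (Fin N → ℝ) (spinHalfFamily Γ) ρ₁ ∧
      IsCompl (pureTrace D N) (LinearMap.ker (gTrace D N)) ∧
      (∀ x, ∀ φ ∈ pureTrace D N, ρ x φ ∈ pureTrace D N) ∧
      (∀ x, ∀ φ ∈ LinearMap.ker (gTrace D N), ρ x φ ∈ LinearMap.ker (gTrace D N)) ∧
      ∃ e : (Fin N → ℝ) ≃ₗ[ℝ] pureTrace D N,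
        ∀ x w, (e (ρ₁ x w) : SpinorTensor 2 d N) = ρ x (e w) := by
  obtain ⟨ρ₁, hρ₁⟩ := hΓ.satisfiesBerman.exists_representation hD hA
  have hdot : ∀ i, D.dot (D.wall (Pi.single i 1)) (D.wall (Pi.single i 1)) = 2 := fun i =>
    dot_wall_self hD hA (.simple i)
  have hd' : (d : ℝ) ≠ 0 := Nat.cast_ne_zero.2 hd
  have hTT : T * T' = 1 := mul_eq_one_comm.1 hT
  -- The twist `w ↦ G ⊗ T w` is needed because pure traces carry `-½ Γ`; anticommuting `T` past
  -- `Γ(α_i)` restores `½ Γ`.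
  let e₀ : (Fin N → ℝ) →ₗ[ℝ] pureTrace D N :=
    (TensorProduct.mk ℝ (SymTensor 2 d) (Fin N → ℝ) (metricTensor D)).rangeRestrict ∘ₗ toLin' T
  have he₀ : ∀ w, (e₀ w : SpinorTensor 2 d N) = metricTensor D ⊗ₜ (T *ᵥ w) := fun w => rfl
  have he : ∀ i w, (e₀ (spinHalfFamily Γ (Pi.single i 1) w) : SpinorTensor 2 d N)
      = spinFamily D (pol52 D) Γ (Pi.single i 1) (e₀ w : SpinorTensor 2 d N) := by
    intro i w
    rw [he₀, he₀, spinFamily_pol52_metricTensor hG Γ (hdot i), spinHalfFamily,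
      LinearMap.smul_apply, toLin'_apply, mulVec_smul, mulVec_mulVec, mulVec_mulVec, hTΓ,
      neg_mulVec, smul_neg, neg_smul]
  have hbij : Function.Bijective e₀ := by
    constructor
    · intro w w' hw
      have h1 : gTrace D N (metricTensor D ⊗ₜ (T *ᵥ w))
          = gTrace D N (metricTensor D ⊗ₜ (T *ᵥ w')) := by
        rw [← he₀, ← he₀, hw]
      rw [gTrace_tmul, gTrace_tmul, contract_metricTensor hG] at h1
      have h2 := smul_right_injective _ hd' h1
      rw [← one_mulVec w, ← one_mulVec w', ← hT, ← mulVec_mulVec, ← mulVec_mulVec, h2]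
    · rintro ⟨_, ψ, rfl⟩
      refine ⟨T' *ᵥ ψ, Subtype.ext ?_⟩
      rw [he₀, mulVec_mulVec, hTT, one_mulVec]
      rfl
  refine ⟨ρ₁, hρ₁, isCompl_pureTrace hG hd, invariant_of_generators hA hρ _ ?_,
    invariant_of_generators hA hρ _ ?_, LinearEquiv.ofBijective e₀ hbij,
    intertwines_of_generators hA hρ hρ₁ ((pureTrace D N).subtype ∘ₗ e₀) he⟩
  · rintro i _ ⟨ψ, rfl⟩
    rw [TensorProduct.mk_apply, spinFamily_pol52_metricTensor hG Γ (hdot i)]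
    exact ⟨_, rfl⟩
  · intro i φ hφ
    rw [LinearMap.mem_ker] at hφ ⊢
    rw [gTrace_spinFamily Γ (hdot i), hφ, mulVec_zero, smul_zero]

end Trace

end Spin

end

noncomputable section

namespace Spin

open Matrix

/-! ### Products of gamma matrices up to sign -/

section Signs

variable {N : ℕ}

/-- `A` and `B` commute up to the sign `(-1)^e`. -/
def SignComm (e : ℤ) (A B : Matrix (Fin N) (Fin N) ℝ) : Prop :=
  A * B = (-1 : ℝ) ^ e • (B * A)

theorem neg_one_zpow_add (e f : ℤ) : (-1 : ℝ) ^ (e + f) = (-1) ^ e * (-1) ^ f :=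
  zpow_add₀ (by norm_num) e f

theorem neg_one_zpow_mul_self (e : ℤ) : (-1 : ℝ) ^ e * (-1) ^ e = 1 := by
  rw [← neg_one_zpow_add, Even.neg_one_zpow ⟨e, rfl⟩]

theorem neg_one_zpow_congr {e f : ℤ} (h : Even (e - f)) : (-1 : ℝ) ^ e = (-1) ^ f := by
  rw [show e = (e - f) + f by ring, neg_one_zpow_add, h.neg_one_zpow, one_mul]

namespace SignComm

variable {A B C : Matrix (Fin N) (Fin N) ℝ} {e f : ℤ}

theorem congr (h : SignComm e A B) (hef : Even (e - f)) : SignComm f A B := by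
  rw [SignComm, ← neg_one_zpow_congr hef]; exact h

theorem symm (h : SignComm e A B) : SignComm e B A := by
  have h1 : A * B = (-1 : ℝ) ^ e • (B * A) := h
  rw [SignComm, h1, smul_smul, neg_one_zpow_mul_self, one_smul]

theorem one_right : SignComm 0 A 1 := by simp [SignComm]

theorem mul_right (h : SignComm e A B) (h' : SignComm f A C) : SignComm (e + f) A (B * C) := by
  have h1 : A * B = (-1 : ℝ) ^ e • (B * A) := h
  have h2 : A * C = (-1 : ℝ) ^ f • (C * A) := h'
  rw [SignComm, ← mul_assoc, h1, smul_mul_assoc, mul_assoc, h2, mul_smul_comm, smul_smul,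
    ← neg_one_zpow_add, mul_assoc]

theorem mul_left (h : SignComm e A C) (h' : SignComm f B C) : SignComm (e + f) (A * B) C :=
  (h.symm.mul_right h'.symm).symm

theorem pow_right (h : SignComm e A B) (n : ℕ) : SignComm (n * e) A (B ^ n) := by
  induction n with
  | zero => simpa using one_right
  | succ n ih =>
    rw [pow_succ]
    convert ih.mul_right h using 1
    push_cast
    ring

theorem inv_right (h : SignComm e A B) (hB : IsUnit B.det) : SignComm e A B⁻¹ := by
  have h1 : B * A = (-1 : ℝ) ^ e • (A * B) := h.symm
  rw [SignComm]
  calc A * B⁻¹ = B⁻¹ * (B * A) * B⁻¹ := by rw [nonsing_inv_mul_cancel_left _ _ hB]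
    _ = (-1 : ℝ) ^ e • (B⁻¹ * A) := by
      rw [h1, mul_smul_comm, smul_mul_assoc, ← mul_assoc, mul_nonsing_inv_cancel_right _ _ hB]

theorem zpow_right (h : SignComm e A B) (hB : IsUnit B.det) (n : ℤ) :
    SignComm (n * e) A (B ^ n) := by
  obtain ⟨k, rfl | rfl⟩ := n.eq_nat_or_neg
  · rw [zpow_natCast]; exact h.pow_right k
  · rw [zpow_neg_natCast]
    refine ((h.pow_right k).inv_right ?_).congr ⟨k * e, by ring⟩
    rw [det_pow]; exact hB.pow k

theorem prod_right {n : ℕ} {g : Fin n → Matrix (Fin N) (Fin N) ℝ} {E : Fin n → ℤ}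
    (h : ∀ b, SignComm (E b) A (g b)) : SignComm (∑ b, E b) A (List.ofFn g).prod := by
  induction n with
  | zero => simpa using one_right
  | succ n ih =>
    rw [List.ofFn_succ, List.prod_cons, Fin.sum_univ_succ]
    exact (h 0).mul_right (ih fun b => h b.succ)

theorem prod_prod {k n : ℕ} {f : Fin k → Matrix (Fin N) (Fin N) ℝ}
    {g : Fin n → Matrix (Fin N) (Fin N) ℝ} {E : Fin k → Fin n → ℤ}
    (h : ∀ a b, SignComm (E a b) (f a) (g b)) :
    SignComm (∑ a, ∑ b, E a b) (List.ofFn f).prod (List.ofFn g).prod :=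
  (prod_right fun a => (prod_right fun b => h a b).symm).symm

end SignComm

/-- The square of a product of matrices of square one which commute up to the signs
`(-1)^{p_a p_b}`. -/
theorem prod_mul_self {n : ℕ} (f : Fin n → Matrix (Fin N) (Fin N) ℝ) (p : Fin n → ℤ)
    (hsq : ∀ a, f a * f a = 1) (h : ∀ a b, a ≠ b → SignComm (p a * p b) (f a) (f b)) :
    ∃ e : ℤ, 2 * e = (∑ a, p a) ^ 2 - ∑ a, p a ^ 2 ∧
      (List.ofFn f).prod * (List.ofFn f).prod = (-1 : ℝ) ^ e • 1 := by
  induction n with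
  | zero => exact ⟨0, by simp, by simp⟩
  | succ n ih =>
    obtain ⟨e, he, h2⟩ := ih (fun a => f a.succ) (fun a => p a.succ) (fun a => hsq _)
      fun a b hab => h _ _ fun hh => hab (Fin.succ_injective _ hh)
    -- The exponent is the sum of `p_a p_b` over `a < b`; moving the new first factor through the
    -- others contributes its products with them.
    refine ⟨e + ∑ b : Fin n, p 0 * p b.succ, ?_, ?_⟩
    · rw [Fin.sum_univ_succ, Fin.sum_univ_succ, ← Finset.mul_sum, mul_add, he]
      ring
    · have h3 : SignComm (∑ b : Fin n, p 0 * p b.succ) (f 0) (List.ofFn fun a => f a.succ).prod :=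
        SignComm.prod_right fun b => h 0 b.succ (Fin.succ_ne_zero b).symm
      have h4 := h3.symm
      rw [SignComm] at h4
      rw [List.ofFn_succ, List.prod_cons]
      set M := (List.ofFn fun a => f a.succ).prod
      calc f 0 * M * (f 0 * M) = f 0 * (M * f 0) * M := by simp only [mul_assoc]
        _ = (-1 : ℝ) ^ (∑ b : Fin n, p 0 * p b.succ) • ((f 0 * f 0) * (M * M)) := by
          rw [h4, mul_smul_comm, smul_mul_assoc]; simp only [mul_assoc]
        _ = _ := by rw [hsq, one_mul, h2, smul_smul, add_comm e, neg_one_zpow_add]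

end Signs

/-! ### Sign rules for Clifford generators and their monomials -/

namespace IsClifford

variable {n N : ℕ} {η : Fin n → ℝ} {γ : Fin n → Matrix (Fin N) (Fin N) ℝ}

theorem sq (hγ : IsClifford η γ) (a : Fin n) : γ a * γ a = η a • 1 := by
  have h := hγ a a
  rw [if_pos rfl, ← two_smul ℝ, mul_smul] at h
  exact smul_right_injective _ (two_ne_zero' ℝ) h

theorem signComm (hγ : IsClifford η γ) (a b : Fin n) :
    SignComm (if a = b then 0 else 1) (γ a) (γ b) := by
  split_ifs with hab
  · subst hab; simp [SignComm]
  · have h := hγ a b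
    rw [if_neg hab] at h
    rw [SignComm, eq_neg_of_add_eq_zero_left h]
    simp

theorem isUnit_det (hγ : IsClifford η γ) {a : Fin n} (ha : η a ≠ 0) : IsUnit (γ a).det :=
  isUnit_det_of_right_inverse (B := (η a)⁻¹ • γ a) (by
    rw [mul_smul_comm, hγ.sq, smul_smul, inv_mul_cancel₀ ha, one_smul])

end IsClifford

section Euclidean

variable {n N : ℕ} {γ : Fin n → Matrix (Fin N) (Fin N) ℝ}

/-- Only pairs of distinct generators anticommute, so this counts the signs met in exchanging two
monomials. -/
theorem sum_offDiag (p q : Fin n → ℤ) :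
    ∑ a, ∑ b, p a * (q b * if a = b then 0 else 1) = (∑ a, p a) * ∑ a, q a - ∑ a, p a * q a := by
  have : ∀ a b : Fin n, p a * (q b * if a = b then 0 else 1)
      = p a * q b - if a = b then p a * q b else 0 := by
    intro a b; split_ifs <;> ring
  simp only [this, Finset.sum_sub_distrib, Finset.sum_ite_eq, Finset.mem_univ, if_true,
    Finset.sum_mul_sum]

theorem SignComm.gammaMonomial_right {A : Matrix (Fin N) (Fin N) ℝ} {E : Fin n → ℤ}
    (h : ∀ a, SignComm (E a) A (γ a)) (hu : ∀ a, IsUnit (γ a).det) (p : Fin n → ℤ) :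
    SignComm (∑ a, p a * E a) A (gammaMonomial γ p) :=
  SignComm.prod_right fun a => (h a).zpow_right (hu a) (p a)

/-- Gamma monomials commute up to sign. -/
theorem IsClifford.signComm_gammaMonomial (hγ : IsClifford (fun _ => 1) γ) (p q : Fin n → ℤ) :
    SignComm ((∑ a, p a) * ∑ a, q a - ∑ a, p a * q a) (gammaMonomial γ p) (gammaMonomial γ q) := by
  have hu : ∀ a, IsUnit (γ a).det := fun a => hγ.isUnit_det one_ne_zero
  rw [← sum_offDiag]
  exact SignComm.prod_prod fun a b =>
    (((hγ.signComm a b).zpow_right (hu b) (q b)).symm.zpow_right (hu a) (p a)).symm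

theorem IsClifford.gammaMonomial_mul_self (hγ : IsClifford (fun _ => 1) γ) (p : Fin n → ℤ) :
    ∃ e : ℤ, 2 * e = (∑ a, p a) ^ 2 - ∑ a, p a ^ 2 ∧
      gammaMonomial γ p * gammaMonomial γ p = (-1 : ℝ) ^ e • 1 := by
  have hu : ∀ a, IsUnit (γ a).det := fun a => hγ.isUnit_det one_ne_zero
  refine prod_mul_self _ p (fun a => ?_) fun a b hab => ?_
  · rw [← Matrix.Commute.mul_zpow (Commute.refl _), hγ.sq, one_smul, Matrix.one_zpow]
  · have := ((hγ.signComm a b).zpow_right (hu b) (p b)).symm.zpow_right (hu a) (p a)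
    rw [if_neg hab, mul_one] at this
    exact this.symm

theorem IsClifford.exists_left_inverse (hγ : IsClifford (fun _ => 1) γ) (p : Fin n → ℤ) :
    ∃ T' : Matrix (Fin N) (Fin N) ℝ, T' * gammaMonomial γ p = 1 := by
  obtain ⟨e, -, he⟩ := hγ.gammaMonomial_mul_self p
  exact ⟨(-1 : ℝ) ^ e • gammaMonomial γ p, by
    rw [smul_mul_assoc, he, smul_smul, neg_one_zpow_mul_self, one_smul]⟩

end Euclidean

theorem SignComm.eq_neg {N : ℕ} {A B : Matrix (Fin N) (Fin N) ℝ} {e : ℤ} (h : SignComm e A B)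
    (he : Odd e) : A * B = -(B * A) := by
  rw [h, he.neg_one_zpow, neg_one_smul]

/-- Matrices whose commutation signs are governed by the parity of `α · β`. -/
theorem SpinHalf.of_signs {d N : ℕ} {D : WallData d}
    {Γ : (Fin d → ℤ) → Matrix (Fin N) (Fin N) ℝ} (hD : RealisesCartan D)
    (hA : KacMoody.IsSimplyLaced D.cartan) (B : (Fin d → ℤ) → (Fin d → ℤ) → ℤ)
    (hB : ∀ m m', D.dot (D.wall m) (D.wall m') = B m m')
    (hc : ∀ m m', SignComm (B m m') (Γ m) (Γ m'))
    (hsq : ∀ m, B m m = 2 → Γ m * Γ m = -1) : SpinHalf D Γ where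
  sq m hm := hsq m (by exact_mod_cast (hB m m).symm.trans (dot_wall_self hD hA hm))
  anticomm m m' _ _ h := by
    refine (hc m m').eq_neg ?_
    rw [hB] at h
    rcases h with h | h
    · have : B m m' = -1 := by exact_mod_cast h
      rw [this]; decide
    · have : B m m' = 1 := by exact_mod_cast h
      rw [this]; decide
  comm m m' _ _ h := by
    rw [hB] at h
    have h0 : B m m' = 0 := by exact_mod_cast h
    have := hc m m'
    rwa [h0, SignComm, zpow_zero, one_smul] at this

end Spin

end

noncomputable section

namespace Spin

open Matrix

/-! ### Wall metrics and Cartan matrices -/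

section Metrics

variable {d : ℕ} {D : WallData d} {w u : Fin d → ℝ} {c : ℝ}

/-- A rank-one update is inverted explicitly by `diagonal w⁻¹ - u uᵀ`. Here `w u = u` makes the
diagonal part invisible on `u`, and `c (u·u - 1) = 1` cancels the remaining multiples of `u uᵀ`. -/
theorem metric_mul_lowMetric (hD : D.metric = diagonal w - c • vecMulVec u u)
    (hw : ∀ a, w a ≠ 0) (hwu : ∀ a, w a * u a = u a) (hc : c * (u ⬝ᵥ u - 1) = 1) :
    D.metric * D.lowMetric = 1 := by
  have h1 : diagonal w * vecMulVec u u = vecMulVec u u := by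
    ext a b
    rw [diagonal_mul, vecMulVec_apply, ← mul_assoc, hwu]
  have h2 : vecMulVec u u * diagonal w⁻¹ = vecMulVec u u := by
    ext a b
    rw [mul_diagonal, vecMulVec_apply, Pi.inv_apply, mul_assoc]
    congr 1
    rw [← div_eq_mul_inv, div_eq_iff (hw b), mul_comm, hwu]
  have h3 : diagonal w * diagonal w⁻¹ = 1 := by
    rw [diagonal_mul_diagonal, ← diagonal_one]
    congr 1
    funext a
    exact mul_inv_cancel₀ (hw a)
  refine mul_nonsing_inv _ (isUnit_det_of_right_inverse
    (B := diagonal w⁻¹ - vecMulVec u u) ?_)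
  rw [hD, sub_mul, mul_sub, mul_sub, h1, h3, smul_mul_assoc, smul_mul_assoc, h2,
    vecMulVec_mul_vecMulVec, vecMulVec_smul]
  linear_combination (norm := module) hc • vecMulVec u u

theorem dot_eq_of_metric (hD : D.metric = diagonal w - c • vecMulVec u u) (v v' : Fin d → ℝ) :
    D.dot v v' = ∑ a, w a * (v a * v' a) - c * ((∑ a, u a * v a) * ∑ a, u a * v' a) := by
  rw [D.dot_eq, hD, sub_mulVec, dotProduct_sub, smul_mulVec, dotProduct_smul, vecMulVec_mulVec,
    op_smul_eq_smul, dotProduct_smul, smul_eq_mul, smul_eq_mul, dotProduct_comm v u,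
    mul_comm (u ⬝ᵥ v')]
  congr 1
  refine Finset.sum_congr rfl fun a _ => ?_
  rw [mulVec_diagonal]
  ring

end Metrics

theorem dynkinCartan_isSimplyLaced (d : ℕ) (edge : ℕ → ℕ → Bool) :
    KacMoody.IsSimplyLaced (dynkinCartan d edge) where
  diag i := if_pos rfl
  symm i j := by
    simp only [dynkinCartan, Bool.or_comm (edge i j), eq_comm (a := i)]
  off_diag i j hij := by
    simp only [dynkinCartan, if_neg hij]
    split_ifs <;> simp

section Components

variable {d k : ℕ}

theorem components_single (r : Fin d → Fin k → ℤ) (i : Fin d) :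
    components r (Pi.single i 1) = r i := by
  funext a
  simp [components, Pi.single_apply]

theorem sum_components (r : Fin d → Fin k → ℤ) (m : Fin d → ℤ) :
    ∑ a, components r m a = ∑ i, m i * ∑ a, r i a := by
  simp only [components, Finset.mul_sum]
  exact Finset.sum_comm

theorem sum_chainRoot_mul {i : ℕ} (hi : i + 1 < d) (F : Fin d → ℤ) :
    ∑ a : Fin d, chainRoot i a * F a = F ⟨i, by omega⟩ - F ⟨i + 1, hi⟩ := by
  have : ∀ a : Fin d, chainRoot i a * F a = (if a = ⟨i, by omega⟩ then F a else 0)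
      - if a = ⟨i + 1, hi⟩ then F a else 0 := by
    intro a
    simp only [chainRoot, Fin.ext_iff]
    split_ifs <;> omega
  simp only [this, Finset.sum_sub_distrib, Finset.sum_ite_eq', Finset.mem_univ, if_true]

end Components

/-! ### The algebras `AE_d` -/

section AE

variable {d : ℕ}

theorem rootAE_chain {i : Fin d} (hi : (i : ℕ) + 1 < d) (a : Fin d) :
    rootAE d i a = chainRoot i a := if_pos hi

/-- The last root is `(1,…,1)` minus the first two unit vectors plus the last one; `d > 3` keeps
these positions apart. -/
theorem sum_rootAE_last_mul (hd : 3 < d) {i : Fin d} (hi : ¬(i : ℕ) + 1 < d) (F : Fin d → ℤ) :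
    ∑ a, rootAE d i a * F a
      = ∑ a, F a - F ⟨0, by omega⟩ - F ⟨1, by omega⟩ + F ⟨d - 1, by omega⟩ := by
  have : ∀ a : Fin d, rootAE d i a * F a = F a - (if a = ⟨0, by omega⟩ then F a else 0)
      - (if a = ⟨1, by omega⟩ then F a else 0) + if a = ⟨d - 1, by omega⟩ then F a else 0 := by
    intro a
    simp only [rootAE, if_neg hi, Fin.ext_iff]
    have := a.isLt
    split_ifs <;> omega
  simp only [this, Finset.sum_sub_distrib, Finset.sum_add_distrib, Finset.sum_ite_eq',
    Finset.mem_univ, if_true]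

theorem sum_rootAE (hd : 3 < d) (i : Fin d) :
    ∑ a, rootAE d i a = if (i : ℕ) + 1 < d then 0 else (d : ℤ) - 1 := by
  split_ifs with hi
  · have := sum_chainRoot_mul hi fun _ => 1
    simpa [rootAE_chain hi] using this
  · have := sum_rootAE_last_mul hd hi fun _ => 1
    simp only [mul_one, Finset.sum_const, Finset.card_univ, Fintype.card_fin, nsmul_eq_mul] at this
    rw [this]; ring

/-- Chain roots have component sum zero and the last root has sum `d - 1`. So the exponent of `Γ_*`
is the integer multiplicity of the last simple root. -/
theorem sum_components_rootAE (hd : 3 < d) (m : Fin d → ℤ) :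
    ∑ a, components (rootAE d) m a = ((d : ℤ) - 1) * m ⟨d - 1, by omega⟩ := by
  rw [sum_components, Finset.sum_eq_single ⟨d - 1, by omega⟩]
  · rw [sum_rootAE hd, if_neg (by simp; omega), mul_comm]
  · intro i _ hi
    rw [sum_rootAE hd, if_pos, mul_zero]
    have := i.isLt
    have h2 : (i : ℕ) ≠ d - 1 := fun h => hi (Fin.ext h)
    omega
  · exact fun h => absurd (Finset.mem_univ _) h

theorem isSimplyLaced_dataAE (d : ℕ) : KacMoody.IsSimplyLaced (dataAE d).cartan := by
  dsimp only [dataAE]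
  exact dynkinCartan_isSimplyLaced d _

theorem dataAE_metric : (dataAE d).metric
    = diagonal (fun _ => 1) - (1 / ((d : ℝ) - 1)) • vecMulVec (fun _ => 1) fun _ => 1 := by
  ext a b
  simp only [dataAE, delta, Matrix.sub_apply, Matrix.smul_apply, vecMulVec_apply,
    diagonal_apply, smul_eq_mul, mul_one]

theorem dataAE_metric_mul_lowMetric (hd : 3 < d) :
    (dataAE d).metric * (dataAE d).lowMetric = 1 := by
  refine metric_mul_lowMetric dataAE_metric (fun _ => one_ne_zero) (fun _ => one_mul _) ?_
  have : (d : ℝ) - 1 ≠ 0 := by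
    have : (3 : ℝ) < d := by exact_mod_cast hd
    linarith
  simp only [dotProduct, mul_one, Finset.sum_const, Finset.card_univ, Fintype.card_fin,
    nsmul_eq_mul]
  field_simp

/-- The bilinear form on the root lattice of `AE_d`. -/
def formAE (hd : 3 < d) (m m' : Fin d → ℤ) : ℤ :=
  ∑ a, components (rootAE d) m a * components (rootAE d) m' a
    - ((d : ℤ) - 1) * (m ⟨d - 1, by omega⟩ * m' ⟨d - 1, by omega⟩)

theorem dot_wall_dataAE (hd : 3 < d) (m m' : Fin d → ℤ) :
    (dataAE d).dot ((dataAE d).wall m) ((dataAE d).wall m') = formAE hd m m' := by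
  have h0 : (d : ℝ) - 1 ≠ 0 := by
    have : (3 : ℝ) < d := by exact_mod_cast hd
    linarith
  have hw : ∀ m a, (dataAE d).wall m a = (components (rootAE d) m a : ℝ) := by
    intro m a
    simp [WallData.wall, components, dataAE]
  have hs : ∀ m, ∑ a, (components (rootAE d) m a : ℝ) = (d - 1) * m ⟨d - 1, by omega⟩ := by
    intro m
    exact_mod_cast congrArg (Int.cast (R := ℝ)) (sum_components_rootAE hd m)
  rw [dot_eq_of_metric dataAE_metric]
  simp only [hw, one_mul, hs, formAE]
  push_cast
  field_simp

theorem formAE_single (hd : 3 < d) (i j : Fin d) :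
    formAE hd (Pi.single i 1) (Pi.single j 1) = (dataAE d).cartan i j := by
  have hval : ∀ i : Fin d, ¬(i : ℕ) + 1 < d → i = ⟨d - 1, by omega⟩ := fun i hi =>
    Fin.ext (by have := i.isLt; simp only; omega)
  have hne : ∀ i : Fin d, (i : ℕ) + 1 < d → (⟨d - 1, by omega⟩ : Fin d) ≠ i := fun i hi h => by
    have := congrArg Fin.val h
    simp only at this
    omega
  have chain : ∀ i j : Fin d, (i : ℕ) + 1 < d →
      formAE hd (Pi.single i 1) (Pi.single j 1) = (dataAE d).cartan i j := by
    intro i j hi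
    have := i.isLt
    have := j.isLt
    rw [formAE, components_single, components_single, Pi.single_eq_of_ne (hne i hi)]
    simp only [rootAE_chain hi]
    rw [sum_chainRoot_mul hi]
    simp only [rootAE, chainRoot, dataAE, dynkinCartan, Fin.ext_iff, Bool.or_eq_true,
      Bool.and_eq_true, beq_iff_eq, decide_eq_true_eq]
    split_ifs <;> omega
  by_cases hi : (i : ℕ) + 1 < d
  · exact chain i j hi
  by_cases hj : (j : ℕ) + 1 < d
  · rw [(isSimplyLaced_dataAE d).symm i j]
    refine Eq.trans ?_ (chain j i hj)
    simp only [formAE, mul_comm]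
  · obtain rfl := hval i hi
    obtain rfl := hval j hj
    have h0 : ¬ d - 1 < 2 := by omega
    have h1 : ¬ d - 1 + 1 < d := by omega
    -- For the last root with itself the component sum of squares is `(d - 1) + 2`, and the metric
    -- correction removes `d - 1`.
    rw [formAE, components_single, sum_rootAE_last_mul hd hi, sum_rootAE hd, if_neg hi,
      Pi.single_eq_same, (isSimplyLaced_dataAE d).diag]
    simp [rootAE, h0, h1]

theorem realisesCartan_dataAE (hd : 3 < d) : RealisesCartan (dataAE d) := fun i j => by
  rw [← wall_single, ← wall_single, dot_wall_dataAE hd, formAE_single hd]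

end AE

/-! ### The algebra `E₁₀` -/

theorem sum_components_rootE10 (m : Fin 10 → ℤ) : ∑ a, components rootE10 m a = 3 * m 9 := by
  have : ∀ i, ∑ a, rootE10 i a = if i = 9 then 3 else 0 := by decide +kernel
  rw [sum_components]
  simp [this, mul_comm]

theorem isSimplyLaced_dataE10 : KacMoody.IsSimplyLaced dataE10.cartan := by
  dsimp only [dataE10]
  exact dynkinCartan_isSimplyLaced 10 _

theorem dataE10_metric : dataE10.metric
    = diagonal (fun _ => 1) - (1 / 9 : ℝ) • vecMulVec (fun _ => 1) fun _ => 1 := by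
  ext a b
  simp only [dataE10, delta, Matrix.sub_apply, Matrix.smul_apply, vecMulVec_apply,
    diagonal_apply, smul_eq_mul, mul_one]

theorem dataE10_metric_mul_lowMetric : dataE10.metric * dataE10.lowMetric = 1 := by
  refine metric_mul_lowMetric dataE10_metric (fun _ => one_ne_zero) (fun _ => one_mul _) ?_
  norm_num [dotProduct]

/-- The bilinear form on the root lattice of `E₁₀`. -/
def formE10 (m m' : Fin 10 → ℤ) : ℤ :=
  ∑ a, components rootE10 m a * components rootE10 m' a - m 9 * m' 9

theorem dot_wall_dataE10 (m m' : Fin 10 → ℤ) :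
    dataE10.dot (dataE10.wall m) (dataE10.wall m') = formE10 m m' := by
  have hw : ∀ m a, dataE10.wall m a = (components rootE10 m a : ℝ) := by
    intro m a
    simp [WallData.wall, components, dataE10]
  have hs : ∀ m, ∑ a, (components rootE10 m a : ℝ) = 3 * m 9 := by
    intro m
    exact_mod_cast congrArg (Int.cast (R := ℝ)) (sum_components_rootE10 m)
  rw [dot_eq_of_metric dataE10_metric]
  simp only [hw, one_mul, hs, formE10]
  push_cast
  ring

theorem realisesCartan_dataE10 : RealisesCartan dataE10 := fun i j => by
  have h : ∀ i j : Fin 10, ∑ a, rootE10 i a * rootE10 j a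
      - (if 9 = i then 1 else 0) * (if 9 = j then 1 else 0)
      = dataE10.cartan i j := by dsimp only [dataE10, dynkinCartan]; decide +kernel
  rw [← wall_single, ← wall_single, dot_wall_dataE10, ← h, formE10, components_single,
    components_single]
  simp only [Pi.single_apply]

/-! ### The algebra `DE₁₀` -/

theorem sum_components_rootDE10 (m : Fin 10 → ℤ) :
    ∑ a, components rootDE10 m a = 2 * m 8 + 6 * m 9 := by
  have : ∀ i, ∑ a, rootDE10 i a = (if i = 8 then 2 else 0) + if i = 9 then 6 else 0 := by
    decide +kernel
  rw [sum_components]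
  simp [this, mul_comm, mul_add, Finset.sum_add_distrib]

theorem isSimplyLaced_dataDE10 : KacMoody.IsSimplyLaced dataDE10.cartan := by
  dsimp only [dataDE10]
  exact dynkinCartan_isSimplyLaced 10 _

theorem dataDE10_metric : dataDE10.metric
    = diagonal (fun a : Fin 10 => if (a : ℕ) < 9 then (1 : ℝ) else 2)
      - (1 / 8 : ℝ) • vecMulVec (fun a : Fin 10 => if (a : ℕ) < 9 then (1 : ℝ) else 0)
        fun a : Fin 10 => if (a : ℕ) < 9 then (1 : ℝ) else 0 := by
  ext a b
  simp only [dataDE10, delta, Matrix.sub_apply, Matrix.smul_apply, vecMulVec_apply,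
    diagonal_apply, smul_eq_mul]
  by_cases hab : a = b
  · subst hab
    by_cases ha : (a : ℕ) < 9 <;> simp [ha]
  · by_cases ha : (a : ℕ) < 9 <;> by_cases hb : (b : ℕ) < 9 <;> simp [ha, hb, hab]

theorem dataDE10_metric_mul_lowMetric : dataDE10.metric * dataDE10.lowMetric = 1 := by
  refine metric_mul_lowMetric dataDE10_metric (fun a => ?_) (fun a => ?_) ?_
  · split_ifs <;> norm_num
  · split_ifs <;> norm_num
  · norm_num [dotProduct, Fin.sum_univ_succ]

/-- The bilinear form on the root lattice of `DE₁₀`. -/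
def formDE10 (m m' : Fin 10 → ℤ) : ℤ :=
  ∑ a, components rootDE10 m a * components rootDE10 m' a
    - 2 * (m 8 * m' 9 + m 9 * m' 8) - 4 * (m 9 * m' 9)

theorem dot_wall_dataDE10 (m m' : Fin 10 → ℤ) :
    dataDE10.dot (dataDE10.wall m) (dataDE10.wall m') = formDE10 m m' := by
  have hw : ∀ m (a : Fin 9), dataDE10.wall m a.castSucc = (components rootDE10 m a : ℝ) := by
    intro m a
    simp [WallData.wall, components, dataDE10]
  have hl : ∀ m, dataDE10.wall m (Fin.last 9) = ((m 8 : ℝ) - m 9) / 2 := by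
    intro m
    have : ∀ i : Fin 10, dilatonDE10 i
        = (if i = 8 then 1 / 2 else 0) - if i = 9 then 1 / 2 else 0 := by
      intro i
      fin_cases i <;> simp [dilatonDE10]
    simp [WallData.wall, dataDE10, this, mul_sub, Finset.sum_sub_distrib]
    ring
  have hs : ∀ m, ∑ a, (components rootDE10 m a : ℝ) = 2 * m 8 + 6 * m 9 := by
    intro m
    exact_mod_cast congrArg (Int.cast (R := ℝ)) (sum_components_rootDE10 m)
  rw [dot_eq_of_metric dataDE10_metric]
  simp only [Fin.sum_univ_castSucc (n := 9), hw, hl, Fin.val_castSucc, Fin.is_lt, if_true, one_mul,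
    Fin.val_last, lt_irrefl, if_false, zero_mul, add_zero, hs, formDE10]
  push_cast
  ring

theorem realisesCartan_dataDE10 : RealisesCartan dataDE10 := fun i j => by
  have h : ∀ i j : Fin 10, ∑ a, rootDE10 i a * rootDE10 j a
      - 2 * ((if 8 = i then 1 else 0) * (if 9 = j then 1 else 0)
        + (if 9 = i then 1 else 0) * (if 8 = j then 1 else 0))
      - 4 * ((if 9 = i then 1 else 0) * (if 9 = j then 1 else 0))
      = dataDE10.cartan i j := by dsimp only [dataDE10, dynkinCartan]; decide +kernel
  rw [← wall_single, ← wall_single, dot_wall_dataDE10, ← h, formDE10, components_single,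
    components_single]
  simp only [Pi.single_apply]

end Spin

end

noncomputable section

namespace Spin

open Matrix

/-! ### The gamma matrices `Γ(α)` -/

section Gamma

variable {N : ℕ}

/-- With `∑ p = 3 m` for the last multiplicity `m`, the commutation exponent differs from `α · β` by
`10 m m' - 2 ∑ p p'`, which is even. On a vector of length two the squaring exponent is `4 m² - 1`,
which is odd. -/
theorem spinHalf_e10 {γ : Fin 10 → Matrix (Fin N) (Fin N) ℝ} (hγ : IsClifford (fun _ => 1) γ) :
    SpinHalf dataE10 fun m => gammaMonomial γ (components rootE10 m) := by
  refine .of_signs realisesCartan_dataE10 isSimplyLaced_dataE10 formE10 dot_wall_dataE10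
    (fun m m' => (hγ.signComm_gammaMonomial _ _).congr ?_) fun m hm => ?_
  · rw [sum_components_rootE10, sum_components_rootE10, formE10]
    exact ⟨5 * (m 9 * m' 9) - ∑ a, components rootE10 m a * components rootE10 m' a, by ring⟩
  · obtain ⟨e, he, h⟩ := hγ.gammaMonomial_mul_self (components rootE10 m)
    rw [sum_components_rootE10] at he
    simp only [formE10, ← pow_two] at hm
    have : Odd e := ⟨2 * m 9 ^ 2 - 1, by linarith⟩
    rw [h, this.neg_one_zpow, neg_one_smul]

theorem spinHalf_de10 {γ : Fin 9 → Matrix (Fin N) (Fin N) ℝ} (hγ : IsClifford (fun _ => 1) γ) :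
    SpinHalf dataDE10 fun m => gammaMonomial γ (components rootDE10 m) := by
  refine .of_signs realisesCartan_dataDE10 isSimplyLaced_dataDE10 formDE10 dot_wall_dataDE10
    (fun m m' => (hγ.signComm_gammaMonomial _ _).congr ?_) fun m hm => ?_
  · rw [sum_components_rootDE10, sum_components_rootDE10, formDE10]
    exact ⟨2 * (m 8 + 3 * m 9) * (m' 8 + 3 * m' 9) + (m 8 * m' 9 + m 9 * m' 8)
      + 2 * (m 9 * m' 9) - ∑ a, components rootDE10 m a * components rootDE10 m' a, by ring⟩
  · obtain ⟨e, he, h⟩ := hγ.gammaMonomial_mul_self (components rootDE10 m)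
    rw [sum_components_rootDE10] at he
    simp only [formDE10, ← pow_two] at hm
    have : Odd e := ⟨(m 8 + 3 * m 9) ^ 2 - 1 - m 8 * m 9 - m 9 ^ 2, by linarith⟩
    rw [h, this.neg_one_zpow, neg_one_smul]

section AE

variable {d : ℕ} {γ : Fin (d + 1) → Matrix (Fin N) (Fin N) ℝ}

theorem IsClifford.succ (hγ : IsClifford (Fin.cons (-1) fun _ => 1) γ) :
    IsClifford (fun _ => 1) fun a : Fin d => γ a.succ := by
  intro a b
  rw [hγ a.succ b.succ]
  simp only [Fin.succ_inj, Fin.cons_succ]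

theorem gammaAE_eq (hd : 3 < d) (m : Fin d → ℤ) :
    gammaAE γ m = gammaMonomial (fun a : Fin d => γ a.succ) (components (rootAE d) m)
      * gammaStar γ ^ m ⟨d - 1, by omega⟩ := by
  rw [gammaAE, sum_components_rootAE hd, Int.mul_ediv_cancel_left _ (by omega)]

theorem signComm_gammaStar (hγ : IsClifford (Fin.cons (-1) fun _ => 1) γ) (μ : Fin (d + 1)) :
    SignComm d (γ μ) (gammaStar γ) := by
  have h : SignComm (∑ b, if μ = b then 0 else 1) (γ μ) (gammaStar γ) :=
    SignComm.prod_right fun b => hγ.signComm μ b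
  have e : (∑ b, if μ = b then (0 : ℤ) else 1) = d := by
    have : ∀ b, (if μ = b then (0 : ℤ) else 1) = 1 - if μ = b then 1 else 0 := by
      intro b; split_ifs <;> rfl
    simp [this, Finset.sum_sub_distrib]
  rwa [e] at h

/-- The time-like square gives one sign, moving `Γ_0` past `d` spatial factors gives `d`, and the
spatial product squares with exponent `t = d(d-1)/2`. -/
theorem gammaStar_mul_self (hγ : IsClifford (Fin.cons (-1) fun _ => 1) γ) :
    ∃ t : ℤ, 2 * t = (d : ℤ) ^ 2 - d ∧
      gammaStar γ * gammaStar γ = (-1 : ℝ) ^ (d + 1 + t) • 1 := by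
  obtain ⟨t, ht, h⟩ := prod_mul_self (fun a : Fin d => γ a.succ) (fun _ => 1)
    (fun a => by rw [hγ.succ.sq, one_smul]) fun a b hab => by
      have := hγ.succ.signComm a b
      rwa [if_neg hab] at this
  refine ⟨t, by simpa using ht, ?_⟩
  have h3 : SignComm (∑ _b : Fin d, 1) (γ 0) (List.ofFn fun a : Fin d => γ a.succ).prod :=
    SignComm.prod_right fun b => by
      have := hγ.signComm 0 b.succ
      rwa [if_neg (Fin.succ_ne_zero b).symm] at this
  have h4 := h3.symm
  simp only [Finset.sum_const, Finset.card_univ, Fintype.card_fin, nsmul_eq_mul, mul_one,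
    SignComm] at h4
  have h0 : γ 0 * γ 0 = (-1 : ℝ) ^ (1 : ℤ) • 1 := by rw [hγ.sq]; simp
  rw [gammaStar, List.ofFn_succ, List.prod_cons]
  set M := (List.ofFn fun a : Fin d => γ a.succ).prod
  calc γ 0 * M * (γ 0 * M) = γ 0 * (M * γ 0) * M := by simp only [mul_assoc]
    _ = (-1 : ℝ) ^ (d : ℤ) • ((γ 0 * γ 0) * (M * M)) := by
      rw [h4, mul_smul_comm, smul_mul_assoc]; simp only [mul_assoc]
    _ = _ := by
      rw [h0, h, smul_mul_smul_comm, mul_one, smul_smul, neg_one_zpow_add, neg_one_zpow_add,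
        mul_assoc]

theorem zpow_mul_self {S : Matrix (Fin N) (Fin N) ℝ} {s : ℤ} (h : S * S = (-1 : ℝ) ^ s • 1)
    (k : ℤ) : S ^ k * S ^ k = (-1 : ℝ) ^ (k * s) • 1 := by
  have key : ∀ n : ℕ, S ^ n * S ^ n = (-1 : ℝ) ^ (n * s) • 1 := by
    intro n
    rw [← (Commute.refl S).mul_pow, h, smul_pow, one_pow, ← zpow_natCast, ← _root_.zpow_mul,
      mul_comm s]
  obtain ⟨n, rfl | rfl⟩ := k.eq_nat_or_neg
  · rw [zpow_natCast]; exact key n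
  · rw [zpow_neg_natCast, ← Matrix.mul_inv_rev, key]
    refine inv_eq_right_inv ?_
    rw [smul_mul_smul_comm, mul_one, ← neg_one_zpow_add, neg_mul, add_neg_cancel, zpow_zero,
      one_smul]

theorem isUnit_det_gammaStar (hγ : IsClifford (Fin.cons (-1) fun _ => 1) γ) :
    IsUnit (gammaStar γ).det := by
  obtain ⟨t, -, h⟩ := gammaStar_mul_self hγ
  exact isUnit_det_of_right_inverse (B := (-1 : ℝ) ^ (d + 1 + t) • gammaStar γ) (by
    rw [mul_smul_comm, h, smul_smul, neg_one_zpow_mul_self, one_smul])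

theorem signComm_gammaMonomial_gammaStar (hγ : IsClifford (Fin.cons (-1) fun _ => 1) γ)
    (p : Fin d → ℤ) (k : ℤ) :
    SignComm (k * ((∑ a, p a) * d)) (gammaMonomial (fun a : Fin d => γ a.succ) p)
      (gammaStar γ ^ k) := by
  refine SignComm.zpow_right ?_ (isUnit_det_gammaStar hγ) k
  rw [Finset.sum_mul]
  exact (SignComm.gammaMonomial_right (fun a => (signComm_gammaStar hγ a.succ).symm)
    (fun a => hγ.succ.isUnit_det one_ne_zero) p).symm

theorem spinHalf_ae (hd : 3 < d) (hγ : IsClifford (Fin.cons (-1) fun _ => 1) γ) :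
    SpinHalf (dataAE d) (gammaAE γ) := by
  obtain ⟨t, ht, hS⟩ := gammaStar_mul_self hγ
  refine .of_signs (realisesCartan_dataAE hd) (isSimplyLaced_dataAE d) (formAE hd)
    (dot_wall_dataAE hd) (fun m m' => ?_) fun m hm => ?_
  · rw [gammaAE_eq hd, gammaAE_eq hd]
    have hSS : SignComm 0 (gammaStar γ) (gammaStar γ) := by simp [SignComm]
    have hu := isUnit_det_gammaStar hγ
    refine (((hγ.succ.signComm_gammaMonomial _ _).mul_right
      (signComm_gammaMonomial_gammaStar hγ _ _)).mul_left
      ((signComm_gammaMonomial_gammaStar hγ _ _).symm.mul_right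
        ((hSS.zpow_right hu _).symm.zpow_right hu _).symm)).congr ?_
    rw [sum_components_rootAE hd, sum_components_rootAE hd, formAE]
    set k := m ⟨d - 1, by omega⟩
    set k' := m' ⟨d - 1, by omega⟩
    -- The powers of `Γ_*` bring `2 d (d-1) k k'`, and the remaining difference from the bilinear
    -- form is `d(d-1) k k' - 2 ∑ p p'`; everything is even because `d(d-1) = 2t`.
    refine ⟨3 * t * (k * k') - ∑ a, components (rootAE d) m a * components (rootAE d) m' a, ?_⟩
    linear_combination (-3 * (k * k')) * ht
  · rw [gammaAE_eq hd]
    obtain ⟨e, he, h⟩ := hγ.succ.gammaMonomial_mul_self (components (rootAE d) m)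
    have hc := (signComm_gammaMonomial_gammaStar hγ (components (rootAE d) m)
      (m ⟨d - 1, by omega⟩)).symm
    rw [sum_components_rootAE hd] at he hc
    simp only [formAE, ← pow_two] at hm
    set k := m ⟨d - 1, by omega⟩
    set M := gammaMonomial (fun a : Fin d => γ a.succ) (components (rootAE d) m)
    obtain ⟨v, hv⟩ := Int.even_mul_succ_self k
    have hc' : gammaStar γ ^ k * M = M * gammaStar γ ^ k := by
      rw [hc, Even.neg_one_zpow, one_smul]
      exact ⟨t * k ^ 2, by linear_combination (-k ^ 2) * ht⟩
    have ht' : 2 * t * k ^ 2 = ((d : ℤ) ^ 2 - d) * k ^ 2 := by rw [ht]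
    have he' : e = (t - d + 1) * k ^ 2 - 1 := by linarith
    -- The total exponent is `(t-d+1) k(k+1) + 2dk - 1`, and `k(k+1) = 2v` is even.
    have hodd : Odd (e + k * (d + 1 + t)) :=
      ⟨(t - d + 1) * v + d * k - 1, by linear_combination he' + (t - d + 1) * hv⟩
    calc M * gammaStar γ ^ k * (M * gammaStar γ ^ k)
        = M * (gammaStar γ ^ k * M) * gammaStar γ ^ k := by simp only [mul_assoc]
      _ = (M * M) * (gammaStar γ ^ k * gammaStar γ ^ k) := by rw [hc']; simp only [mul_assoc]
      _ = -1 := by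
        rw [h, zpow_mul_self hS, smul_mul_smul_comm, mul_one, ← neg_one_zpow_add,
          hodd.neg_one_zpow, neg_one_smul]

end AE

/-! ### Matrices which anticommute with the `Γ(α_i)` -/

theorem exists_anticommuting_e10 {γ : Fin 10 → Matrix (Fin N) (Fin N) ℝ}
    (hγ : IsClifford (fun _ => 1) γ) : ∃ T T' : Matrix (Fin N) (Fin N) ℝ, T' * T = 1 ∧
      ∀ i, T * gammaMonomial γ (components rootE10 (Pi.single i 1))
        = -(gammaMonomial γ (components rootE10 (Pi.single i 1)) * T) := by
  -- The witness multiplies every second gamma matrix. A chain root involves two neighbours, exactly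
  -- one of which occurs in the product, so the sign is odd; the last root gives `5 · 3 - 2 = 13`.
  obtain ⟨T', hT⟩ := hγ.exists_left_inverse fun a => (a : ℤ) % 2
  refine ⟨_, T', hT, fun i => ?_⟩
  have h : ∀ i : Fin 10, (∑ a : Fin 10, (a : ℤ) % 2) * ∑ a, rootE10 i a
      - ∑ a : Fin 10, (a : ℤ) % 2 * rootE10 i a ∈ [-1, 1, 13] := by decide +kernel
  rw [components_single]
  refine (hγ.signComm_gammaMonomial _ _).eq_neg ?_
  have := h i
  simp only [List.mem_cons, List.not_mem_nil, or_false] at this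
  rcases this with h | h | h <;> rw [h] <;> decide

theorem exists_anticommuting_de10 {γ : Fin 9 → Matrix (Fin N) (Fin N) ℝ}
    (hγ : IsClifford (fun _ => 1) γ) : ∃ T T' : Matrix (Fin N) (Fin N) ℝ, T' * T = 1 ∧
      ∀ i, T * gammaMonomial γ (components rootDE10 (Pi.single i 1))
        = -(gammaMonomial γ (components rootDE10 (Pi.single i 1)) * T) := by
  -- Here the five gamma matrices at even zero-based positions are taken. The two non-chain roots
  -- give the odd exponents `5 · 2 - 1 = 9` and `5 · 6 - 3 = 27`.
  obtain ⟨T', hT⟩ := hγ.exists_left_inverse fun a => ((a : ℤ) + 1) % 2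
  refine ⟨_, T', hT, fun i => ?_⟩
  have h : ∀ i : Fin 10, (∑ a : Fin 9, ((a : ℤ) + 1) % 2) * ∑ a, rootDE10 i a
      - ∑ a : Fin 9, ((a : ℤ) + 1) % 2 * rootDE10 i a ∈ [-1, 1, 9, 27] := by
    decide +kernel
  rw [components_single]
  refine (hγ.signComm_gammaMonomial _ _).eq_neg ?_
  have := h i
  simp only [List.mem_cons, List.not_mem_nil, or_false] at this
  rcases this with h | h | h | h <;> rw [h] <;> decide

theorem exists_anticommuting_ae {d : ℕ} {γ : Fin (d + 1) → Matrix (Fin N) (Fin N) ℝ} (hd : 3 < d)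
    (hγ : IsClifford (Fin.cons (-1) fun _ => 1) γ) :
    ∃ T T' : Matrix (Fin N) (Fin N) ℝ, T' * T = 1 ∧
      ∀ i, T * gammaAE γ (Pi.single i 1) = -(gammaAE γ (Pi.single i 1) * T) := by
  -- The alternating pattern handles chain roots. Its phase, depending on `d`, makes the last entry
  -- `1`, so that `q_{d-1} = q_0 + q_1`. The factor `γ 0` commutes with the chain generators and
  -- supplies the odd sign for the last root.
  let q : Fin d → ℤ := fun a => ((a : ℤ) + 1 + d + 1) % 2
  obtain ⟨T', hT⟩ := hγ.succ.exists_left_inverse q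
  refine ⟨γ 0 * gammaMonomial (fun a : Fin d => γ a.succ) q, T' * -γ 0, ?_, fun i => ?_⟩
  · have h0 : γ 0 * γ 0 = -1 := by rw [hγ.sq]; simp
    rw [mul_assoc, ← mul_assoc (-γ 0), neg_mul, h0, neg_neg, one_mul, hT]
  · have h0 : ∀ p : Fin d → ℤ, SignComm (∑ a, p a) (γ 0)
        (gammaMonomial (fun a : Fin d => γ a.succ) p) := by
      intro p
      have := SignComm.gammaMonomial_right (A := γ 0) (γ := fun a : Fin d => γ a.succ)
        (E := fun _ => 1) (fun a => by
          have := hγ.signComm 0 a.succ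
          rwa [if_neg (Fin.succ_ne_zero a).symm] at this)
        (fun a => hγ.succ.isUnit_det one_ne_zero) p
      simpa using this
    rw [gammaAE_eq hd, components_single]
    refine (((h0 _).mul_right ((signComm_gammaStar hγ 0).zpow_right (isUnit_det_gammaStar hγ)
      _)).mul_left ((hγ.succ.signComm_gammaMonomial _ _).mul_right
      (signComm_gammaMonomial_gammaStar hγ _ _))).eq_neg ?_
    simp only [mul_comm (q _) (rootAE d i _)]
    rw [sum_rootAE hd]
    split_ifs with hi
    · have hne : (⟨d - 1, by omega⟩ : Fin d) ≠ i := fun h => by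
        have := congrArg Fin.val h
        simp only at this
        omega
      simp only [rootAE_chain hi]
      rw [sum_chainRoot_mul hi, Pi.single_eq_of_ne hne]
      simp only [q]
      push_cast
      rw [Int.odd_iff]
      omega
    · have hii : i = ⟨d - 1, by omega⟩ := Fin.ext (by have := i.isLt; simp only; omega)
      have hs : (Pi.single i 1 : Fin d → ℤ) ⟨d - 1, by omega⟩ = 1 := by
        rw [← hii, Pi.single_eq_same]
      rw [sum_rootAE_last_mul hd hi, hs]
      have hq : q ⟨d - 1, by omega⟩ - q ⟨0, by omega⟩ - q ⟨1, by omega⟩ = 0 := by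
        simp only [q]
        have : ((d - 1 : ℕ) : ℤ) = d - 1 := by omega
        rw [this]
        push_cast
        omega
      exact ⟨d - 1 + (∑ a, q a) * (d - 1), by linear_combination -hq⟩

theorem IsGamma.spinHalf {d : ℕ} {D : WallData d}
    {Γ : (Fin d → ℤ) → Matrix (Fin N) (Fin N) ℝ} (h : IsGamma D Γ) : SpinHalf D Γ := by
  cases h with
  | ae d hd N γ hγ => exact spinHalf_ae hd hγ
  | e10 N γ hγ => exact spinHalf_e10 hγ
  | de10 N γ hγ => exact spinHalf_de10 hγ

theorem IsGamma.exists_anticommuting {d : ℕ} {D : WallData d}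
    {Γ : (Fin d → ℤ) → Matrix (Fin N) (Fin N) ℝ} (h : IsGamma D Γ) :
    ∃ T T' : Matrix (Fin N) (Fin N) ℝ, T' * T = 1 ∧
      ∀ i, T * Γ (Pi.single i 1) = -(Γ (Pi.single i 1) * T) := by
  cases h with
  | ae d hd N γ hγ => exact exists_anticommuting_ae hd hγ
  | e10 N γ hγ => exact exists_anticommuting_e10 hγ
  | de10 N γ hγ => exact exists_anticommuting_de10 hγ

end Gamma

/-! ### Assembling the three families -/

theorem IsListed.properties {d : ℕ} {D : WallData d} (hD : IsListed D) :
    RealisesCartan D ∧ KacMoody.IsSimplyLaced D.cartan ∧ D.metric * D.lowMetric = 1 ∧ d ≠ 0 := by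
  cases hD with
  | ae d hd => exact ⟨realisesCartan_dataAE hd, isSimplyLaced_dataAE d,
      dataAE_metric_mul_lowMetric hd, by omega⟩
  | e10 => exact ⟨realisesCartan_dataE10, isSimplyLaced_dataE10, dataE10_metric_mul_lowMetric,
      by omega⟩
  | de10 => exact ⟨realisesCartan_dataDE10, isSimplyLaced_dataDE10,
      dataDE10_metric_mul_lowMetric, by omega⟩

end Spin

end

theorem mainTheorem2 {d : ℕ} (D : Spin.WallData d) (hD : Spin.IsListed D) :
    -- the simple roots realise the Cartan matrix
    (∀ i j, D.dot (D.simpleRoot i) (D.simpleRoot j) = D.cartan i j) ∧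
    -- the polarisation tensors solve the polarisation equations on all real roots
    Spin.SolvesPolarisationEquations D (Spin.pol32 D) ∧
    Spin.SolvesPolarisationEquations D (Spin.pol52 D) ∧
    (∀ ε : ℝ, ε = 1 ∨ ε = -1 →
      Spin.SolvesPolarisationEquations D (fun α => Spin.pol72 D α ε)) ∧
    -- the resulting representations
    ∀ (N : ℕ) (Γ : (Fin d → ℤ) → Matrix (Fin N) (Fin N) ℝ), Spin.IsGamma D Γ →
      (Spin.SatisfiesBerman D (Spin.SpinorTensor 1 d N) (Spin.spinFamily D (Spin.pol32 D) Γ) ∧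
        ∃ ρ, Spin.IsRepresentationBy D (Spin.SpinorTensor 1 d N)
          (Spin.spinFamily D (Spin.pol32 D) Γ) ρ) ∧
      (∀ ε : ℝ, ε = 1 ∨ ε = -1 →
        Spin.SatisfiesBerman D (Spin.SpinorTensor 3 d N)
          (Spin.spinFamily D (fun α => Spin.pol72 D α ε) Γ) ∧
        ∃ ρ, Spin.IsRepresentationBy D (Spin.SpinorTensor 3 d N)
          (Spin.spinFamily D (fun α => Spin.pol72 D α ε) Γ) ρ) ∧
      Spin.SatisfiesBerman D (Spin.SpinorTensor 2 d N) (Spin.spinFamily D (Spin.pol52 D) Γ) ∧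
      ∃ ρ, Spin.IsRepresentationBy D (Spin.SpinorTensor 2 d N)
          (Spin.spinFamily D (Spin.pol52 D) Γ) ρ ∧
        -- the `G`-trace splits off as a copy of the spin-1/2 representation
        ∃ ρ₁, Spin.IsRepresentationBy D (Fin N → ℝ) (Spin.spinHalfFamily Γ) ρ₁ ∧
          IsCompl (Spin.pureTrace D N) (LinearMap.ker (Spin.gTrace D N)) ∧
          (∀ x, ∀ φ ∈ Spin.pureTrace D N, ρ x φ ∈ Spin.pureTrace D N) ∧
          (∀ x, ∀ φ ∈ LinearMap.ker (Spin.gTrace D N),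
            ρ x φ ∈ LinearMap.ker (Spin.gTrace D N)) ∧
          ∃ e : (Fin N → ℝ) ≃ₗ[ℝ] Spin.pureTrace D N,
            ∀ x w, (e (ρ₁ x w) : Spin.SpinorTensor 2 d N) = ρ x (e w) := by

  obtain ⟨hC, hA, hG, hd⟩ := hD.properties
  have h32 := Spin.polarises_pol32 (D := D)
  have h52 := Spin.polarises_pol52 (D := D)
  have h72 := fun (ε : ℝ) (hε : ε = 1 ∨ ε = -1) => Spin.polarises_pol72 hG hε
  refine ⟨hC, h32.solves hC hA, h52.solves hC hA, fun ε hε => (h72 ε hε).solves hC hA,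
    fun N Γ hΓ => ?_⟩
  have hS := hΓ.spinHalf
  obtain ⟨T, T', hT, hTΓ⟩ := hΓ.exists_anticommuting
  obtain ⟨ρ, hρ⟩ := (h52.satisfiesBerman hC hA hS).exists_representation hC hA
  exact ⟨⟨h32.satisfiesBerman hC hA hS,
      (h32.satisfiesBerman hC hA hS).exists_representation hC hA⟩,
    fun ε hε => ⟨(h72 ε hε).satisfiesBerman hC hA hS,
      ((h72 ε hε).satisfiesBerman hC hA hS).exists_representation hC hA⟩,
    h52.satisfiesBerman hC hA hS, ρ, hρ,
    Spin.spin52_decomposition hC hA hG hd hS hT hTΓ hρ⟩
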